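/- **Setting.** Let $N\ge 1$ and $\Lambda=(\mathbb Z/N)^4$, with unit vectors $\hat\mu$ and $\hat s=\hat1+\hat2+\hat3+\hat4$; the dual lattice is $\tilde\Lambda=\Lambda+\tfrac12\hat s$ and $F(x)=x+\tfrac12\hat s$. An $r$-form on $\Lambda$ (or $\tilde\Lambda$) assigns a number $\alpha_{x,\mu_1\cdots\mu_r}$, antisymmetric in the directions, to every cell. Put $$(d\alpha)_{x,\mu_1\cdots\mu_{r}}=\sum_{j=1}^{r}(-1)^{j+1}\big[\alpha_{x+\hat\mu_j,\mu_1\cdots\mathring\mu_j\cdots\mu_r}-\alpha_{x,\mu_1\cdots\mathring\mu_j\cdots\mu_r}\big],\qquad (\partial\alpha)_{x,\mu_1\cdots\mu_r}=\sum_{\nu}\big[\alpha_{x,\mu_1\cdots\mu_r\nu}-\alpha_{x-\hat\nu,\mu_1\cdots\mu_r\nu}\big],$$ $$(\alpha\cup\beta)_{x,\mu_1\cdots\mu_{p+q}}=\sum_{\sigma\in\mathfrak S_{p+q}}\frac{\epsilon_\sigma}{p!\,q!}\,\alpha_{x,\mu_{\sigma(1)}\cdots\mu_{\sigma(p)}}\,\beta_{x+\sum_{i\le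 p}\hat\mu_{\sigma(i)},\,\mu_{\sigma(p+1)}\cdots\mu_{\sigma(p+q)}},$$ $$(\alpha\cup_1\beta)_{x,\mu_1\cdots\mu_{p+q-1}}=(-1)^q\sum_{a=1}^{p+q-1}(-1)^aP_{\mu_a}\big(P_{\mu_a}\iota_{\mu_a}\alpha\cup P_{\mu_a}\iota_{\mu_a}\beta\big)_{x,\mu_1\cdots\mathring\mu_a\cdots\mu_{p+q-1}}\qquad(\mu_1<\dots<\mu_{p+q-1})$$ for $\alpha$ a $p$-form and $\beta$ a $q$-form, where $(\iota_\mu\alpha)_{x,\mu_1\cdots}=\alpha_{x,\mu\mu_1\cdots}$, and $P_\mu$ acts on sites by $x_\nu\mapsto -x_\nu$ for $\nu\ge\mu$ and on forms by $(P_\mu\alpha)_{x,\mu_1\cdots\mu_r}=(-1)^{\#\{i:\mu_i\ge\mu\}}\alpha_{P_\mu x-\sum_{\mu_i\ge\mu}\hat\mu_i,\ \mu_1\cdots\mu_r}$. The dot denotes the Euclidean inner product of forms (sum over all cells), $\sum_x$ of a $4$-form its sum over the lattice, and $P_\partial$ is the orthogonal projection of real $2$-forms onto $\operatorname{Im}\partial$.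 For a real $1$-form $A^e$ and an integer $2$-form $n$ put $F^e=dA^e+2\pi n$ and $$Q_0=\sum_x\tfrac1{8\pi^2}F^e\cup F^e,\quad Q=Q_0+\sum_x\tfrac1{4\pi}F^e\cup_1dn,\quad \tilde Q=Q_0-\sum_x\tfrac1{4\pi}F^e\cup_1dn,\quad \mathfrak P(n)=\sum_x(n\cup n+n\cup_1dn).$$ Let $\int DA^e$, $\int DA^m$ be integration of all components of a $1$-form $A^e$ and of a $3$-form $A^m$ over $[-\pi,\pi)$ with measure $dA/2\pi$. Let $\beta>0$, $\theta\in\mathbb R$, $p,q_e,q_m\in\mathbb Z$. Let $\gamma$ be a contour (a finite collection of oriented lattice links that form closed paths) and let $\dot\gamma$ be its tangent $1$-form: $\dot\gamma_{x,\mu}$ is $+1$ if $(x,\mu)\in\gamma$, $-1$ if $(x+\hat\mu,-\mu)\in\gamma$, and $0$ otherwise, counted with multiplicity. Set $$Z[\beta,\theta]=\int DA^e\sum_{n:\,dn=0}e^{-\frac\beta2F^e\cdot F^e-i\theta Q_0},$$ $$\langle W_d^{(q_e,q_m)}(\gamma)\rangle^p_{\beta,\theta}=\frac1{Z[\beta,\theta]}\int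 DA^eDA^m\sum_n e^{-\frac\beta2F^e\cdot F^e-i\theta Q+\frac i{2\pi}\partial A^m\cdot F^e-ip\pi\mathfrak P(n)}\,e^{i\left(q_e\dot\gamma\cdot A^e-q_m\sum_x\dot\gamma\cup A^m\right)},$$ $$\langle\tilde W_d^{(q_e,q_m)}(\gamma)\rangle^p_{\beta,\theta}=\frac1{Z[\beta,\theta]}\int DA^eDA^m\sum_n e^{-\frac\beta2F^e\cdot F^e-i\theta\tilde Q+\frac i{2\pi}\partial A^m\cdot F^e-ip\pi\mathfrak P(n)}\,e^{i\left(q_e\dot\gamma\cdot A^e+q_m\sum_xA^m\cup\dot\gamma\right)},$$ where $n$ runs over the integer $2$-forms. The same definitions are used on $\tilde\Lambda$; in particular $\langle\tilde W_d(F(\gamma))\rangle$ refers to the contour $F(\gamma)$ in $\tilde\Lambda$. Finally let $$\tilde\beta=\frac{\beta}{(2\pi\beta)^2+(\theta/2\pi)^2},\qquad\tilde\theta=\frac{-\theta}{(2\pi\beta)^2+(\theta/2\pi)^2},\qquad\tau=\frac\theta{2\pi}+2\pi i\beta,\qquad q=q_e+\tau q_m .$$ **Lemma ($\mathcal S$-transformation).**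 Let $\gamma$ be a contour in $\Lambda$ and let $l$ be an integer $2$-form on $\Lambda$ with $\sum_{\nu<\rho<\sigma}\epsilon_{\mu\nu\rho\sigma}(dl)_{x+\hat\mu,\nu\rho\sigma}=-\dot\gamma_{x,\mu}$ for all $x,\mu$. Put $u=\sum_xP_\partial l\cup_1dP_\partial l\in\mathbb R$ and $v=\mathfrak P(l)\in\mathbb Z$. Poisson summation exchanges $W_d(\gamma)$ and $\tilde W_d(F(\gamma))$, replaces $(q_e,q_m)$ by $(q_m,-q_e)$ and $(\beta,\theta)$ by $(\tilde\beta,\tilde\theta)$; flipping the framing exchanges $W_d(\gamma)$ and $\tilde W_d(F(\gamma))$ and leaves the charges and couplings unchanged; the $\mathcal S$-transformation is Poisson summation followed by flipping the framing. Then $$\langle W_d^{(q_e,q_m)}(\gamma)\rangle^p_{\beta,\theta}=\exp\!\Big(-iu\pi\frac{q^2}\tau-2\pi^2u(\beta q_m^2-\tilde\beta q_e^2)\Big)(-1)^{pv(q_m^2+q_e^2)}\,\langle W_d^{(q_m,-q_e)}(\gamma)\rangle^p_{\tilde\beta,\tilde\theta},$$ $$\langle\tilde W_d^{(q_e,q_m)}(F(\gamma))\rangle^p_{\beta,\theta}=\exp\!\Big(iu\pi\frac{q^2}\tau+2\pi^2u(\beta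 q_m^2-\tilde\beta q_e^2)\Big)(-1)^{pv(q_m^2+q_e^2)}\,\langle\tilde W_d^{(q_m,-q_e)}(F(\gamma))\rangle^p_{\tilde\beta,\tilde\theta},$$ and $\mathcal S$ acts on the charges, in both framings, by $\begin{pmatrix}q_e\\q_m\end{pmatrix}\mapsto\begin{pmatrix}q_m\\-q_e\end{pmatrix}=\begin{pmatrix}0&1\\-1&0\end{pmatrix}\begin{pmatrix}q_e\\q_m\end{pmatrix}$. -/

import Mathlib

open Real MeasureTheory

namespace Villain

/-- Sites of the periodic hypercubic lattice of side `N`. For `half = false` this is the lattice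
`Λ` and the site is `coord`; for `half = true` it is the dual lattice `Λ + ŝ/2`,
`ŝ = (1,1,1,1)`, and the site is `coord + ŝ/2`. -/
structure Site (N : ℕ) (half : Bool) where
  coord : Fin 4 → ZMod N
  deriving DecidableEq

instance instFintypeSite (N : ℕ) [NeZero N] (half : Bool) : Fintype (Site N half) :=
  Fintype.ofEquiv (Fin 4 → ZMod N) ⟨Site.mk, Site.coord, fun _ => rfl, fun _ => rfl⟩

/-- The integer vector `∑_{μ ∈ S} μ̂`. -/
def dirs (N : ℕ) (S : Finset (Fin 4)) : Fin 4 → ZMod N := fun μ => if μ ∈ S then 1 else 0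

/-- The site `x + v`. -/
def Site.shift {N : ℕ} {half : Bool} (x : Site N half) (v : Fin 4 → ZMod N) : Site N half :=
  ⟨x.coord + v⟩

/-- The map `F(x) = x + ŝ/2` from the lattice to the dual lattice. -/
def toDual {N : ℕ} (x : Site N false) : Site N true := ⟨x.coord⟩

/-- The reflection `P_μ` of sites: it changes the sign of the position coordinates `x_ν`,
`ν ≥ μ`. On the dual lattice `-(c + 1/2) = (-c - 1) + 1/2`. -/
def Site.reflect {N : ℕ} {half : Bool} (μ : Fin 4) (x : Site N half) : Site N half :=
  ⟨fun ν => if μ ≤ ν then (if half then -x.coord ν - 1 else -x.coord ν) else x.coord ν⟩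

/-- An `r`-cell: a site and an increasing tuple of `r` directions, that is, an `r`-element set. -/
abbrev Cell (N : ℕ) (half : Bool) (r : ℕ) : Type :=
  Site N half × {S : Finset (Fin 4) // S.card = r}

/-- `R`-valued `r`-forms, given by their values `α_{x, μ₁…μ_r}` at `μ₁ < … < μ_r`. -/
abbrev Form (N : ℕ) (half : Bool) (r : ℕ) (R : Type) : Type := Cell N half r → R

section Calculus

variable {N : ℕ} {half : Bool} {R : Type} [CommRing R]

/-- The value of an `r`-form at the site `x` and the increasing tuple of directions with
underlying set `S`; zero when `S` does not have `r` elements. -/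
def val {r : ℕ} (α : Form N half r R) (x : Site N half) (S : Finset (Fin 4)) : R :=
  if h : S.card = r then α (x, ⟨S, h⟩) else 0

/-- The sign of the permutation that sorts the concatenation of the increasing tuples of the
disjoint sets `A` and `B`. -/
def shuffleSign (A B : Finset (Fin 4)) : ℤ :=
  (-1) ^ ((A ×ˢ B).filter (fun ab => ab.2 < ab.1)).card

/-- The exterior derivative
`(dα)_{x,μ₁…} = ∑ⱼ (-1)^(j+1) (α_{x+μ̂ⱼ,…μⱼ omitted…} - α_{x,…μⱼ omitted…})`. -/
def extDeriv {r : ℕ} (α : Form N half r R) : Form N half (r + 1) R := fun c =>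
  ∑ μ ∈ c.2.1, (shuffleSign {μ} (c.2.1.erase μ) : R) *
    (val α (c.1.shift (dirs N {μ})) (c.2.1.erase μ) - val α c.1 (c.2.1.erase μ))

/-- The boundary operator `(∂α)_{x,μ₁…μ_r} = ∑_ν (α_{x,μ₁…μ_r ν} - α_{x-ν̂,μ₁…μ_r ν})`. -/
def boundary {r : ℕ} (α : Form N half (r + 1) R) : Form N half r R := fun c =>
  ∑ ν ∈ c.2.1ᶜ, (shuffleSign c.2.1 {ν} : R) *
    (val α c.1 (insert ν c.2.1) - val α (c.1.shift (-dirs N {ν})) (insert ν c.2.1))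

/-- The cup product: the sum over the splittings of the directions into `A` (for `α`) and its
complement (for `β`) of `± α_{x,A} β_{x + ∑_{μ ∈ A} μ̂, Aᶜ}`. -/
def cup {p q : ℕ} (α : Form N half p R) (β : Form N half q R) : Form N half (p + q) R := fun c =>
  ∑ A ∈ c.2.1.powerset, (shuffleSign A (c.2.1 \ A) : R) *
    (val α c.1 A * val β (c.1.shift (dirs N A)) (c.2.1 \ A))

/-- The interior product `(ι_μ α)_{x,μ₁…μ_r} = α_{x,μ μ₁…μ_r}`. -/
def interiorProduct {r : ℕ} (μ : Fin 4) (α : Form N half (r + 1) R) : Form N half r R := fun c =>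
  (shuffleSign {μ} c.2.1 : R) * val α c.1 (insert μ c.2.1)

/-- The parity transformation `P_μ` of forms: the directions `ν ≥ μ` are reversed. -/
def parity {r : ℕ} (μ : Fin 4) (α : Form N half r R) : Form N half r R := fun c =>
  (-1) ^ (c.2.1.filter (fun ν => μ ≤ ν)).card *
    α ((c.1.reflect μ).shift (-dirs N (c.2.1.filter (fun ν => μ ≤ ν))), c.2)

/-- The higher cup product `∪₁` of a `(p+1)`-form `α` and a `(q+1)`-form `β`,
`(-1)^(q+1) ∑_a (-1)^a P_{μ_a} (P_{μ_a} ι_{μ_a} α ∪ P_{μ_a} ι_{μ_a} β)_{x,…μ_a omitted…}`,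
where `μ_a` is the `a`-th smallest direction, `a = 1, 2, …`. -/
def cupOne {p q : ℕ} (α : Form N half (p + 1) R) (β : Form N half (q + 1) R) :
    Form N half (p + q + 1) R := fun c =>
  (-1) ^ (q + 1) * ∑ μ ∈ c.2.1, (-1) ^ (c.2.1.filter (fun ν => ν ≤ μ)).card *
    val (parity μ (cup (parity μ (interiorProduct μ α)) (parity μ (interiorProduct μ β)))) c.1 (c.2.1.erase μ)

/-- The sum over the lattice of a `4`-form. -/
def total [NeZero N] (α : Form N half 4 R) : R := ∑ x, val α x Finset.univ

/-- The inner product of two forms of the same degree. -/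
def dot [NeZero N] {r : ℕ} (α β : Form N half r R) : R := ∑ c, α c * β c

end Calculus

/-- An integer-valued form, regarded as real-valued. -/
def toReal {N : ℕ} {half : Bool} {r : ℕ} (n : Form N half r ℤ) : Form N half r ℝ :=
  fun c => (n c : ℝ)

/-- An oriented link: `(x, +μ)` from `x` to `x + μ̂` or `(x, -μ)` from `x` to `x - μ̂`. -/
structure OrientedLink (N : ℕ) (half : Bool) where
  source : Site N half
  dir : Fin 4
  forward : Bool

/-- The end point of an oriented link. -/
def OrientedLink.target {N : ℕ} {half : Bool} (e : OrientedLink N half) : Site N half :=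
  if e.forward then e.source.shift (dirs N {e.dir}) else e.source.shift (-dirs N {e.dir})

/-- A contour: oriented links that fit together to closed paths, that is, every site is as often
the source as the target of a link. -/
structure Contour (N : ℕ) (half : Bool) where
  links : List (OrientedLink N half)
  closed : ∀ x, links.countP (fun e => decide (e.source = x)) =
    links.countP (fun e => decide (e.target = x))

/-- The tangent `γ̇`: `+1` on `(x, μ)` if `(x, +μ)` belongs to the contour, `-1` if `(x + μ̂, -μ)`
does, `0` otherwise (counted with multiplicity). -/
def Contour.tangent {N : ℕ} {half : Bool} (γ : Contour N half) : Form N half 1 ℤ := fun c =>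
  (γ.links.countP (fun e => e.forward && decide (e.source = c.1 ∧ c.2.1 = {e.dir})) : ℤ) -
  (γ.links.countP (fun e => !e.forward && decide (e.target = c.1 ∧ c.2.1 = {e.dir})) : ℤ)

/-- The oriented link of the dual lattice that is parallel to a given one. -/
def OrientedLink.toDual {N : ℕ} (e : OrientedLink N false) : OrientedLink N true :=
  ⟨Villain.toDual e.source, e.dir, e.forward⟩

theorem OrientedLink.target_toDual {N : ℕ} (e : OrientedLink N false) :
    e.toDual.target = Villain.toDual e.target := by
  unfold OrientedLink.target OrientedLink.toDual
  split <;> rfl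

/-- The contour `F(γ)` in the dual lattice. -/
def Contour.toDual {N : ℕ} (γ : Contour N false) : Contour N true where
  links := γ.links.map OrientedLink.toDual
  closed := fun x => by
    have h := γ.closed ⟨x.coord⟩
    have key : ∀ y : Site N false, Villain.toDual y = x ↔ y = ⟨x.coord⟩ := by
      rintro ⟨y⟩
      obtain ⟨x⟩ := x
      simp [Villain.toDual]
    simp only [List.countP_map, Function.comp_def, OrientedLink.target_toDual]
    simpa only [OrientedLink.toDual, key] using h

noncomputable section

/-- Integration of compact variables, `∏ ∫_{-π}^{π} dA_i / 2π`. -/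
def compactIntegral {ι : Type} [Fintype ι] (f : (ι → ℝ) → ℂ) : ℂ :=
  ((1 / (2 * π) : ℝ) : ℂ) ^ Fintype.card ι *
    ∫ A in Set.univ.pi (fun _ : ι => Set.Ico (-π) π), f A

section Theory

variable {N : ℕ} [NeZero N] {half : Bool}

/-- The field strength `F = dA + 2π n`. -/
def fieldStrength (A : Form N half 1 ℝ) (n : Form N half 2 ℤ) : Form N half 2 ℝ :=
  fun c => extDeriv A c + 2 * π * (n c : ℝ)

/-- `Q₀[F] = (1/8π²) ∑ F ∪ F`. -/
def charge₀ (F : Form N half 2 ℝ) : ℝ := 1 / (8 * π ^ 2) * total (cup F F)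

/-- `Q[F] = ∑ ((1/8π²) F ∪ F + (1/4π) F ∪₁ dn)`, `F = dA + 2π n`. -/
def charge (A : Form N half 1 ℝ) (n : Form N half 2 ℤ) : ℝ :=
  charge₀ (fieldStrength A n) +
    1 / (4 * π) * total (cupOne (fieldStrength A n) (extDeriv (toReal n)))

/-- `Q̃[F] = ∑ ((1/8π²) F ∪ F - (1/4π) F ∪₁ dn)`, `F = dA + 2π n`. -/
def dualCharge (A : Form N half 1 ℝ) (n : Form N half 2 ℤ) : ℝ :=
  charge₀ (fieldStrength A n) -
    1 / (4 * π) * total (cupOne (fieldStrength A n) (extDeriv (toReal n)))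

/-- The Pontryagin square `𝔓(n) = ∑ (n ∪ n + n ∪₁ dn)`. -/
def pontryagin (n : Form N half 2 ℤ) : ℤ := total (cup n n) + total (cupOne n (extDeriv n))

open Classical in
/-- The partition function
`Z[β,θ] = ∫ DA ∑_n exp(-(β/2) F² - iθ Q₀[F]) δ(dn)`, on the lattice (`half = false`) or on the
dual lattice (`half = true`). -/
def partition (N : ℕ) [NeZero N] (half : Bool) (β θ : ℝ) : ℂ :=
  compactIntegral fun A : Form N half 1 ℝ => ∑' n : Form N half 2 ℤ,
    if extDeriv n = 0 then
      Complex.exp (-(β / 2 * dot (fieldStrength A n) (fieldStrength A n) : ℝ)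
        - Complex.I * (θ * charge₀ (fieldStrength A n) : ℝ))
    else 0

/-- The expectation value of the dyonic Wilson loop
`W_d = exp(i ∑ (q_e γ̇ A^e - q_m γ̇ ∪ A^m))`, with the topological charge `Q`. -/
def evLoop (γ : Contour N half) (p qe qm : ℤ) (β θ : ℝ) : ℂ :=
  1 / partition N half β θ *
    compactIntegral fun Ae : Form N half 1 ℝ => compactIntegral fun Am : Form N half 3 ℝ =>
      ∑' n : Form N half 2 ℤ,
        Complex.exp (-(β / 2 * dot (fieldStrength Ae n) (fieldStrength Ae n) : ℝ)
          - Complex.I * (θ * charge Ae n : ℝ)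
          + Complex.I * (1 / (2 * π) * dot (boundary Am) (fieldStrength Ae n) : ℝ)
          - Complex.I * (p * π * pontryagin n : ℝ)) *
        Complex.exp (Complex.I *
          (qe * dot (toReal γ.tangent) Ae - qm * total (cup (toReal γ.tangent) Am) : ℝ))

/-- The expectation value of the dual dyonic Wilson loop
`W̃_d = exp(i ∑ (q_e γ̇ A^e + q_m A^m ∪ γ̇))`, with the topological charge `Q̃`. -/
def evDualLoop (γ : Contour N half) (p qe qm : ℤ) (β θ : ℝ) : ℂ :=
  1 / partition N half β θ *
    compactIntegral fun Ae : Form N half 1 ℝ => compactIntegral fun Am : Form N half 3 ℝ =>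
      ∑' n : Form N half 2 ℤ,
        Complex.exp (-(β / 2 * dot (fieldStrength Ae n) (fieldStrength Ae n) : ℝ)
          - Complex.I * (θ * dualCharge Ae n : ℝ)
          + Complex.I * (1 / (2 * π) * dot (boundary Am) (fieldStrength Ae n) : ℝ)
          - Complex.I * (p * π * pontryagin n : ℝ)) *
        Complex.exp (Complex.I *
          (qe * dot (toReal γ.tangent) Ae + qm * total (cup Am (toReal γ.tangent)) : ℝ))

/-- The image of `∂` in the real `2`-forms with the Euclidean inner product. -/
def coexact (N : ℕ) [NeZero N] (half : Bool) : Submodule ℝ (EuclideanSpace ℝ (Cell N half 2)) :=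
  Submodule.span ℝ (Set.range fun α : Form N half 3 ℝ => WithLp.toLp 2 (boundary α))

/-- The orthogonal projection `P_∂` of the real `2`-forms onto the image of `∂`. -/
def projBoundary (α : Form N half 2 ℝ) : Form N half 2 ℝ :=
  WithLp.ofLp ((coexact N half).starProjection (WithLp.toLp 2 α))

/-- `u = ∑ P_∂ l ∪₁ d P_∂ l`. -/
def uNumber (l : Form N half 2 ℤ) : ℝ :=
  total (cupOne (projBoundary (toReal l)) (extDeriv (projBoundary (toReal l))))

/-- `ε_{μνρσ} (dl)_{x+μ̂,νρσ} = -γ̇_{x,μ}` (with `ν < ρ < σ` the directions other than `μ`). -/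
def IsMonopoleSolution (γ : Contour N half) (l : Form N half 2 ℤ) : Prop :=
  ∀ (x : Site N half) (μ : Fin 4),
    shuffleSign {μ} {μ}ᶜ * val (extDeriv l) (x.shift (dirs N {μ})) {μ}ᶜ =
      -val γ.tangent x {μ}

end Theory

/-- `β̃ = β / ((2πβ)² + (θ/2π)²)`. -/
def dualBeta (β θ : ℝ) : ℝ := β / ((2 * π * β) ^ 2 + (θ / (2 * π)) ^ 2)

/-- `θ̃ = -θ / ((2πβ)² + (θ/2π)²)`. -/
def dualTheta (β θ : ℝ) : ℝ := -θ / ((2 * π * β) ^ 2 + (θ / (2 * π)) ^ 2)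

/-- The complex coupling `τ = θ/2π + 2πiβ`. -/
def coupling (β θ : ℝ) : ℂ := (θ / (2 * π) : ℝ) + Complex.I * (2 * π * β : ℝ)

/-- The complex charge `q = q_e + τ q_m`. -/
def complexCharge (qe qm : ℤ) (β θ : ℝ) : ℂ := qe + coupling β θ * qm

/-- The two framings of a dyonic loop: `plain` for `W_d(γ)`, `dual` for `W̃_d(F(γ))`. -/
inductive Framing
  | plain
  | dual

/-- The other framing. -/
def Framing.flip : Framing → Framing
  | plain => dual
  | dual => plain

/-- A dyonic loop operator along a fixed contour together with the couplings of the theory. -/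
structure LoopData where
  framing : Framing
  charges : Fin 2 → ℤ
  β : ℝ
  θ : ℝ

/-- The expectation value of a loop operator along `γ`: `⟨W_d(γ)⟩` or `⟨W̃_d(F(γ))⟩`. -/
def LoopData.ev {N : ℕ} [NeZero N] (γ : Contour N false) (p : ℤ) (D : LoopData) : ℂ :=
  match D.framing with
  | .plain => evLoop γ p (D.charges 0) (D.charges 1) D.β D.θ
  | .dual => evDualLoop γ.toDual p (D.charges 0) (D.charges 1) D.β D.θ

/-- Poisson summation: it passes to the dual couplings, exchanges the electric and the magnetic
loop, and thereby changes the framing. -/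
def LoopData.poisson (D : LoopData) : LoopData :=
  ⟨D.framing.flip, ![D.charges 1, -D.charges 0], dualBeta D.β D.θ, dualTheta D.β D.θ⟩

/-- Flipping the framing. -/
def LoopData.flipFraming (D : LoopData) : LoopData := { D with framing := D.framing.flip }

/-- The `𝒮`-transformation: Poisson summation followed by flipping the framing. -/
def LoopData.sTransform (D : LoopData) : LoopData := D.poisson.flipFraming

end

end Villain

open Villain

/-! Summing by parts, both loops couple `A^m` to `l`, so integrating out `A^m` imposes `dn = q_m
dl`. On this sector the integrand is, up to a constant factor, the exponential of the quadratic form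
`β + i(θ/4π²)K` in `F = dA^e + 2πn` with linear source `q_e K l`, where `K` is a symmetric
involution of the real 2-forms.

The operator `K` (`dualOp`) arises as follows. The lattice star that represents the cup product is
orthogonal but not symmetric: its transpose represents the product in the reverse order, and
Steenrod's formula `cup_sub_cup_swap` measures the difference by `∪₁`. The difference vanishes on
closed forms. Hence the star on `Im ∂`, combined with the transposed star on the orthogonal
complement `ker d`, is symmetric and orthogonal, and so squares to one. The `∪₁` term of the charge
is exactly what turns the star into `K`, up to the constant `q_m² u/2` (`framedCharge_eq`). The
source changes by multiples of `u` and of `2π` (`electricWeight_eq`), and `𝔓(n)` modulo two depends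
only on `dn`, because the intersection form of the torus is even (`even_pontryagin_sub`).

Since `K² = 1`, the inverse of `a + ibK` is `(a - ibK)/(a² + b²)`, a form of the same kind. After
Poisson summation over `n`, the `A^e` integral restricts the dual variable `k` to `∂k = 0`. There
`K` preserves integrality, and it carries `∂A^m` to an exact form. The substitution `n = -Kk - q_e
l`, with `A^m` in the role of the new `A^e`, reproduces the original sum at `τ ↦ -1/τ` and `(q_e,
q_m) ↦ (q_m, -q_e)` (`exists_theta_duality`). The Gaussian constant does not depend on the charges
and cancels against the partition functions. The other framing uses the transposed star, which
replaces `u` by `-u`. -/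

namespace Villain

/-! ### Poisson summation over `ℤ^ι` for functions with a Gaussian bound -/

section Poisson

variable {ι : Type} [Fintype ι]

/-- This is the Jacobi theta series at `z = 0`, `τ = ic/π`, which converges because `Im τ > 0`. -/
theorem summable_exp_neg_mul_sq_int {c : ℝ} (hc : 0 < c) :
    Summable fun n : ℤ => Real.exp (-c * (n : ℝ) ^ 2) := by
  have h := ((summable_jacobiTheta₂_term_iff 0 (Complex.I * (c / π : ℝ))).2
    (by simpa using div_pos hc pi_pos)).norm
  refine h.congr fun n => ?_
  rw [norm_jacobiTheta₂_term]
  congr 1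
  simp
  field_simp

theorem summable_prod_of_summable {f : ℤ → ℝ} (hf : Summable f) (h0 : ∀ n, 0 ≤ f n) :
    Summable fun n : ι → ℤ => ∏ i, f (n i) := by
  classical
  refine summable_of_sum_le (c := ∏ _i : ι, ∑' n, f n)
    (fun n => Finset.prod_nonneg fun i _ => h0 _) fun s => ?_
  have hsub : s ⊆ Fintype.piFinset fun i => s.image fun n => n i :=
    fun n hn => Fintype.mem_piFinset.2 fun i => Finset.mem_image_of_mem _ hn
  refine (Finset.sum_le_sum_of_subset_of_nonneg hsub
    fun n _ _ => Finset.prod_nonneg fun i _ => h0 _).trans ?_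
  rw [← Finset.prod_univ_sum (fun i => s.image fun n => n i) fun _ k => f k]
  have key : ∀ i ∈ Finset.univ, ∑ k ∈ s.image fun n => n i, f k ≤ ∑' n, f n :=
    fun i _ => Summable.sum_le_tsum _ (fun k _ => h0 k) hf
  exact Finset.prod_le_prod (fun i _ => Finset.sum_nonneg fun k _ => h0 k) key

theorem summable_exp_neg_mul_sum_sq {c : ℝ} (hc : 0 < c) :
    Summable fun n : ι → ℤ => Real.exp (-c * ∑ i, (n i : ℝ) ^ 2) := by
  refine (summable_prod_of_summable (ι := ι) (summable_exp_neg_mul_sq_int hc)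
    fun _ => (Real.exp_pos _).le).congr fun n => ?_
  rw [← Real.exp_sum, Finset.mul_sum]

/-- Termwise `(x + y)² ≥ y²/2 - x²`, since the difference is `(2x + y)²/2`. This separates a bounded
shift from the summation variable at the cost of half the decay rate. -/
theorem exp_neg_sum_sq_add_le {c : ℝ} (hc : 0 ≤ c) (x y : ι → ℝ) :
    Real.exp (-c * ∑ i, (x i + y i) ^ 2) ≤
      Real.exp (c * ∑ i, x i ^ 2) * Real.exp (-(c / 2) * ∑ i, y i ^ 2) := by
  rw [← Real.exp_add]
  refine Real.exp_le_exp.2 ?_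
  rw [Finset.mul_sum, Finset.mul_sum, Finset.mul_sum, ← Finset.sum_add_distrib]
  refine Finset.sum_le_sum fun i _ => ?_
  nlinarith [mul_nonneg hc (sq_nonneg (2 * x i + y i))]

/-- The unit cube with corner `n`. -/
def unitCube (n : ι → ℤ) : Set (ι → ℝ) := Set.univ.pi fun i => Set.Ioc (n i : ℝ) (n i + 1)

theorem measurableSet_unitCube (n : ι → ℤ) : MeasurableSet (unitCube n) :=
  MeasurableSet.univ_pi fun _ => measurableSet_Ioc

theorem mem_unitCube_iff {n : ι → ℤ} {x : ι → ℝ} : x ∈ unitCube n ↔ ∀ i, n i = ⌈x i⌉ - 1 := by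
  simp only [unitCube, Set.mem_univ_pi, Set.mem_Ioc]
  refine forall_congr' fun i => ?_
  rw [eq_sub_iff_add_eq, eq_comm, Int.ceil_eq_iff]
  push_cast
  simp

theorem pairwise_disjoint_unitCube : Pairwise (Function.onFun Disjoint (unitCube (ι := ι))) := by
  intro m n hmn
  refine Set.disjoint_left.2 fun x hm hn => hmn ?_
  ext i
  rw [mem_unitCube_iff.1 hm, mem_unitCube_iff.1 hn]

theorem iUnion_unitCube : ⋃ n, unitCube (ι := ι) n = Set.univ := by
  refine Set.eq_univ_of_forall fun x => Set.mem_iUnion.2 ⟨fun i => ⌈x i⌉ - 1, ?_⟩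
  exact mem_unitCube_iff.2 fun _ => rfl

theorem setIntegral_unitCube {E : Type} [NormedAddCommGroup E] [NormedSpace ℝ E]
    (h : (ι → ℝ) → E) (n : ι → ℤ) :
    ∫ x in unitCube n, h x = ∫ x in unitCube 0, h (fun i => x i + n i) := by
  have hmp : MeasurePreserving (fun x : ι → ℝ => x + fun i => (n i : ℝ)) volume volume :=
    measurePreserving_add_right volume _
  have := hmp.setIntegral_preimage_emb (MeasurableEquiv.addRight _).measurableEmbedding h
    (unitCube n)
  rw [← this]
  congr 2
  ext x
  simp only [unitCube, Set.mem_preimage, Set.mem_univ_pi, Set.mem_Ioc, Pi.add_apply, Pi.zero_apply,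
    Int.cast_zero]
  refine forall_congr' fun i => ?_
  constructor <;> rintro ⟨h1, h2⟩ <;> constructor <;> linarith

theorem hasSum_integral_unitCube {E : Type} [NormedAddCommGroup E] [NormedSpace ℝ E]
    {h : (ι → ℝ) → E} (hh : Integrable h) :
    HasSum (fun n : ι → ℤ => ∫ x in unitCube 0, h (fun i => x i + n i)) (∫ x, h x) := by
  have := hasSum_integral_iUnion (μ := volume) (f := h) (s := unitCube (ι := ι))
    measurableSet_unitCube pairwise_disjoint_unitCube (by rw [iUnion_unitCube]; exact hh.integrableOn)
  rw [iUnion_unitCube, setIntegral_univ] at this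
  simpa only [setIntegral_unitCube h] using this

theorem integrable_exp_neg_mul_sum_sq {c : ℝ} (hc : 0 < c) :
    Integrable fun x : ι → ℝ => Real.exp (-c * ∑ i, x i ^ 2) := by
  have := Integrable.fintype_prod (ι := ι) (f := fun _ (x : ℝ) => Real.exp (-c * x ^ 2))
    (μ := fun _ => volume) fun _ => integrable_exp_neg_mul_sq hc
  refine this.congr (Filter.Eventually.of_forall fun x => ?_)
  simp only
  rw [← Real.exp_sum, Finset.mul_sum]

/-- Bounded sum of squares on a bounded set. -/
theorem norm_shift_le_of_gaussian_bound {f : (ι → ℝ) → ℂ} {C c : ℝ} (hc : 0 ≤ c)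
    (hf : ∀ x, ‖f x‖ ≤ C * Real.exp (-c * ∑ i, x i ^ 2)) {R : ℝ} {x : ι → ℝ}
    (hx : ∑ i, x i ^ 2 ≤ R) (n : ι → ℤ) :
    ‖f (fun i => x i + n i)‖ ≤
      C * Real.exp (c * R) * Real.exp (-(c / 2) * ∑ i, (n i : ℝ) ^ 2) := by
  have hC : 0 ≤ C := by
    have := (norm_nonneg _).trans (hf x)
    exact nonneg_of_mul_nonneg_left this (Real.exp_pos _)
  refine (hf _).trans ?_
  rw [mul_assoc]
  refine mul_le_mul_of_nonneg_left ((exp_neg_sum_sq_add_le hc x _).trans ?_) hC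
  gcongr

theorem continuous_tsum_shift {f : (ι → ℝ) → ℂ} (hcont : Continuous f) {C c : ℝ} (hc : 0 < c)
    (hf : ∀ x, ‖f x‖ ≤ C * Real.exp (-c * ∑ i, x i ^ 2)) :
    Continuous fun x : ι → ℝ => ∑' n : ι → ℤ, f (fun i => x i + n i) := by
  refine continuous_iff_continuousAt.2 fun x₀ => ?_
  have hS : IsOpen {x : ι → ℝ | ∑ i, x i ^ 2 < ∑ i, x₀ i ^ 2 + 1} :=
    isOpen_lt (by fun_prop) (by fun_prop)
  have hmem : x₀ ∈ {x : ι → ℝ | ∑ i, x i ^ 2 < ∑ i, x₀ i ^ 2 + 1} := by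
    simp only [Set.mem_ofPred_eq]
    exact lt_add_one _
  have hu := (summable_exp_neg_mul_sum_sq (ι := ι) (half_pos hc)).mul_left
    (C * Real.exp (c * (∑ i, x₀ i ^ 2 + 1)))
  refine (continuousOn_tsum (fun n => ?_) hu fun n x hx => ?_).continuousAt (hS.mem_nhds hmem)
  · exact (hcont.comp (by fun_prop)).continuousOn
  · exact norm_shift_le_of_gaussian_bound hc.le hf (le_of_lt hx) n

theorem mFourier_coe (k : ι → ℤ) (x : ι → ℝ) :
    UnitAddTorus.mFourier k (fun i => (x i : UnitAddCircle)) =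
      Complex.exp (2 * π * Complex.I * ∑ i, (k i : ℂ) * x i) := by
  simp only [UnitAddTorus.mFourier, ContinuousMap.coe_mk, fourier_coe_apply]
  rw [← Complex.exp_sum, Finset.mul_sum]
  congr 1
  refine Finset.sum_congr rfl fun i _ => ?_
  simp
  ring

/-- Poisson summation over `ℤ^ι` for continuous functions with a Gaussian bound. -/
theorem tsum_eq_tsum_integral_of_gaussian_bound {f : (ι → ℝ) → ℂ} (hcont : Continuous f)
    {C c : ℝ} (hc : 0 < c) (hf : ∀ x, ‖f x‖ ≤ C * Real.exp (-c * ∑ i, x i ^ 2))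
    (hsum : Summable fun k : ι → ℤ =>
      ∫ x : ι → ℝ, Complex.exp (-2 * π * Complex.I * ∑ i, (k i : ℂ) * x i) * f x) :
    ∑' n : ι → ℤ, f (fun i => (n i : ℝ)) = ∑' k : ι → ℤ,
      ∫ x : ι → ℝ, Complex.exp (-2 * π * Complex.I * ∑ i, (k i : ℂ) * x i) * f x := by
  -- The periodization of `f`; its value at `0` is the left-hand side.
  set Φ : (ι → ℝ) → ℂ := fun x => ∑' n : ι → ℤ, f (fun i => x i + n i) with hΦ
  have hΦc : Continuous Φ := continuous_tsum_shift hcont hc hf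
  have hq : IsOpenQuotientMap
      (Pi.map fun (_ : ι) (x : ℝ) => (x : UnitAddCircle)) :=
    IsOpenQuotientMap.piMap fun _ => QuotientAddGroup.isOpenQuotientMap_mk
  have hper : ∀ (x : ι → ℝ) (m : ι → ℤ), Φ (fun i => x i + m i) = Φ x := by
    intro x m
    simp only [hΦ]
    refine Eq.trans ?_ ((Equiv.addLeft m).tsum_eq fun n : ι → ℤ => f fun i => x i + n i)
    refine tsum_congr fun n => ?_
    congr 1
    ext i
    simp only [Equiv.coe_addLeft, Pi.add_apply, Int.cast_add, add_assoc]
  have hfac : ∀ x y : ι → ℝ, (Pi.map fun (_ : ι) (x : ℝ) => (x : UnitAddCircle)) x =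
      (Pi.map fun (_ : ι) (x : ℝ) => (x : UnitAddCircle)) y → Φ x = Φ y := by
    intro x y hxy
    have : ∀ i, ∃ m : ℤ, x i = y i + m := by
      intro i
      have h1 : ((x i : ℝ) : UnitAddCircle) = (y i : ℝ) := congrFun hxy i
      rw [← sub_eq_zero, ← AddCircle.coe_sub, AddCircle.coe_eq_zero_iff] at h1
      obtain ⟨m, hm⟩ := h1
      refine ⟨m, ?_⟩
      simp only [zsmul_eq_mul, mul_one] at hm
      linarith
    choose m hm using this
    rw [show x = fun i => y i + m i from funext hm, hper]
  -- `Φ` is constant on the fibres of the quotient map, so any choice of preimages gives the same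
  -- continuous function on the torus.
  obtain ⟨g, hg⟩ : ∃ g : C(UnitAddTorus ι, ℂ), ∀ x : ι → ℝ, g (fun i => (x i : UnitAddCircle)) = Φ x := by
    refine ⟨⟨fun t => Φ (hq.surjective t).choose, ?_⟩, fun x => ?_⟩
    · refine (hq.isQuotientMap.continuous_iff).2 ?_
      refine hΦc.congr fun x => hfac _ _ ?_
      exact ((hq.surjective _).choose_spec).symm
    · exact hfac _ _ (hq.surjective fun i => (x i : UnitAddCircle)).choose_spec
  have hint : ∀ k : ι → ℤ, Integrable fun x : ι → ℝ =>
      Complex.exp (-2 * π * Complex.I * ∑ i, (k i : ℂ) * x i) * f x := by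
    intro k
    refine ((integrable_exp_neg_mul_sum_sq (ι := ι) hc).const_mul C).mono'
      (Continuous.aestronglyMeasurable (by fun_prop)) (Filter.Eventually.of_forall fun x => ?_)
    rw [norm_mul, Complex.norm_exp]
    have : (-2 * π * Complex.I * ∑ i, (k i : ℂ) * x i).re = 0 := by
      have : -2 * π * Complex.I * ∑ i, (k i : ℂ) * x i =
          ((-2 * π * ∑ i, (k i : ℝ) * x i : ℝ) : ℂ) * Complex.I := by push_cast; ring
      rw [this, Complex.re_ofReal_mul]
      simp
    rw [this, Real.exp_zero, one_mul]
    exact hf x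
  -- Unfolding: the characters are `ℤ^ι`-periodic, so the integral of the periodization over one
  -- cube is the integral of `f` over the tiled space.
  have hcoeff : ∀ k : ι → ℤ, UnitAddTorus.mFourierCoeff g k =
      ∫ x : ι → ℝ, Complex.exp (-2 * π * Complex.I * ∑ i, (k i : ℂ) * x i) * f x := by
    intro k
    rw [UnitAddTorus.mFourierCoeff_eq_integral _ _ 0, ← (hasSum_integral_unitCube (hint k)).tsum_eq]
    have hset : {x : ι → ℝ | ∀ i, x i ∈ Set.Ioc ((0 : ι → ℝ) i) ((0 : ι → ℝ) i + 1)} =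
        unitCube 0 := by
      ext x; simp [unitCube]
    rw [hset]
    have hexp : ∀ (n : ι → ℤ) (x : ι → ℝ),
        Complex.exp (-2 * π * Complex.I * ∑ i, (k i : ℂ) * ((x i + n i : ℝ) : ℂ)) =
          Complex.exp (-2 * π * Complex.I * ∑ i, (k i : ℂ) * x i) := by
      intro n x
      have : -2 * π * Complex.I * ∑ i, (k i : ℂ) * ((x i + n i : ℝ) : ℂ) =
          -2 * π * Complex.I * ∑ i, (k i : ℂ) * x i +
            ((-∑ i, k i * n i : ℤ) : ℂ) * (2 * π * Complex.I) := by
        push_cast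
        simp only [mul_add, Finset.sum_add_distrib]
        ring
      rw [this, Complex.exp_add, Complex.exp_int_mul_two_pi_mul_I, mul_one]
    have hI := integral_tsum_of_summable_integral_norm (μ := volume.restrict (unitCube (ι := ι) 0))
      (F := fun (n : ι → ℤ) (x : ι → ℝ) =>
        Complex.exp (-2 * π * Complex.I * ∑ i, (k i : ℂ) * ((x i + n i : ℝ) : ℂ)) *
          f fun i => x i + n i)
      (fun n => ((hint k).comp_add_right fun i => (n i : ℝ)).integrableOn)
      (hasSum_integral_unitCube (hint k).norm).summable
    refine Eq.trans ?_ hI.symm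
    simp only [hexp, hg, mFourier_coe, smul_eq_mul, hΦ, ← tsum_mul_left]
    congr! 6
    simp only [Pi.neg_apply, Int.cast_neg, neg_mul, Finset.sum_neg_distrib, mul_neg]
  have hsum' : Summable (UnitAddTorus.mFourierCoeff g) := by
    rw [funext hcoeff]; exact hsum
  -- Summable coefficients make the Fourier series converge pointwise; it is evaluated at `0`.
  have := (UnitAddTorus.hasSum_mFourier_series_apply_of_summable hsum'
    fun _ => ((0 : ℝ) : UnitAddCircle)).tsum_eq
  have h0 := hg fun _ => 0
  simp only [hΦ, zero_add] at h0
  rw [h0] at this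
  rw [← this]
  refine tsum_congr fun k => ?_
  rw [hcoeff, mFourier_coe k fun _ => 0]
  simp

end Poisson

/-! ### Complex Gaussian integrals with a symmetric involution -/

section Gaussian

variable {ι : Type} [Fintype ι]

/-- The eigenbasis gives a linear isometry of Euclidean space, which preserves volume; so does the
passage between Euclidean space and plain functions. -/
theorem exists_orthogonal_diagonalization (K : Matrix ι ι ℝ) (hK : K.IsHermitian) :
    ∃ (Ψ : (ι → ℝ) ≃ₗ[ℝ] (ι → ℝ)) (ev : ι → ℝ), MeasurePreserving Ψ volume volume ∧
      (∀ x y, Ψ x ⬝ᵥ Ψ y = x ⬝ᵥ y) ∧ ∀ x, K.mulVec (Ψ x) = Ψ fun i => ev i * x i := by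
  classical
  let b := hK.eigenvectorBasis
  let Ψ : (ι → ℝ) ≃ₗ[ℝ] (ι → ℝ) :=
    (WithLp.linearEquiv 2 ℝ (ι → ℝ)).symm.trans
      (b.repr.symm.toLinearEquiv.trans (WithLp.linearEquiv 2 ℝ (ι → ℝ)))
  have hΨ : ∀ x, Ψ x = WithLp.ofLp (b.repr.symm (WithLp.toLp 2 x)) := fun x => rfl
  refine ⟨Ψ, hK.eigenvalues, ?_, fun x y => ?_, fun x => ?_⟩
  · exact (PiLp.volume_preserving_ofLp ι).comp
      (b.repr.symm.measurePreserving.comp (PiLp.volume_preserving_toLp ι))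
  · have := b.repr.symm.inner_map_map (WithLp.toLp 2 y) (WithLp.toLp 2 x)
    rw [EuclideanSpace.inner_eq_star_dotProduct, EuclideanSpace.inner_eq_star_dotProduct] at this
    simpa only [hΨ, star_trivial] using this
  · have hsum : ∀ x, Ψ x = ∑ i, x i • (WithLp.ofLp (b i)) := by
      intro x
      rw [hΨ, ← b.sum_repr (b.repr.symm (WithLp.toLp 2 x))]
      simp
    rw [hsum, hsum, Matrix.mulVec_sum]
    refine Finset.sum_congr rfl fun i _ => ?_
    rw [Matrix.mulVec_smul, hK.mulVec_eigenvectorBasis, smul_smul, mul_comm]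

/-- The Fourier transform of the Gaussian with the complex covariance `a + i b K`, where `K` is a
symmetric involution. -/
theorem exists_integral_gaussian_involution (K : Matrix ι ι ℝ) (hK : K.IsHermitian)
    (hKK : ∀ x, K.mulVec (K.mulVec x) = x) {a : ℝ} (ha : 0 < a) (b : ℝ) :
    ∃ C : ℂ, C ≠ 0 ∧ ∀ w : ι → ℝ,
      ∫ x : ι → ℝ, Complex.exp (-(a / 2 * (x ⬝ᵥ x) : ℝ) - Complex.I * (b / 2 * (x ⬝ᵥ K.mulVec x) : ℝ)
        - Complex.I * (w ⬝ᵥ x : ℝ)) =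
      C * Complex.exp (-(a / (a ^ 2 + b ^ 2) / 2 * (w ⬝ᵥ w) : ℝ) -
        Complex.I * (-b / (a ^ 2 + b ^ 2) / 2 * (w ⬝ᵥ K.mulVec w) : ℝ)) := by
  obtain ⟨Ψ, ev, hmp, horth, hdiag⟩ := exists_orthogonal_diagonalization K hK
  have hev : ∀ i, ev i ^ 2 = 1 := by
    classical
    intro i
    have h := hKK (Ψ (Pi.single i 1))
    rw [hdiag, hdiag] at h
    have := congrFun (Ψ.injective h) i
    simpa [sq] using this
  set B : ι → ℂ := fun i => (a + Complex.I * (b * ev i)) / 2 with hB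
  have hBre : ∀ i, 0 < (B i).re := by
    intro i
    have : B i = ((a / 2 : ℝ) : ℂ) + ((b * ev i / 2 : ℝ) : ℂ) * Complex.I := by
      rw [hB]; push_cast; ring
    rw [this]
    simp [ha]
  have hB0 : ∀ i, B i ≠ 0 := fun i h => by
    have := hBre i
    rw [h] at this
    simp at this
  refine ⟨∏ i, (π / B i) ^ (1 / 2 : ℂ), ?_, fun w => ?_⟩
  · refine Finset.prod_ne_zero_iff.2 fun i _ => ?_
    rw [Ne, Complex.cpow_eq_zero_iff, not_and_or]
    exact Or.inl (div_ne_zero (by exact_mod_cast pi_ne_zero) (hB0 i))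
  obtain ⟨v, rfl⟩ := Ψ.surjective w
  rw [← hmp.integral_comp (Ψ.toContinuousLinearEquiv.toHomeomorph.measurableEmbedding)]
  simp only [hdiag, horth]
  have h1 : ∀ y : ι → ℝ, Complex.exp (-(a / 2 * (y ⬝ᵥ y) : ℝ)
      - Complex.I * (b / 2 * (y ⬝ᵥ fun i => ev i * y i) : ℝ) - Complex.I * (v ⬝ᵥ y : ℝ)) =
      Complex.exp (-∑ i, B i * (y i : ℂ) ^ 2 + ∑ i, (-Complex.I * v i) * y i) := by
    intro y
    congr 1
    simp only [dotProduct, hB]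
    push_cast
    simp only [Finset.mul_sum, ← Finset.sum_neg_distrib, ← Finset.sum_sub_distrib,
      ← Finset.sum_add_distrib]
    exact Finset.sum_congr rfl fun i _ => by ring
  simp only [h1]
  rw [GaussianFourier.integral_cexp_neg_sum_mul_add hBre, Finset.prod_mul_distrib,
    ← Complex.exp_sum]
  congr 2
  simp only [dotProduct]
  push_cast
  simp only [Finset.mul_sum, ← Finset.sum_neg_distrib, ← Finset.sum_sub_distrib]
  refine Finset.sum_congr rfl fun i _ => ?_
  have hab : (a : ℂ) ^ 2 + (b : ℂ) ^ 2 ≠ 0 := by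
    have : a ^ 2 + b ^ 2 ≠ 0 := by positivity
    exact_mod_cast this
  have hBc : B i * (a - Complex.I * (b * ev i)) = (a ^ 2 + b ^ 2) / 2 := by
    have he : (ev i : ℂ) ^ 2 = 1 := by exact_mod_cast hev i
    rw [hB]
    linear_combination (-(b : ℂ) ^ 2 * (ev i : ℂ) ^ 2 / 2) * Complex.I_sq + (b : ℂ) ^ 2 / 2 * he
  have hB' : (B i)⁻¹ = 2 * (a - Complex.I * (b * ev i)) / (a ^ 2 + b ^ 2) := by
    refine inv_eq_of_mul_eq_one_right ?_
    rw [mul_div_assoc', div_eq_one_iff_eq hab]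
    linear_combination 2 * hBc
  rw [div_eq_mul_inv, mul_inv, hB']
  field_simp
  rw [Complex.I_sq]
  ring

end Gaussian

/-! ### Integrals over the cube `[-π, π)^ι` -/

section CompactIntegral

variable {ι : Type} [Fintype ι]

theorem compactIntegral_exp_intCast (m : ι → ℤ) [Decidable (m = 0)] :
    compactIntegral (fun A : ι → ℝ => Complex.exp (Complex.I * (∑ i, A i * m i : ℝ))) =
      if m = 0 then 1 else 0 := by
  have h1 : ∀ k : ℤ, ∫ x in Set.Ico (-π) π, Complex.exp (Complex.I * (x * k : ℝ)) =
      if k = 0 then ((2 * π : ℝ) : ℂ) else 0 := by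
    intro k
    rw [integral_Ico_eq_integral_Ioc, ← intervalIntegral.integral_of_le (by linarith [pi_pos])]
    split_ifs with hk
    · simp [hk]; ring
    · have hc : Complex.I * k ≠ 0 := mul_ne_zero Complex.I_ne_zero (by exact_mod_cast hk)
      have := integral_exp_mul_complex (a := -π) (b := π) hc
      have h2 : ∀ x : ℝ, Complex.exp (Complex.I * (x * k : ℝ)) =
          Complex.exp (Complex.I * k * x) := fun x => by push_cast; ring_nf
      simp only [h2, this]
      have : Complex.I * k * (π : ℝ) = Complex.I * k * ((-π : ℝ) : ℂ) + k * (2 * π * Complex.I) := by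
        push_cast; ring
      rw [this, Complex.exp_add, Complex.exp_int_mul_two_pi_mul_I, mul_one, sub_self, zero_div]
  unfold compactIntegral
  rw [volume_pi, Measure.restrict_pi_pi]
  have h2 : ∀ A : ι → ℝ, Complex.exp (Complex.I * (∑ i, A i * m i : ℝ)) =
      ∏ i, Complex.exp (Complex.I * (A i * m i : ℝ)) := by
    intro A
    rw [← Complex.exp_sum, Complex.ofReal_sum, Finset.mul_sum]
  simp only [h2]
  rw [integral_fintype_prod_eq_prod (fun i (x : ℝ) => Complex.exp (Complex.I * (x * m i : ℝ)))]
  simp only [h1]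
  split_ifs with hm
  · simp only [hm, Pi.zero_apply, if_true, Finset.prod_const, Finset.card_univ]
    rw [← mul_pow, ← Complex.ofReal_mul, one_div, inv_mul_cancel₀ (by positivity)]
    simp
  · obtain ⟨i, hi⟩ := Function.ne_iff.1 hm
    rw [Finset.prod_eq_zero (Finset.mem_univ i) (if_neg hi), mul_zero]

theorem norm_compactIntegral_le {f : (ι → ℝ) → ℂ} {C : ℝ}
    (hf : ∀ A ∈ Set.univ.pi fun _ : ι => Set.Ico (-π) π, ‖f A‖ ≤ C) :
    ‖compactIntegral f‖ ≤ C := by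
  have hvol : volume.real (Set.univ.pi fun _ : ι => Set.Ico (-π) π) =
      (2 * π) ^ Fintype.card ι := by
    have := Real.volume_pi_Ico_toReal (a := fun _ : ι => -π) (b := fun _ => π)
      fun _ => by linarith [pi_pos]
    rw [measureReal_def, this, Finset.prod_const, Finset.card_univ]
    ring
  have h1 := norm_setIntegral_le_of_norm_le_const (μ := volume) (by
    rw [Real.volume_pi_Ico]
    exact ENNReal.prod_lt_top fun _ _ => ENNReal.ofReal_lt_top) hf
  rw [hvol] at h1
  unfold compactIntegral
  rw [norm_mul, norm_pow, Complex.norm_real, Real.norm_of_nonneg (by positivity)]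
  calc _ ≤ (1 / (2 * π)) ^ Fintype.card ι * (C * (2 * π) ^ Fintype.card ι) := by gcongr
    _ = C := by
      rw [mul_left_comm, ← mul_pow, one_div, inv_mul_cancel₀ (by positivity), one_pow, mul_one]

theorem compactIntegral_const_mul (c : ℂ) (f : (ι → ℝ) → ℂ) :
    compactIntegral (fun A => c * f A) = c * compactIntegral f := by
  unfold compactIntegral
  rw [integral_const_mul, mul_left_comm]

theorem compactIntegral_tsum {κ : Type} [Countable κ] {f : κ → (ι → ℝ) → ℂ}
    (hf : ∀ k, Continuous (f k)) {u : κ → ℝ} (hu : Summable u)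
    (hfu : ∀ k, ∀ A ∈ Set.univ.pi fun _ : ι => Set.Ico (-π) π, ‖f k A‖ ≤ u k) :
    compactIntegral (fun A => ∑' k, f k A) = ∑' k, compactIntegral (f k) := by
  have hmeas : MeasurableSet (Set.univ.pi fun _ : ι => Set.Ico (-π) π) :=
    MeasurableSet.univ_pi fun _ => measurableSet_Ico
  have hfin : volume (Set.univ.pi fun _ : ι => Set.Ico (-π) π) < ⊤ := by
    rw [Real.volume_pi_Ico]
    exact ENNReal.prod_lt_top fun _ _ => ENNReal.ofReal_lt_top
  have hfin' : IsFiniteMeasure (volume.restrict (Set.univ.pi fun _ : ι => Set.Ico (-π) π)) :=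
    ⟨by rwa [Measure.restrict_apply_univ]⟩
  unfold compactIntegral
  rw [tsum_mul_left]
  congr 1
  have hae : ∀ k, ∀ᵐ A ∂volume.restrict (Set.univ.pi fun _ : ι => Set.Ico (-π) π),
      ‖f k A‖ ≤ u k := fun k => ae_restrict_of_forall_mem hmeas (hfu k)
  refine (hasSum_integral_of_dominated_convergence (fun k _ => u k)
    (fun k => (hf k).aestronglyMeasurable) hae (Filter.Eventually.of_forall fun _ => hu)
    (integrable_const _) ?_).tsum_eq.symm
  refine ae_restrict_of_forall_mem hmeas fun A hA => ?_
  exact (Summable.of_norm_bounded hu fun k => hfu k A hA).hasSum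

theorem compactIntegral_signedPerm {κ : Type} [Fintype κ] (e : ι ≃ κ) (s : ι → ℝ)
    (hs : ∀ i, s i = 1 ∨ s i = -1) (f : (ι → ℝ) → ℂ) :
    compactIntegral (fun y : κ → ℝ => f fun i => s i * y (e i)) = compactIntegral f := by
  unfold compactIntegral
  rw [Fintype.card_congr e]
  congr 1
  -- The half-open interval is not invariant under `x ↦ -x`; the closed one is, and differs by a
  -- null set.
  have hIcc : ∀ (κ' : Type) [Fintype κ'] (g : (κ' → ℝ) → ℂ),
      ∫ A in Set.univ.pi fun _ : κ' => Set.Ico (-π) π, g A =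
        ∫ A in Set.univ.pi fun _ : κ' => Set.Icc (-π) π, g A := by
    intro κ' _ g
    refine setIntegral_congr_set ?_
    rw [volume_pi]
    exact Measure.pi_Ico_ae_eq_pi_Icc
  rw [hIcc, hIcc]
  have hs0 : ∀ i, s i ≠ 0 := fun i => by rcases hs i with h | h <;> rw [h] <;> norm_num
  let E : (κ → ℝ) ≃ᵐ (ι → ℝ) := (MeasurableEquiv.arrowCongr' e.symm (MeasurableEquiv.refl ℝ)).trans
    (MeasurableEquiv.piCongrRight fun i => MeasurableEquiv.mulLeft₀ (s i) (hs0 i))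
  have hE : ∀ y, E y = fun i => s i * y (e i) := fun y => rfl
  have hmp : MeasurePreserving E volume volume := by
    refine MeasurePreserving.comp (g := MeasurableEquiv.piCongrRight fun i =>
        MeasurableEquiv.mulLeft₀ (s i) (hs0 i)) (μb := volume) (volume_preserving_pi fun i => ?_)
      (volume_preserving_arrowCongr' e.symm (MeasurableEquiv.refl ℝ) (MeasurePreserving.id _))
    rcases hs i with h | h
    · convert! MeasurePreserving.id (volume : Measure ℝ) using 1
      exact funext fun x => show s i * x = x by rw [h, one_mul]
    · convert! Measure.measurePreserving_neg (volume : Measure ℝ) using 1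
      exact funext fun x => show s i * x = -x by rw [h, neg_one_mul]
  rw [← hmp.setIntegral_preimage_emb E.measurableEmbedding]
  congr 2
  ext y
  simp only [Set.mem_preimage, hE, Set.mem_univ_pi, Set.mem_Icc]
  rw [← e.forall_congr_right]
  refine forall_congr' fun i => ?_
  rcases hs i with h | h <;> rw [h] <;> constructor <;> rintro ⟨h1, h2⟩ <;> constructor <;> linarith

end CompactIntegral

/-! ### Duality of the constrained Gaussian sum over an abstract self-dual complex -/

section Duality

/-- The bound is uniform over the compact cube, as needed to exchange the sum over `n` with the
compact integral. -/
theorem exists_summable_gaussian_bound {ι κ : Type} [Fintype ι] [Fintype κ] {a t : ℝ} (ha : 0 < a)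
    (ht : t ≠ 0) {c : (κ → ℝ) → ι → ℝ} (hc : Continuous c) :
    ∃ u : (ι → ℤ) → ℝ, Summable u ∧ ∀ n, ∀ A ∈ Set.univ.pi fun _ : κ => Set.Ico (-π) π,
      Real.exp (-a * ∑ i, (c A i + t * n i) ^ 2) ≤ u n := by
  have hcomp : IsCompact (Set.univ.pi fun _ : κ => Set.Icc (-π) π) :=
    isCompact_univ_pi fun _ => isCompact_Icc
  obtain ⟨R, hR⟩ := hcomp.exists_bound_of_continuousOn
    (f := fun A => Real.exp (a * ∑ i, c A i ^ 2)) (by fun_prop)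
  have hpos : 0 < a / 2 * t ^ 2 := by positivity
  refine ⟨fun n => R * Real.exp (-(a / 2 * t ^ 2) * ∑ i, (n i : ℝ) ^ 2),
    (summable_exp_neg_mul_sum_sq hpos).mul_left _, fun n A hA => ?_⟩
  refine (exp_neg_sum_sq_add_le ha.le (c A) fun i => t * n i).trans ?_
  have h1 := hR A fun i hi => Set.Ico_subset_Icc_self (hA i hi)
  rw [Real.norm_of_nonneg (Real.exp_pos _).le] at h1
  have h2 : -(a / 2) * ∑ i, (t * (n i : ℝ)) ^ 2 = -(a / 2 * t ^ 2) * ∑ i, (n i : ℝ) ^ 2 := by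
    simp only [mul_pow, ← Finset.mul_sum]
    ring
  rw [h2]
  exact mul_le_mul_of_nonneg_right h1 (Real.exp_pos _).le

/-- The piece of a lattice complex around the middle dimension: `d` from `1`-forms and `b` from
`3`-forms to `2`-forms with orthogonal images and with integral transposes `dT`, `bT`, and a
symmetric involution `K` of the `2`-forms which exchanges the images of `d` and `b` and preserves
integrality on the kernel of `dT`. -/
structure SelfDualComplex (ι₁ ι₂ ι₃ : Type) [Fintype ι₁] [Fintype ι₂] [Fintype ι₃] where
  d : (ι₁ → ℝ) →ₗ[ℝ] (ι₂ → ℝ)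
  b : (ι₃ → ℝ) →ₗ[ℝ] (ι₂ → ℝ)
  dT : (ι₂ → ℤ) → ι₁ → ℤ
  bT : (ι₂ → ℤ) → ι₃ → ℤ
  d_dot : ∀ A k, d A ⬝ᵥ (fun i => (k i : ℝ)) = ∑ i, A i * dT k i
  b_dot : ∀ y n, b y ⬝ᵥ (fun i => (n i : ℝ)) = ∑ i, y i * bT n i
  d_dot_b : ∀ A y, d A ⬝ᵥ b y = 0
  K : Matrix ι₂ ι₂ ℝ
  isHermitian : K.IsHermitian
  involution : ∀ x, K.mulVec (K.mulVec x) = x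
  Kint : (ι₂ → ℤ) ≃ (ι₂ → ℤ)
  mulVec_intCast : ∀ k, dT k = 0 → K.mulVec (fun i => (k i : ℝ)) = fun i => (Kint k i : ℝ)
  dT_eq_zero_iff : ∀ k, dT k = 0 ↔ bT (Kint k) = 0
  e : ι₁ ≃ ι₃
  s : ι₁ → ℝ
  s_eq : ∀ i, s i = 1 ∨ s i = -1
  mulVec_b : ∀ y, K.mulVec (b y) = d fun i => s i * y (e i)

namespace SelfDualComplex

variable {ι₁ ι₂ ι₃ : Type} [Fintype ι₁] [Fintype ι₂] [Fintype ι₃] (S : SelfDualComplex ι₁ ι₂ ι₃)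

/-- Additivity of `bT` is not a field of the structure; testing `b_dot` on unit vectors recovers
what is needed. -/
theorem bT_neg_eq_zero_iff (n : ι₂ → ℤ) : S.bT (-n) = 0 ↔ S.bT n = 0 := by
  classical
  have h : S.bT (-n) = -S.bT n := by
    ext i
    have h1 := S.b_dot (Pi.single i 1) (-n)
    have h2 := S.b_dot (Pi.single i 1) n
    have h3 : (fun i => ((-n) i : ℝ)) = -fun i => (n i : ℝ) := by ext; simp
    rw [h3, dotProduct_neg, h2] at h1
    simp [Pi.single_apply] at h1
    exact_mod_cast h1.symm
  rw [h, neg_eq_zero]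

theorem dotProduct_mulVec_comm (x y : ι₂ → ℝ) : x ⬝ᵥ S.K.mulVec y = S.K.mulVec x ⬝ᵥ y := by
  have h : S.K.transpose = S.K := by simpa [Matrix.IsHermitian] using S.isHermitian
  rw [Matrix.dotProduct_mulVec, ← Matrix.mulVec_transpose, h]

theorem mulVec_dotProduct_mulVec (x y : ι₂ → ℝ) : S.K.mulVec x ⬝ᵥ S.K.mulVec y = x ⬝ᵥ y := by
  rw [S.dotProduct_mulVec_comm, S.involution]

/-- The Gaussian weight with covariance `a + i b K` and linear source `w`. -/
noncomputable def weight (a b : ℝ) (w F : ι₂ → ℝ) : ℂ :=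
  Complex.exp (-(a / 2 * (F ⬝ᵥ F) : ℝ) - Complex.I * (b / 2 * (F ⬝ᵥ S.K.mulVec F) : ℝ)
    - Complex.I * (w ⬝ᵥ F : ℝ))

theorem norm_exp_mul_I (x : ℝ) : ‖Complex.exp (Complex.I * (x : ℂ))‖ = 1 := by
  rw [mul_comm, Complex.norm_exp_ofReal_mul_I]

theorem norm_weight (a b : ℝ) (w F : ι₂ → ℝ) :
    ‖S.weight a b w F‖ = Real.exp (-(a / 2) * ∑ i, F i ^ 2) := by
  rw [weight, Complex.norm_exp]
  congr 1
  simp [dotProduct, sq]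

theorem continuous_weight (a b : ℝ) (w : ι₂ → ℝ) : Continuous (S.weight a b w) := by
  unfold weight dotProduct Matrix.mulVec dotProduct
  fun_prop

/-- The sum over the integral `2`-forms `n` with `bT (n - qm l) = 0`, integrated over the compact
`1`-forms. -/
noncomputable def theta [DecidableEq (ι₃ → ℤ)] (a b : ℝ) (l : ι₂ → ℤ) (qe qm : ℤ) : ℂ :=
  compactIntegral fun A : ι₁ → ℝ => ∑' n : ι₂ → ℤ, if S.bT (n - qm • l) = 0 then
    S.weight a b ((qe : ℝ) • S.K.mulVec fun i => (l i : ℝ)) (S.d A + (2 * π) • fun i => (n i : ℝ)) else 0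

/-- The compact variable `y` is a Lagrange multiplier: by orthogonality of characters its integral
enforces the integer constraint. -/
theorem compactIntegral_tsum_constraint [DecidableEq (ι₃ → ℤ)] {w : (ι₂ → ℤ) → ℂ} (hw : Summable w)
    (m : ι₂ → ℤ) :
    compactIntegral (fun y : ι₃ → ℝ => ∑' n : ι₂ → ℤ,
      w n * Complex.exp (Complex.I * (S.b y ⬝ᵥ (fun i => ((n - m) i : ℝ)) : ℝ))) =
      ∑' n, if S.bT (n - m) = 0 then w n else 0 := by
  rw [compactIntegral_tsum (u := fun n => ‖w n‖)]
  · refine tsum_congr fun n => ?_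
    rw [compactIntegral_const_mul]
    simp only [S.b_dot, compactIntegral_exp_intCast, mul_ite, mul_one, mul_zero]
  · intro n
    simp only [S.b_dot]
    fun_prop
  · exact hw.norm
  · intro n y _
    rw [norm_mul, norm_exp_mul_I, mul_one]

theorem summable_weight {a : ℝ} (ha : 0 < a) (b : ℝ) (w c : ι₂ → ℝ) {t : ℝ} (ht : t ≠ 0) :
    Summable fun n : ι₂ → ℤ => S.weight a b w (c + t • fun i => (n i : ℝ)) := by
  -- Without compact variables the cube is a point, and the uniform bound becomes one for a fixed
  -- shift.
  obtain ⟨u, hu, h⟩ := exists_summable_gaussian_bound (κ := Empty) (half_pos ha) ht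
    (c := fun _ => c) continuous_const
  refine Summable.of_norm_bounded hu fun n => ?_
  rw [norm_weight]
  simpa using h n (fun _ => 0) (fun i => i.elim)

/-- In the variable `F = dA + 2πx` the Fourier mode `k` and the phase of `y` add to the linear
source, and the Gaussian transform inverts `a + ibK`. The dependence on `A` survives only in a
character, so that integrating over `A` will constrain `k`. -/
theorem exists_poisson_weight {a : ℝ} (ha : 0 < a) (b : ℝ) :
    ∃ C : ℂ, C ≠ 0 ∧ ∀ (w : ι₂ → ℝ) (m : ι₂ → ℤ) (A : ι₁ → ℝ) (y : ι₃ → ℝ),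
      ∑' n : ι₂ → ℤ, S.weight a b w (S.d A + (2 * π) • fun i => (n i : ℝ)) *
        Complex.exp (Complex.I * (S.b y ⬝ᵥ (fun i => ((n - m) i : ℝ)) : ℝ)) =
      C * ∑' k : ι₂ → ℤ, (Complex.exp (-Complex.I * (S.b y ⬝ᵥ (fun i => (m i : ℝ)) : ℝ)) *
        S.weight (a / (a ^ 2 + b ^ 2)) (-b / (a ^ 2 + b ^ 2)) 0
          (w - (1 / (2 * π)) • S.b y + (1 : ℝ) • fun i => (k i : ℝ))) *
        Complex.exp (Complex.I * (∑ i, A i * S.dT k i : ℝ)) := by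
  obtain ⟨C, hC, hF⟩ := exists_integral_gaussian_involution S.K S.isHermitian S.involution ha b
  have h2π : (0 : ℝ) < 2 * π := by positivity
  refine ⟨((((2 * π) ^ Fintype.card ι₂)⁻¹ : ℝ) : ℂ) * C,
    mul_ne_zero (by exact_mod_cast (by positivity : ((2 * π) ^ Fintype.card ι₂)⁻¹ ≠ (0 : ℝ))) hC,
    fun w m A y => ?_⟩
  set f : (ι₂ → ℝ) → ℂ := fun x => S.weight a b w (S.d A + (2 * π) • x) *
    Complex.exp (Complex.I * (S.b y ⬝ᵥ (x - fun i => (m i : ℝ)) : ℝ)) with hf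
  have hcont : Continuous f := by
    refine ((S.continuous_weight a b w).comp (by fun_prop)).mul ?_
    simp only [dotProduct]
    fun_prop
  have hbound : ∀ x, ‖f x‖ ≤ Real.exp (a / 2 * ∑ i, S.d A i ^ 2) *
      Real.exp (-(a / 4 * (2 * π) ^ 2) * ∑ i, x i ^ 2) := by
    intro x
    rw [hf, norm_mul, norm_exp_mul_I, mul_one, norm_weight]
    refine (exp_neg_sum_sq_add_le (half_pos ha).le (S.d A) ((2 * π) • x)).trans (le_of_eq ?_)
    congr 2
    simp only [Pi.smul_apply, smul_eq_mul, mul_pow, ← Finset.mul_sum]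
    ring
  have hint : ∀ k : ι₂ → ℤ,
      ∫ x : ι₂ → ℝ, Complex.exp (-2 * π * Complex.I * ∑ i, (k i : ℂ) * x i) * f x =
        ((((2 * π) ^ Fintype.card ι₂)⁻¹ : ℝ) : ℂ) * C *
        ((Complex.exp (-Complex.I * (S.b y ⬝ᵥ (fun i => (m i : ℝ)) : ℝ)) *
        S.weight (a / (a ^ 2 + b ^ 2)) (-b / (a ^ 2 + b ^ 2)) 0
          (w - (1 / (2 * π)) • S.b y + (1 : ℝ) • fun i => (k i : ℝ))) *
        Complex.exp (Complex.I * (∑ i, A i * S.dT k i : ℝ))) := by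
    intro k
    set v : ι₂ → ℝ := w - (1 / (2 * π)) • S.b y + (1 : ℝ) • fun i => (k i : ℝ) with hv
    set D : ℂ := Complex.exp (-Complex.I * (S.b y ⬝ᵥ (fun i => (m i : ℝ)) : ℝ)) *
      Complex.exp (Complex.I * (∑ i, A i * S.dT k i : ℝ)) with hD
    have h1 : ∀ x : ι₂ → ℝ, Complex.exp (-2 * π * Complex.I * ∑ i, (k i : ℂ) * x i) * f x =
        D * S.weight a b v (S.d A + (2 * π) • x) := by
      intro x
      simp only [hf, weight, hD, ← Complex.exp_add]
      congr 1
      rw [← S.d_dot]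
      have h2 : -2 * π * Complex.I * ∑ i, (k i : ℂ) * x i =
          -Complex.I * ((2 * π * ((fun i => (k i : ℝ)) ⬝ᵥ x) : ℝ) : ℂ) := by
        simp only [dotProduct]; push_cast; ring
      -- Orthogonality of `Im d` and `Im b` lets `b y ⬝ᵥ x` be rewritten as `b y ⬝ᵥ F / 2π`; this is
      -- the source `-b y / 2π` in `v`.
      have h3 : v ⬝ᵥ (S.d A + (2 * π) • x) = w ⬝ᵥ (S.d A + (2 * π) • x) - S.b y ⬝ᵥ x +
          S.d A ⬝ᵥ (fun i => (k i : ℝ)) + 2 * π * ((fun i => (k i : ℝ)) ⬝ᵥ x) := by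
        have hdb := S.d_dot_b A y
        rw [dotProduct_comm] at hdb
        rw [hv, add_dotProduct, sub_dotProduct, smul_dotProduct, smul_dotProduct, dotProduct_add (S.b y),
          dotProduct_add (fun i => (k i : ℝ)), dotProduct_smul, dotProduct_smul, hdb,
          dotProduct_comm (S.d A)]
        simp only [smul_eq_mul]
        field_simp
        ring
      rw [h2, h3, dotProduct_sub]
      push_cast
      ring
    simp only [h1]
    rw [integral_const_mul]
    have h4 := Measure.integral_comp_smul (volume : Measure (ι₂ → ℝ))
      (fun F => S.weight a b v (S.d A + F)) (2 * π)
    rw [h4, integral_add_left_eq_self (S.weight a b v) (S.d A)]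
    have h5 := hF v
    simp only [weight] at h5 ⊢
    rw [h5, Module.finrank_fintype_fun_eq_card, abs_of_pos (by positivity), Complex.real_smul, hD]
    simp only [zero_dotProduct, Complex.ofReal_zero, mul_zero, sub_zero]
    have h6 : a / (a ^ 2 + b ^ 2) / 2 = a / (a ^ 2 + b ^ 2) / 2 := rfl
    ring
  have hsum : Summable fun k : ι₂ → ℤ =>
      ∫ x : ι₂ → ℝ, Complex.exp (-2 * π * Complex.I * ∑ i, (k i : ℂ) * x i) * f x := by
    simp only [hint]
    refine Summable.mul_left _ ?_
    have h := (S.summable_weight (a := a / (a ^ 2 + b ^ 2)) (by positivity) (-b / (a ^ 2 + b ^ 2)) 0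
      (w - (1 / (2 * π)) • S.b y) one_ne_zero).norm
    refine Summable.of_norm_bounded h fun k => le_of_eq ?_
    rw [norm_mul, norm_mul, norm_exp_mul_I, neg_mul, ← mul_neg, ← Complex.ofReal_neg, norm_exp_mul_I,
      one_mul, mul_one]
  have hP := tsum_eq_tsum_integral_of_gaussian_bound hcont (by positivity) hbound hsum
  simp only [hint, tsum_mul_left] at hP
  rw [← hP]
  refine tsum_congr fun n => ?_
  simp only [hf]
  congr 5
  ext i
  simp

/-- Invariance of the constrained sum under `a + i b K ↦ (a + i b K)⁻¹ / 4π²` and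
`(qe, qm) ↦ (qm, -qe)`. -/
theorem exists_theta_duality [DecidableEq (ι₃ → ℤ)] {a : ℝ} (ha : 0 < a) (b : ℝ) :
    ∃ C : ℂ, C ≠ 0 ∧ ∀ (l : ι₂ → ℤ) (qe qm : ℤ), S.theta a b l qe qm = C *
      Complex.exp (-Complex.I * (2 * π * (qe * qm) *
        ((fun i => (l i : ℝ)) ⬝ᵥ S.K.mulVec fun i => (l i : ℝ)) : ℝ)) *
      S.theta (a / (a ^ 2 + b ^ 2) / (4 * π ^ 2)) (-b / (a ^ 2 + b ^ 2) / (4 * π ^ 2)) l qm (-qe) := by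
  classical
  obtain ⟨C, hC, hP⟩ := S.exists_poisson_weight ha b
  refine ⟨C, hC, fun l qe qm => ?_⟩
  have h2π : (2 * π : ℝ) ≠ 0 := by positivity
  set a₂ := a / (a ^ 2 + b ^ 2) with ha₂
  set b₂ := -b / (a ^ 2 + b ^ 2)
  have ha₂pos : 0 < a₂ := by positivity
  set L : ι₂ → ℝ := fun i => (l i : ℝ) with hL
  set w : ι₂ → ℝ := (qe : ℝ) • S.K.mulVec L with hw
  have hbc : Continuous S.b := S.b.continuous_of_finiteDimensional
  have hdc : Continuous S.d := S.d.continuous_of_finiteDimensional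
  set g : (ι₂ → ℤ) → (ι₃ → ℝ) → ℂ := fun k y =>
    Complex.exp (-Complex.I * (S.b y ⬝ᵥ (fun i => ((qm • l) i : ℝ)) : ℝ)) *
      S.weight a₂ b₂ 0 (w - (1 / (2 * π)) • S.b y + (1 : ℝ) • fun i => (k i : ℝ)) with hg
  have hgcont : ∀ k, Continuous (g k) := by
    intro k
    refine Continuous.mul ?_ ((S.continuous_weight a₂ b₂ 0).comp (by fun_prop))
    simp only [dotProduct]
    fun_prop
  obtain ⟨u, hu, hgu⟩ := exists_summable_gaussian_bound (κ := ι₃) (half_pos ha₂pos) one_ne_zero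
    (c := fun y => w - (1 / (2 * π)) • S.b y) (by fun_prop)
  have hgu' : ∀ k, ∀ y ∈ Set.univ.pi fun _ : ι₃ => Set.Ico (-π) π, ‖g k y‖ ≤ u k := by
    intro k y hy
    rw [hg, norm_mul, neg_mul, ← mul_neg, ← Complex.ofReal_neg, norm_exp_mul_I, one_mul,
      norm_weight]
    exact hgu k y hy
  -- The constraint is written as a `y`-integral, the free sum over `n` is Poisson-summed, and the
  -- `A`-integral then leaves only `dT k = 0`.
  have hleft : S.theta a b l qe qm =
      C * ∑' k, if S.dT k = 0 then compactIntegral (g k) else 0 := by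
    have h1 : ∀ A : ι₁ → ℝ, (∑' n : ι₂ → ℤ, if S.bT (n - qm • l) = 0 then
        S.weight a b w (S.d A + (2 * π) • fun i => (n i : ℝ)) else 0) =
        C * ∑' k, compactIntegral (g k) * Complex.exp (Complex.I * (∑ i, A i * S.dT k i : ℝ)) := by
      intro A
      rw [← S.compactIntegral_tsum_constraint (S.summable_weight ha b w (S.d A) h2π)]
      simp only [hP]
      rw [compactIntegral_const_mul, compactIntegral_tsum (u := u) (fun k => (hgcont k).mul_const _) hu]
      · congr 1
        refine tsum_congr fun k => ?_
        rw [mul_comm (compactIntegral _), ← compactIntegral_const_mul]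
        congr 1
        ext y
        rw [mul_comm]
      · intro k y hy
        rw [norm_mul, norm_exp_mul_I, mul_one]
        exact hgu' k y hy
    unfold theta
    simp only [← hL, ← hw, h1]
    rw [compactIntegral_const_mul, compactIntegral_tsum (u := u) (fun k => by fun_prop) hu]
    · congr 1
      refine tsum_congr fun k => ?_
      rw [compactIntegral_const_mul, compactIntegral_exp_intCast]
      simp only [mul_ite, mul_one, mul_zero]
    · intro k A _
      rw [norm_mul, norm_exp_mul_I, mul_one]
      exact norm_compactIntegral_le (hgu' k)
  set a₃ := a₂ / (4 * π ^ 2) with ha₃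
  set b₃ := b₂ / (4 * π ^ 2) with hb₃
  have ha₃pos : 0 < a₃ := by positivity
  have hright : S.theta a₃ b₃ l qm (-qe) = ∑' n, if S.bT (n - -qe • l) = 0 then
      compactIntegral (fun A => S.weight a₃ b₃ ((qm : ℝ) • S.K.mulVec L)
        (S.d A + (2 * π) • fun i => (n i : ℝ))) else 0 := by
    obtain ⟨u', hu', hgu'⟩ := exists_summable_gaussian_bound (κ := ι₁) (half_pos ha₃pos) h2π hdc
    unfold theta
    rw [compactIntegral_tsum (u := u') (fun n => ?_) hu']
    · refine tsum_congr fun n => ?_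
      split_ifs with h
      · rfl
      · simp [compactIntegral]
    · intro n A hA
      split_ifs
      · rw [norm_weight]
        exact hgu' n A hA
      · rw [norm_zero]
        exact (Real.exp_pos _).le.trans (hgu' n A hA)
    · split_ifs
      · exact (S.continuous_weight _ _ _).comp (by fun_prop)
      · exact continuous_const
  -- The relabelling `n = -Kk - qe l` turns `dT k = 0` into the constraint for the magnetic charge
  -- `-qe`.
  let E : (ι₂ → ℤ) ≃ (ι₂ → ℤ) := S.Kint.trans ((Equiv.neg _).trans (Equiv.subRight (qe • l)))
  have hE : ∀ k, E k = -S.Kint k - qe • l := fun k => rfl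
  rw [← E.tsum_eq] at hright
  rw [hleft, hright, mul_assoc]
  congr 1
  rw [← tsum_mul_left]
  refine tsum_congr fun k => ?_
  have hcond : S.bT (E k - -qe • l) = 0 ↔ S.dT k = 0 := by
    rw [hE, neg_smul, sub_neg_eq_add, sub_add_cancel, S.bT_neg_eq_zero_iff, ← S.dT_eq_zero_iff]
  by_cases hk : S.dT k = 0
  swap
  · rw [if_neg hk, if_neg (mt hcond.1 hk), mul_zero]
  rw [if_pos hk, if_pos (hcond.2 hk), hE]
  rw [← compactIntegral_signedPerm S.e S.s S.s_eq, ← compactIntegral_const_mul]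
  congr 1
  ext y
  set v : ι₂ → ℝ := w - (1 / (2 * π)) • S.b y + (1 : ℝ) • fun i => (k i : ℝ) with hv
  -- The dual source is a field strength: applying `-2πK` to `qe K l - b y / 2π + k` gives the exact
  -- form `K b y` plus `2πn`. The factor `2π` produces the rescaling of the couplings by `4π²`.
  have hF : (S.d fun i => S.s i * y (S.e i)) +
      (2 * π) • (fun i => ((-S.Kint k - qe • l) i : ℝ)) = -(2 * π) • S.K.mulVec v := by
    have h1 : (fun i => ((-S.Kint k - qe • l) i : ℝ)) =
        -(fun i => (S.Kint k i : ℝ)) - (qe : ℝ) • L := by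
      ext i; simp [hL]
    rw [h1, ← S.mulVec_b, ← S.mulVec_intCast k hk, hv, hw, Matrix.mulVec_add, Matrix.mulVec_sub,
      Matrix.mulVec_smul, Matrix.mulVec_smul, Matrix.mulVec_smul, S.involution]
    ext i
    simp only [Pi.add_apply, Pi.smul_apply, Pi.sub_apply, Pi.neg_apply, smul_eq_mul]
    field_simp
    ring
  rw [hF]
  simp only [hg, weight, ← hv]
  rw [← Complex.exp_add, ← Complex.exp_add]
  -- The cross term `qm (k ⬝ᵥ l)` contributes only full turns.
  have hint : Complex.exp (Complex.I * (2 * π * (qm * ∑ i, k i * l i : ℤ) : ℝ)) = 1 := by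
    have := Complex.exp_int_mul_two_pi_mul_I (qm * ∑ i, k i * l i)
    rw [← this]
    congr 1
    push_cast
    ring
  have hvL : v ⬝ᵥ L = qe * (L ⬝ᵥ S.K.mulVec L) - 1 / (2 * π) * (S.b y ⬝ᵥ L) +
      ((∑ i, k i * l i : ℤ) : ℝ) := by
    rw [hv, hw, add_dotProduct, sub_dotProduct, smul_dotProduct, smul_dotProduct, one_smul,
      S.dotProduct_mulVec_comm]
    congr 1
    simp [dotProduct, hL]
  have hq : (S.b y ⬝ᵥ fun i => ((qm • l) i : ℝ)) = qm * (S.b y ⬝ᵥ L) := by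
    have : (fun i => ((qm • l) i : ℝ)) = (qm : ℝ) • L := by ext i; simp [hL]
    rw [this, dotProduct_smul, smul_eq_mul]
  rw [← mul_one (Complex.exp _), ← hint, ← Complex.exp_add, hq]
  congr 1
  simp only [smul_dotProduct, dotProduct_smul, Matrix.mulVec_smul, S.mulVec_dotProduct_mulVec,
    smul_eq_mul, zero_dotProduct]
  rw [dotProduct_comm L v, hvL, ha₃, hb₃]
  have hπ : (π : ℂ) ≠ 0 := by exact_mod_cast pi_ne_zero
  push_cast
  generalize (a₂ : ℂ) = a₂
  generalize (b₂ : ℂ) = b₂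
  field_simp
  ring

end SelfDualComplex

end Duality

/-! ### Translations of the lattice -/

section Shift

variable {N : ℕ} {half : Bool}

theorem Site.shift_shift (x : Site N half) (v w : Fin 4 → ZMod N) :
    (x.shift v).shift w = x.shift (v + w) := by
  simp [Site.shift, add_assoc]

theorem Site.shift_zero (x : Site N half) : x.shift 0 = x := by
  simp [Site.shift]

/-- Translation of sites. -/
def shiftEquiv (N : ℕ) (half : Bool) (v : Fin 4 → ZMod N) : Site N half ≃ Site N half where
  toFun x := x.shift v
  invFun x := x.shift (-v)
  left_inv x := by simp only [Site.shift_shift, add_neg_cancel, Site.shift_zero]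
  right_inv x := by simp only [Site.shift_shift, neg_add_cancel, Site.shift_zero]

theorem sum_shift [NeZero N] {M : Type} [AddCommMonoid M] (f : Site N half → M)
    (v : Fin 4 → ZMod N) : ∑ x : Site N half, f (x.shift v) = ∑ x, f x :=
  (shiftEquiv N half v).sum_comp f

theorem sum_shift_mul_shift [NeZero N] {R : Type} [CommRing R] (f g : Site N half → R)
    (v : Fin 4 → ZMod N) :
    ∑ x : Site N half, f (x.shift v) * g x = ∑ x, f x * g (x.shift (-v)) := by
  rw [← sum_shift (fun x => f x * g (x.shift (-v))) v]
  simp only [Site.shift_shift, add_neg_cancel, Site.shift_zero]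

end Shift

/-! ### Component formulas for the operations on forms -/

section Values

variable {N : ℕ} {half : Bool} {R : Type} [CommRing R]

theorem val_of_card {r : ℕ} (α : Form N half r R) (x : Site N half) {S : Finset (Fin 4)}
    (h : S.card = r) : val α x S = α (x, ⟨S, h⟩) := dif_pos h

theorem val_of_card_ne {r : ℕ} (α : Form N half r R) (x : Site N half) {S : Finset (Fin 4)}
    (h : S.card ≠ r) : val α x S = 0 := dif_neg h

theorem form_ext {r : ℕ} {α β : Form N half r R}
    (h : ∀ x S, S.card = r → val α x S = val β x S) : α = β := by
  ext ⟨x, S, hS⟩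
  simpa only [val_of_card _ _ hS] using h x S hS

theorem val_extDeriv {r : ℕ} (α : Form N half r R) (x : Site N half) {S : Finset (Fin 4)}
    (h : S.card = r + 1) : val (extDeriv α) x S = ∑ μ ∈ S, (shuffleSign {μ} (S.erase μ) : R) *
      (val α (x.shift (dirs N {μ})) (S.erase μ) - val α x (S.erase μ)) := by
  rw [val_of_card _ _ h, extDeriv]

theorem val_boundary {r : ℕ} (α : Form N half (r + 1) R) (x : Site N half) {S : Finset (Fin 4)}
    (h : S.card = r) : val (boundary α) x S = ∑ ν ∈ Sᶜ, (shuffleSign S {ν} : R) *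
      (val α x (insert ν S) - val α (x.shift (-dirs N {ν})) (insert ν S)) := by
  rw [val_of_card _ _ h, boundary]

theorem val_cup {p q : ℕ} (α : Form N half p R) (β : Form N half q R) (x : Site N half)
    {S : Finset (Fin 4)} (h : S.card = p + q) : val (cup α β) x S =
      ∑ A ∈ S.powerset, (shuffleSign A (S \ A) : R) *
        (val α x A * val β (x.shift (dirs N A)) (S \ A)) := by
  rw [val_of_card _ _ h, cup]

theorem val_parity {r : ℕ} (μ : Fin 4) (α : Form N half r R) (x : Site N half)
    (S : Finset (Fin 4)) : val (parity μ α) x S = (-1) ^ (S.filter (fun ν => μ ≤ ν)).card *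
      val α ((x.reflect μ).shift (-dirs N (S.filter (fun ν => μ ≤ ν)))) S := by
  by_cases h : S.card = r
  · rw [val_of_card _ _ h, val_of_card _ _ h, parity]
  · rw [val_of_card_ne _ _ h, val_of_card_ne _ _ h, mul_zero]

theorem val_interiorProduct {r : ℕ} (μ : Fin 4) (α : Form N half (r + 1) R) (x : Site N half)
    {S : Finset (Fin 4)} (h : μ ∉ S) :
    val (interiorProduct μ α) x S = (shuffleSign {μ} S : R) * val α x (insert μ S) := by
  by_cases hS : S.card = r
  · rw [val_of_card _ _ hS, interiorProduct]
  · rw [val_of_card_ne _ _ hS, val_of_card_ne, mul_zero]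
    rw [Finset.card_insert_of_notMem h]
    omega

/-- The outer and inner reflections compose to translations: the signs cancel, and so do the
half-unit corrections on the dual lattice. What remains is a product with displacements reversed in
the directions `≥ μ`. -/
theorem val_parity_cup_parity {p q : ℕ} (μ : Fin 4) (α : Form N half p R) (β : Form N half q R)
    (x : Site N half) {S : Finset (Fin 4)} (h : S.card = p + q) :
    val (parity μ (cup (parity μ α) (parity μ β))) x S =
      ∑ A ∈ S.powerset, (shuffleSign A (S \ A) : R) *
        (val α (x.shift (dirs N ((S \ A).filter (fun ν => μ ≤ ν)))) A *
          val β (x.shift (dirs N (A.filter (fun ν => ν < μ)))) (S \ A)) := by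
  rw [val_parity, val_cup _ _ _ h, Finset.mul_sum]
  refine Finset.sum_congr rfl fun A hA => ?_
  have hAS := Finset.mem_powerset.1 hA
  rw [val_parity, val_parity]
  have hcard : (S.filter (fun ν => μ ≤ ν)).card =
      (A.filter (fun ν => μ ≤ ν)).card + ((S \ A).filter (fun ν => μ ≤ ν)).card := by
    rw [← Finset.card_union_of_disjoint, ← Finset.filter_union, Finset.union_sdiff_of_subset hAS]
    exact Finset.disjoint_filter_filter Finset.disjoint_sdiff
  have hsign : ((-1 : R)) ^ (S.filter (fun ν => μ ≤ ν)).card *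
      ((-1) ^ (A.filter (fun ν => μ ≤ ν)).card * (-1) ^ ((S \ A).filter (fun ν => μ ≤ ν)).card) =
      1 := by
    rw [hcard, ← pow_add, ← pow_add, ← two_mul, pow_mul]
    simp
  have h1 : (((x.reflect μ).shift (-dirs N (S.filter (fun ν => μ ≤ ν)))).reflect μ).shift
      (-dirs N (A.filter (fun ν => μ ≤ ν))) = x.shift (dirs N ((S \ A).filter (fun ν => μ ≤ ν))) := by
    unfold Site.shift Site.reflect dirs
    congr 1
    ext ν
    by_cases hν : μ ≤ ν
    · by_cases hS : ν ∈ S <;> by_cases hA' : ν ∈ A <;> cases half <;>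
        simp [hν, hS, hA'] <;> first | exact absurd (hAS hA') hS | ring
    · simp [hν]
  have h2 : ((((x.reflect μ).shift (-dirs N (S.filter (fun ν => μ ≤ ν)))).shift (dirs N A)).reflect μ).shift
      (-dirs N ((S \ A).filter (fun ν => μ ≤ ν))) = x.shift (dirs N (A.filter (fun ν => ν < μ))) := by
    unfold Site.shift Site.reflect dirs
    congr 1
    ext ν
    by_cases hν : μ ≤ ν
    · have hν' : ¬ν < μ := not_lt.2 hν
      by_cases hS : ν ∈ S <;> by_cases hA' : ν ∈ A <;> cases half <;>
        simp [hν, hν', hS, hA'] <;> exact absurd (hAS hA') hS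
    · have hν' : ν < μ := not_le.1 hν
      simp [hν, hν']
  rw [h1, h2]
  linear_combination (shuffleSign A (S \ A) : R) *
    (val α (x.shift (dirs N ((S \ A).filter (fun ν => μ ≤ ν)))) A *
          val β (x.shift (dirs N (A.filter (fun ν => ν < μ)))) (S \ A)) * hsign

theorem val_cupOne {p q : ℕ} (α : Form N half (p + 1) R) (β : Form N half (q + 1) R)
    (x : Site N half) {S : Finset (Fin 4)} (h : S.card = p + q + 1) :
    val (cupOne α β) x S = (-1) ^ (q + 1) * ∑ μ ∈ S, (-1) ^ (S.filter (fun ν => ν ≤ μ)).card *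
      ∑ A ∈ (S.erase μ).powerset, (shuffleSign A (S.erase μ \ A) : R) *
        (((shuffleSign {μ} A : R) *
            val α (x.shift (dirs N ((S.erase μ \ A).filter (fun ν => μ ≤ ν)))) (insert μ A)) *
          ((shuffleSign {μ} (S.erase μ \ A) : R) *
            val β (x.shift (dirs N (A.filter (fun ν => ν < μ)))) (insert μ (S.erase μ \ A)))) := by
  rw [val_of_card _ _ h, cupOne]
  congr 1
  refine Finset.sum_congr rfl fun μ hμ => ?_
  have hc : (S.erase μ).card = p + q := by
    rw [Finset.card_erase_of_mem hμ, h]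
    rfl
  rw [val_parity_cup_parity _ _ _ _ hc]
  congr 1
  refine Finset.sum_congr rfl fun A hA => ?_
  have hA' : μ ∉ A := fun h' => Finset.notMem_erase μ S (Finset.mem_powerset.1 hA h')
  have hC : μ ∉ S.erase μ \ A := fun h' => Finset.notMem_erase μ S (Finset.mem_sdiff.1 h').1
  rw [val_interiorProduct _ _ _ hA', val_interiorProduct _ _ _ hC]

theorem sum_powerset_of_card_one {M : Type} [AddCommMonoid M] {S : Finset (Fin 4)}
    {g : Finset (Fin 4) → M} (hg : ∀ A ⊆ S, A.card ≠ 1 → g A = 0) :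
    ∑ A ∈ S.powerset, g A = ∑ ν ∈ S, g {ν} := by
  symm
  refine Finset.sum_of_injOn (fun ν => {ν}) (fun _ _ _ _ h => Finset.singleton_injective h)
    (fun ν hν => by simpa using hν) (fun A hA hA' => hg A (Finset.mem_powerset.1 hA) fun hc => hA' ?_)
    fun _ _ => rfl
  obtain ⟨ν, rfl⟩ := Finset.card_eq_one.1 hc
  exact ⟨ν, by simpa using hA, rfl⟩

theorem sum_powerset_of_card_compl_one {M : Type} [AddCommMonoid M] {S : Finset (Fin 4)}
    {g : Finset (Fin 4) → M} (hg : ∀ A ⊆ S, (S \ A).card ≠ 1 → g A = 0) :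
    ∑ A ∈ S.powerset, g A = ∑ ν ∈ S, g (S \ {ν}) := by
  symm
  refine Finset.sum_of_injOn (fun ν => S \ {ν}) (fun a ha b hb h => ?_)
    (fun ν hν => by simp) (fun A hA hA' => hg A (Finset.mem_powerset.1 hA) fun hc => hA' ?_)
    fun _ _ => rfl
  · have h2 : S \ (S \ {a}) = S \ (S \ {b}) := congrArg (S \ ·) h
    rw [Finset.sdiff_sdiff_eq_self (by simpa using ha),
      Finset.sdiff_sdiff_eq_self (by simpa using hb)] at h2
    exact Finset.singleton_injective h2
  · obtain ⟨ν, hν⟩ := Finset.card_eq_one.1 hc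
    have hAS := Finset.mem_powerset.1 hA
    refine ⟨ν, ?_, ?_⟩
    · have : ν ∈ S \ A := by rw [hν]; simp
      exact (Finset.mem_sdiff.1 this).1
    · simp only
      rw [← hν, Finset.sdiff_sdiff_eq_self hAS]

end Values

/-! ### Steenrod's formula for the commutator of the cup product of 2-forms -/

section CupCommutator

variable {N : ℕ} {half : Bool} {R : Type} [CommRing R]

/-- A 2-form leaves only singletons `{ν}` in the sum over subsets. Both sums range over all four
directions with explicit conditions, ready for expansion. -/
theorem val_cupOne_left {q : ℕ} (α : Form N half 2 R) (β : Form N half (q + 1) R)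
    (x : Site N half) {S : Finset (Fin 4)} (h : S.card = 1 + q + 1) :
    val (cupOne α β) x S = (-1) ^ (q + 1) * ∑ μ, if μ ∈ S then
      (-1) ^ (S.filter (fun ν => ν ≤ μ)).card *
      ∑ ν, if ν ∈ S ∧ ν ≠ μ then (shuffleSign {ν} ((S.erase μ).erase ν) : R) *
        (((shuffleSign {μ} {ν} : R) *
            val α (x.shift (dirs N (((S.erase μ).erase ν).filter (fun ρ => μ ≤ ρ)))) {μ, ν}) *
          ((shuffleSign {μ} ((S.erase μ).erase ν) : R) *
            val β (x.shift (dirs N (({ν} : Finset (Fin 4)).filter (fun ρ => ρ < μ))))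
              (S.erase ν))) else 0 else 0 := by
  rw [val_cupOne _ _ _ h, ← Finset.sum_filter, Finset.filter_mem_eq_inter, Finset.univ_inter]
  congr 1
  refine Finset.sum_congr rfl fun μ hμ => ?_
  congr 1
  rw [sum_powerset_of_card_one, ← Finset.sum_filter]
  · refine Finset.sum_congr ?_ fun ν hν => ?_
    · ext ν; simp [and_comm]
    · have hne : ν ≠ μ := (Finset.mem_filter.1 hν).2.2
      rw [Finset.sdiff_singleton_eq_erase]
      congr 5
      rw [Finset.erase_right_comm, Finset.insert_erase (Finset.mem_erase.2 ⟨hne.symm, hμ⟩)]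
  · intro A hA hc
    rw [val_of_card_ne α, mul_zero, zero_mul, mul_zero]
    rw [Finset.card_insert_of_notMem fun h' => Finset.notMem_erase μ S (hA h')]
    omega

theorem val_cupOne_right {p : ℕ} (α : Form N half (p + 1) R) (β : Form N half 2 R)
    (x : Site N half) {S : Finset (Fin 4)} (h : S.card = p + 1 + 1) :
    val (cupOne α β) x S = ∑ μ, if μ ∈ S then
      (-1) ^ (S.filter (fun ν => ν ≤ μ)).card *
      ∑ ν, if ν ∈ S ∧ ν ≠ μ then (shuffleSign ((S.erase μ).erase ν) {ν} : R) *
        (((shuffleSign {μ} ((S.erase μ).erase ν) : R) *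
            val α (x.shift (dirs N (({ν} : Finset (Fin 4)).filter (fun ρ => μ ≤ ρ)))) (S.erase ν)) *
          ((shuffleSign {μ} {ν} : R) *
            val β (x.shift (dirs N (((S.erase μ).erase ν).filter (fun ρ => ρ < μ)))) {μ, ν}))
        else 0 else 0 := by
  rw [val_cupOne _ _ _ h, ← Finset.sum_filter, Finset.filter_mem_eq_inter, Finset.univ_inter]
  norm_num only [one_mul]
  refine Finset.sum_congr rfl fun μ hμ => ?_
  congr 1
  rw [sum_powerset_of_card_compl_one, ← Finset.sum_filter]
  · refine Finset.sum_congr ?_ fun ν hν => ?_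
    · ext ν; simp [and_comm]
    · have hne : ν ≠ μ := (Finset.mem_filter.1 hν).2.2
      have hν' : ν ∈ S := (Finset.mem_filter.1 hν).2.1
      rw [Finset.sdiff_sdiff_eq_self (by simp [hne, hν']), Finset.sdiff_singleton_eq_erase]
      congr 5
      rw [Finset.erase_right_comm, Finset.insert_erase (Finset.mem_erase.2 ⟨hne.symm, hμ⟩)]
  · intro A hA hc
    rw [val_of_card_ne β, mul_zero, mul_zero, mul_zero]
    rw [Finset.card_insert_of_notMem fun h' =>
      Finset.notMem_erase μ S (Finset.mem_sdiff.1 h').1]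
    omega

theorem dirs_eq (N : ℕ) (S : Finset (Fin 4)) : dirs N S =
    ![if 0 ∈ S then 1 else 0, if 1 ∈ S then 1 else 0, if 2 ∈ S then 1 else 0,
      if 3 ∈ S then 1 else 0] := by
  ext i
  fin_cases i <;> rfl

/-- One factor per possible inversion, so that the sign reduces to membership tests on concrete
sets. -/
theorem cast_shuffleSign_eq (A B : Finset (Fin 4)) : shuffleSign A B =
    (if 1 ∈ A ∧ 0 ∈ B then -1 else 1) * (if 2 ∈ A ∧ 0 ∈ B then -1 else 1) *
    (if 3 ∈ A ∧ 0 ∈ B then -1 else 1) * (if 2 ∈ A ∧ 1 ∈ B then -1 else 1) *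
    (if 3 ∈ A ∧ 1 ∈ B then -1 else 1) * (if 3 ∈ A ∧ 2 ∈ B then -1 else 1) := by
  revert A B
  unfold shuffleSign
  decide

theorem erase_erase_univ :
    ((Finset.univ : Finset (Fin 4)).erase 0).erase 1 = {2, 3} ∧
    ((Finset.univ : Finset (Fin 4)).erase 0).erase 2 = {1, 3} ∧
    ((Finset.univ : Finset (Fin 4)).erase 0).erase 3 = {1, 2} ∧
    ((Finset.univ : Finset (Fin 4)).erase 1).erase 0 = {2, 3} ∧
    ((Finset.univ : Finset (Fin 4)).erase 1).erase 2 = {0, 3} ∧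
    ((Finset.univ : Finset (Fin 4)).erase 1).erase 3 = {0, 2} ∧
    ((Finset.univ : Finset (Fin 4)).erase 2).erase 0 = {1, 3} ∧
    ((Finset.univ : Finset (Fin 4)).erase 2).erase 1 = {0, 3} ∧
    ((Finset.univ : Finset (Fin 4)).erase 2).erase 3 = {0, 1} ∧
    ((Finset.univ : Finset (Fin 4)).erase 3).erase 0 = {1, 2} ∧
    ((Finset.univ : Finset (Fin 4)).erase 3).erase 1 = {0, 2} ∧
    ((Finset.univ : Finset (Fin 4)).erase 3).erase 2 = {0, 1} := by
  decide

theorem pair_swap :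
    ({1, 0} : Finset (Fin 4)) = {0, 1} ∧ ({2, 0} : Finset (Fin 4)) = {0, 2} ∧
    ({3, 0} : Finset (Fin 4)) = {0, 3} ∧ ({2, 1} : Finset (Fin 4)) = {1, 2} ∧
    ({3, 1} : Finset (Fin 4)) = {1, 3} ∧ ({3, 2} : Finset (Fin 4)) = {2, 3} := by
  decide

theorem val_extDeriv_erase (a : Form N half 2 R) (x : Site N half) (m : Fin 4) :
    val (extDeriv a) x (Finset.univ.erase m) = ∑ μ, if μ ≠ m then
      (shuffleSign {μ} ((Finset.univ.erase m).erase μ) : R) *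
      (val a (x.shift (dirs N {μ})) ((Finset.univ.erase m).erase μ) -
        val a x ((Finset.univ.erase m).erase μ)) else 0 := by
  rw [val_extDeriv _ _ (by rw [Finset.card_erase_of_mem (Finset.mem_univ m)]; rfl),
    ← Finset.sum_filter]
  exact Finset.sum_congr (by ext; simp) fun _ _ => rfl

theorem val_cup_univ (a b : Form N half 2 R) (x : Site N half) :
    val (cup a b) x Finset.univ =
      val a x {0, 1} * val b (x.shift ![1, 1, 0, 0]) {2, 3} -
      val a x {0, 2} * val b (x.shift ![1, 0, 1, 0]) {1, 3} +
      val a x {0, 3} * val b (x.shift ![1, 0, 0, 1]) {1, 2} +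
      val a x {1, 2} * val b (x.shift ![0, 1, 1, 0]) {0, 3} -
      val a x {1, 3} * val b (x.shift ![0, 1, 0, 1]) {0, 2} +
      val a x {2, 3} * val b (x.shift ![0, 0, 1, 1]) {0, 1} := by
  rw [val_cup _ _ _ (by rfl)]
  have h : ∑ A ∈ (Finset.univ : Finset (Fin 4)).powerset, (shuffleSign A (Finset.univ \ A) : R) *
        (val a x A * val b (x.shift (dirs N A)) (Finset.univ \ A)) =
      ∑ A ∈ ({{0, 1}, {0, 2}, {0, 3}, {1, 2}, {1, 3}, {2, 3}} : Finset (Finset (Fin 4))),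
        (shuffleSign A (Finset.univ \ A) : R) *
        (val a x A * val b (x.shift (dirs N A)) (Finset.univ \ A)) := by
    symm
    refine Finset.sum_subset (by decide) fun A _ hA => ?_
    have : A.card ≠ 2 := by revert A; decide
    rw [val_of_card_ne _ _ this, zero_mul, mul_zero]
  rw [h]
  rw [Finset.sum_insert (by decide), Finset.sum_insert (by decide), Finset.sum_insert (by decide),
    Finset.sum_insert (by decide), Finset.sum_insert (by decide), Finset.sum_singleton]
  have e1 : (Finset.univ \ {0, 1} : Finset (Fin 4)) = {2, 3} := by decide
  have e2 : (Finset.univ \ {0, 2} : Finset (Fin 4)) = {1, 3} := by decide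
  have e3 : (Finset.univ \ {0, 3} : Finset (Fin 4)) = {1, 2} := by decide
  have e4 : (Finset.univ \ {1, 2} : Finset (Fin 4)) = {0, 3} := by decide
  have e5 : (Finset.univ \ {1, 3} : Finset (Fin 4)) = {0, 2} := by decide
  have e6 : (Finset.univ \ {2, 3} : Finset (Fin 4)) = {0, 1} := by decide
  simp [e1, e2, e3, e4, e5, e6, dirs_eq, cast_shuffleSign_eq]
  ring

/-- The cases with bound `0` are stated with `ν = 0`, the form to which `ν ≤ 0` simplifies. -/
theorem card_filter_erase :
    ((Finset.univ.erase 0).filter fun ν : Fin 4 => ν ≤ 1).card = 1 ∧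
    ((Finset.univ.erase 0).filter fun ν : Fin 4 => ν ≤ 2).card = 2 ∧
    ((Finset.univ.erase 0).filter fun ν : Fin 4 => ν ≤ 3).card = 3 ∧
    ((Finset.univ.erase 1).filter fun ν : Fin 4 => ν = 0).card = 1 ∧
    ((Finset.univ.erase 1).filter fun ν : Fin 4 => ν ≤ 2).card = 2 ∧
    ((Finset.univ.erase 1).filter fun ν : Fin 4 => ν ≤ 3).card = 3 ∧
    ((Finset.univ.erase 2).filter fun ν : Fin 4 => ν = 0).card = 1 ∧
    ((Finset.univ.erase 2).filter fun ν : Fin 4 => ν ≤ 1).card = 2 ∧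
    ((Finset.univ.erase 2).filter fun ν : Fin 4 => ν ≤ 3).card = 3 ∧
    ((Finset.univ.erase 3).filter fun ν : Fin 4 => ν = 0).card = 1 ∧
    ((Finset.univ.erase 3).filter fun ν : Fin 4 => ν ≤ 1).card = 2 ∧
    ((Finset.univ.erase 3).filter fun ν : Fin 4 => ν ≤ 2).card = 3 := by
  decide

theorem card_filter_univ :
    (Finset.univ.filter fun ν : Fin 4 => ν = 0).card = 1 ∧
    (Finset.univ.filter fun ν : Fin 4 => ν ≤ 1).card = 2 ∧
    (Finset.univ.filter fun ν : Fin 4 => ν ≤ 2).card = 3 ∧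
    (Finset.univ.filter fun ν : Fin 4 => ν ≤ 3).card = 4 := by
  decide

theorem shift_vec_zero (x : Site N half) : x.shift ![0, 0, 0, 0] = x := by
  have : (![0, 0, 0, 0] : Fin 4 → ZMod N) = 0 := by ext i; fin_cases i <;> rfl
  rw [this, Site.shift_zero]

theorem val_cupOne_erase (a b : Form N half 2 R) (x : Site N half) (m : Fin 4) :
    val (cupOne a b) x (Finset.univ.erase m) = ![
      -(val a (x.shift ![0, 0, 0, 1]) {1, 2} * val b x {1, 3} -
        val a (x.shift ![0, 0, 1, 0]) {1, 3} * val b x {1, 2}) +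
      (-(val a (x.shift ![0, 0, 0, 1]) {1, 2} * val b (x.shift ![0, 1, 0, 0]) {2, 3}) +
        val a x {2, 3} * val b x {1, 2}) -
      (val a x {1, 3} * val b (x.shift ![0, 1, 0, 0]) {2, 3} -
        val a x {2, 3} * val b (x.shift ![0, 0, 1, 0]) {1, 3}),
      -(val a (x.shift ![0, 0, 0, 1]) {0, 2} * val b x {0, 3} -
        val a (x.shift ![0, 0, 1, 0]) {0, 3} * val b x {0, 2}) +
      (-(val a (x.shift ![0, 0, 0, 1]) {0, 2} * val b (x.shift ![1, 0, 0, 0]) {2, 3}) +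
        val a x {2, 3} * val b x {0, 2}) -
      (val a x {0, 3} * val b (x.shift ![1, 0, 0, 0]) {2, 3} -
        val a x {2, 3} * val b (x.shift ![0, 0, 1, 0]) {0, 3}),
      -(val a (x.shift ![0, 0, 0, 1]) {0, 1} * val b x {0, 3} -
        val a (x.shift ![0, 1, 0, 0]) {0, 3} * val b x {0, 1}) +
      (-(val a (x.shift ![0, 0, 0, 1]) {0, 1} * val b (x.shift ![1, 0, 0, 0]) {1, 3}) +
        val a x {1, 3} * val b x {0, 1}) -
      (val a x {0, 3} * val b (x.shift ![1, 0, 0, 0]) {1, 3} -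
        val a x {1, 3} * val b (x.shift ![0, 1, 0, 0]) {0, 3}),
      -(val a (x.shift ![0, 0, 1, 0]) {0, 1} * val b x {0, 2} -
        val a (x.shift ![0, 1, 0, 0]) {0, 2} * val b x {0, 1}) +
      (-(val a (x.shift ![0, 0, 1, 0]) {0, 1} * val b (x.shift ![1, 0, 0, 0]) {1, 2}) +
        val a x {1, 2} * val b x {0, 1}) -
      (val a x {0, 2} * val b (x.shift ![1, 0, 0, 0]) {1, 2} -
        val a x {1, 2} * val b (x.shift ![0, 1, 0, 0]) {0, 2})] m := by
  rw [val_cupOne_left _ _ _ (by rw [Finset.card_erase_of_mem (Finset.mem_univ m)]; rfl)]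
  fin_cases m <;>
  · simp [Fin.sum_univ_four, erase_erase_univ, pair_swap, dirs_eq, cast_shuffleSign_eq,
      card_filter_erase, shift_vec_zero]
    ring

/-- In top degree both sides are explicit polynomials in the components at translated sites; after
expansion the identity is one of commutative rings. -/
theorem cup_sub_cup_swap (a b : Form N half 2 R) (x : Site N half) :
    val (cup a b) x Finset.univ - val (cup b a) x Finset.univ =
      val (cupOne a (extDeriv b)) x Finset.univ + val (cupOne (extDeriv a) b) x Finset.univ -
        val (extDeriv (cupOne a b)) x Finset.univ := by
  rw [val_extDeriv _ _ (by rfl), val_cup_univ, val_cup_univ, val_cupOne_left _ _ _ (by rfl),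
    val_cupOne_right _ _ _ (by rfl)]
  simp [Fin.sum_univ_four, val_cupOne_erase, val_extDeriv_erase, erase_erase_univ, pair_swap, dirs_eq,
    cast_shuffleSign_eq, card_filter_univ, shift_vec_zero, Site.shift_shift]
  ring

end CupCommutator

/-! ### Linearity of `d` and `∂` -/

section Linear

variable {N : ℕ} {half : Bool} {R : Type} [CommRing R] {r : ℕ}

theorem val_add (α β : Form N half r R) (x : Site N half) (S : Finset (Fin 4)) :
    val (α + β) x S = val α x S + val β x S := by
  by_cases h : S.card = r
  · simp only [val_of_card _ _ h, Pi.add_apply]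
  · simp only [val_of_card_ne _ _ h, add_zero]

theorem val_smul (a : R) (α : Form N half r R) (x : Site N half) (S : Finset (Fin 4)) :
    val (a • α) x S = a * val α x S := by
  by_cases h : S.card = r
  · simp only [val_of_card _ _ h, Pi.smul_apply, smul_eq_mul]
  · simp only [val_of_card_ne _ _ h, mul_zero]

/-- The exterior derivative as a linear map. -/
def extDerivLin (N : ℕ) (half : Bool) (r : ℕ) (R : Type) [CommRing R] :
    Form N half r R →ₗ[R] Form N half (r + 1) R where
  toFun := extDeriv
  map_add' α β := by
    ext c
    simp only [extDeriv, Pi.add_apply, val_add, ← Finset.sum_add_distrib]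
    exact Finset.sum_congr rfl fun _ _ => by ring
  map_smul' a α := by
    ext c
    simp only [extDeriv, Pi.smul_apply, val_smul, smul_eq_mul, Finset.mul_sum, RingHom.id_apply]
    exact Finset.sum_congr rfl fun _ _ => by ring

/-- The boundary operator as a linear map. -/
def boundaryLin (N : ℕ) (half : Bool) (r : ℕ) (R : Type) [CommRing R] :
    Form N half (r + 1) R →ₗ[R] Form N half r R where
  toFun := boundary
  map_add' α β := by
    ext c
    simp only [boundary, Pi.add_apply, val_add, ← Finset.sum_add_distrib]
    exact Finset.sum_congr rfl fun _ _ => by ring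
  map_smul' a α := by
    ext c
    simp only [boundary, Pi.smul_apply, val_smul, smul_eq_mul, Finset.mul_sum, RingHom.id_apply]
    exact Finset.sum_congr rfl fun _ _ => by ring

theorem extDeriv_add (α β : Form N half r R) :
    extDeriv (α + β) = extDeriv α + extDeriv β := (extDerivLin N half r R).map_add α β

theorem extDeriv_sub (α β : Form N half r R) :
    extDeriv (α - β) = extDeriv α - extDeriv β := (extDerivLin N half r R).map_sub α β

theorem extDeriv_smul (a : R) (α : Form N half r R) :
    extDeriv (a • α) = a • extDeriv α := (extDerivLin N half r R).map_smul a α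

theorem val_toReal (n : Form N half r ℤ) (x : Site N half) (S : Finset (Fin 4)) :
    val (toReal n) x S = ((val n x S : ℤ) : ℝ) := by
  by_cases h : S.card = r
  · simp only [val_of_card _ _ h, toReal]
  · simp only [val_of_card_ne _ _ h, Int.cast_zero]

theorem toReal_extDeriv (n : Form N half r ℤ) : toReal (extDeriv n) = extDeriv (toReal n) := by
  ext c
  simp [toReal, extDeriv, val_toReal]

end Linear

/-! ### Adjointness, Stokes' theorem and `d² = 0` -/

section Dot

variable {N : ℕ} [NeZero N] {half : Bool} {R : Type} [CommRing R] {r : ℕ}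

/-- Summing over all subsets, with wrong sizes contributing zero, frees later reindexings from
cardinality proofs. -/
theorem dot_eq_sum_val (α β : Form N half r R) :
    dot α β = ∑ x, ∑ S : Finset (Fin 4), val α x S * val β x S := by
  rw [dot, Fintype.sum_prod_type]
  refine Finset.sum_congr rfl fun x _ => ?_
  have h : ∀ S : Finset (Fin 4), val α x S * val β x S =
      if h : S.card = r then α (x, ⟨S, h⟩) * β (x, ⟨S, h⟩) else 0 := by
    intro S
    by_cases hS : S.card = r
    · simp only [val_of_card _ _ hS, dif_pos hS]
    · simp only [val_of_card_ne _ _ hS, dif_neg hS, mul_zero]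
  simp only [h]
  rw [Finset.sum_dite, Finset.sum_const_zero, add_zero]
  exact Finset.sum_bij' (fun S _ => ⟨S.1, by simp [S.2]⟩) (fun S _ => ⟨S.1, by simpa using S.2⟩)
    (by simp) (by simp) (by simp) (by simp) (by simp)

theorem dot_comm (α β : Form N half r R) : dot α β = dot β α := dotProduct_comm α β

theorem eq_zero_of_dot_eq_zero {α : Form N half r R} (h : ∀ β, dot α β = 0) : α = 0 :=
  dotProduct_eq_zero_iff.1 h

theorem shuffleSign_singleton_right (S : Finset (Fin 4)) (μ : Fin 4) (h : μ ∉ S) :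
    shuffleSign S {μ} = (-1) ^ S.card * shuffleSign {μ} S := by
  revert S μ
  decide

/-- The exterior derivative and the boundary operator are adjoint up to a sign. -/
theorem dot_extDeriv (α : Form N half r R) (β : Form N half (r + 1) R) :
    dot (extDeriv α) β = (-1) ^ (r + 1) * dot α (boundary β) := by
  have hL : dot (extDeriv α) β = ∑ x, ∑ S : Finset (Fin 4), ∑ μ ∈ S,
      (shuffleSign {μ} (S.erase μ) : R) * (val α (x.shift (dirs N {μ})) (S.erase μ) -
        val α x (S.erase μ)) * val β x S := by
    rw [dot_eq_sum_val]
    refine Finset.sum_congr rfl fun x _ => Finset.sum_congr rfl fun S _ => ?_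
    rw [← Finset.sum_mul]
    by_cases hS : S.card = r + 1
    · rw [val_extDeriv _ _ hS]
    · rw [val_of_card_ne β _ hS, mul_zero, mul_zero]
  have hR : dot α (boundary β) = ∑ x, ∑ S : Finset (Fin 4), ∑ μ ∈ Sᶜ, (shuffleSign S {μ} : R) *
      (val α x S * (val β x (insert μ S) - val β (x.shift (-dirs N {μ})) (insert μ S))) := by
    rw [dot_eq_sum_val]
    refine Finset.sum_congr rfl fun x _ => Finset.sum_congr rfl fun S _ => ?_
    by_cases hS : S.card = r
    · rw [val_boundary _ _ hS, Finset.mul_sum]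
      exact Finset.sum_congr rfl fun _ _ => by ring
    · rw [val_of_card_ne α _ hS]
      simp
  have hs : ∀ (t : Finset (Fin 4) → Finset (Fin 4)) (f : Site N half → Finset (Fin 4) → Fin 4 → R),
      ∑ x, ∑ S, ∑ μ ∈ t S, f x S μ =
        ∑ p ∈ (Finset.univ : Finset (Finset (Fin 4))).sigma t, ∑ x, f x p.1 p.2 := fun t f => by
    rw [Finset.sum_comm, Finset.sum_sigma]
    exact Finset.sum_congr rfl fun S _ => Finset.sum_comm
  rw [hL, hR, hs (fun S => S), hs (fun S => Sᶜ), Finset.mul_sum]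
  -- A cell with a chosen direction corresponds to the face that omits it, together with that
  -- direction.
  refine Finset.sum_bij' (fun (p : (_ : Finset (Fin 4)) × Fin 4) _ => ⟨p.1.erase p.2, p.2⟩)
    (fun (p : (_ : Finset (Fin 4)) × Fin 4) _ => ⟨insert p.2 p.1, p.2⟩)
    (by simp) (by simp) (fun p hp => ?_) (fun p hp => ?_) fun p hp => ?_
  · simp only [Finset.mem_sigma, Finset.mem_univ, true_and] at hp
    simp [Finset.insert_erase hp]
  · simp only [Finset.mem_sigma, Finset.mem_univ, true_and, Finset.mem_compl] at hp
    simp [Finset.erase_insert hp]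
  · obtain ⟨S, μ⟩ := p
    simp only [Finset.mem_sigma, Finset.mem_univ, true_and] at hp
    simp only
    rw [Finset.insert_erase hp, shuffleSign_singleton_right _ _ (Finset.notMem_erase μ S)]
    by_cases hS : S.card = r + 1
    swap
    · simp [val_of_card_ne β _ hS]
    have hc : (S.erase μ).card = r := by rw [Finset.card_erase_of_mem hp, hS]; rfl
    rw [hc, ← Finset.mul_sum]
    have h1 : ∀ x : Site N half, (shuffleSign {μ} (S.erase μ) : R) *
        (val α (x.shift (dirs N {μ})) (S.erase μ) - val α x (S.erase μ)) * val β x S =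
        (shuffleSign {μ} (S.erase μ) : R) * (val α (x.shift (dirs N {μ})) (S.erase μ) * val β x S) -
        (shuffleSign {μ} (S.erase μ) : R) * (val α x (S.erase μ) * val β x S) := fun x => by ring
    simp only [h1]
    simp only [mul_sub (val α _ _), Finset.sum_sub_distrib, ← Finset.mul_sum]
    rw [sum_shift_mul_shift (fun x => val α x (S.erase μ)) (fun x => val β x S)]
    push_cast
    have h2 : (-1 : R) ^ (r + 1) * (-1) ^ r = -1 := by
      rw [← pow_add, show r + 1 + r = 2 * r + 1 by ring, pow_succ, pow_mul]
      simp
    linear_combination (-(shuffleSign {μ} (S.erase μ) : R) * (∑ x, val α x (S.erase μ) * val β x S) +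
      (shuffleSign {μ} (S.erase μ) : R) *
        (∑ x : Site N half, val α x (S.erase μ) * val β (x.shift (-dirs N {μ})) S)) * h2

theorem total_extDeriv (ω : Form N half 3 R) : total (extDeriv ω) = 0 := by
  have h : ∀ x : Site N half, val (extDeriv ω) x Finset.univ =
      ∑ μ, (shuffleSign {μ} (Finset.univ.erase μ) : R) *
        (val ω (x.shift (dirs N {μ})) (Finset.univ.erase μ) - val ω x (Finset.univ.erase μ)) :=
    fun x => val_extDeriv ω x rfl
  simp only [total, h]
  rw [Finset.sum_comm]
  refine Finset.sum_eq_zero fun μ _ => ?_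
  rw [← Finset.mul_sum, Finset.sum_sub_distrib,
    sum_shift (fun x => val ω x (Finset.univ.erase μ)), sub_self, mul_zero]

/-- The exact term in Steenrod's formula sums to zero on the torus. -/
theorem total_cup_sub_total_cup (a b : Form N half 2 R) :
    total (cup a b) - total (cup b a) =
      total (cupOne a (extDeriv b)) + total (cupOne (extDeriv a) b) := by
  have h := total_extDeriv (cupOne a b)
  simp only [total] at h ⊢
  rw [← Finset.sum_sub_distrib, ← Finset.sum_add_distrib,
    ← sub_zero (∑ x, (val (cupOne a (extDeriv b)) x Finset.univ + _)), ← h, ← Finset.sum_sub_distrib]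
  exact Finset.sum_congr rfl fun x _ => cup_sub_cup_swap a b x

theorem val_extDeriv_pair {N : ℕ} (A : Form N half 1 R) (x : Site N half) {i j : Fin 4} (h : i < j) :
    val (extDeriv A) x {i, j} = val A (x.shift (dirs N {i})) {j} - val A x {j} -
      (val A (x.shift (dirs N {j})) {i} - val A x {i}) := by
  rw [val_extDeriv _ _ (Finset.card_pair h.ne), Finset.sum_pair h.ne]
  have h1 : ({i, j} : Finset (Fin 4)).erase i = {j} := by
    rw [Finset.erase_insert]; simpa using h.ne
  have h2 : ({i, j} : Finset (Fin 4)).erase j = {i} := by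
    rw [Finset.pair_comm, Finset.erase_insert]; simpa using h.ne'
  have h3 : ∀ i j : Fin 4, i < j → shuffleSign {i} {j} = 1 ∧ shuffleSign {j} {i} = -1 := by decide
  rw [h1, h2, (h3 i j h).1, (h3 i j h).2]
  push_cast
  ring

theorem extDeriv_extDeriv {N : ℕ} (A : Form N half 1 R) : extDeriv (extDeriv A) = 0 := by
  refine form_ext fun x S hS => ?_
  obtain ⟨m, rfl⟩ : ∃ m, S = Finset.univ.erase m := by
    revert S; decide
  rw [val_extDeriv_erase]
  have h0 : val (0 : Form N half 3 R) x (Finset.univ.erase m) = 0 := by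
    rw [val_of_card _ _ hS]; rfl
  rw [h0]
  fin_cases m <;>
  · simp [Fin.sum_univ_four, erase_erase_univ, val_extDeriv_pair, dirs_eq, cast_shuffleSign_eq,
      Site.shift_shift]
    ring

end Dot

/-! ### Signs and offsets of the two framings -/

theorem Framing.flip_flip (fr : Framing) : fr.flip.flip = fr := by cases fr <;> rfl

/-- `1` for the plain framing and `-1` for the dual one. -/
def Framing.sign : Framing → ℤ
  | plain => 1
  | dual => -1

theorem Framing.sign_mul_self (fr : Framing) : fr.sign * fr.sign = 1 := by cases fr <;> rfl

/-- The sign with which the complementary cells in the directions `S` and `Sᶜ` are paired by the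
cup product (`plain`) or the reversed cup product (`dual`). -/
def Framing.cellSign : Framing → Finset (Fin 4) → ℤ
  | plain, S => shuffleSign S Sᶜ
  | dual, S => shuffleSign Sᶜ S

/-- The displacement between the complementary cells that are paired by the cup product (`plain`)
or the reversed cup product (`dual`). -/
def Framing.offset (N : ℕ) : Framing → Finset (Fin 4) → Fin 4 → ZMod N
  | plain, S => dirs N S
  | dual, S => -dirs N Sᶜ

theorem Framing.cellSign_flip_compl (fr : Framing) (S : Finset (Fin 4)) :
    fr.flip.cellSign Sᶜ = fr.cellSign S := by
  cases fr <;> simp [Framing.flip, Framing.cellSign]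

theorem Framing.cellSign_mul_self (fr : Framing) (S : Finset (Fin 4)) :
    fr.cellSign S * fr.cellSign S = 1 := by
  cases fr <;> simp [Framing.cellSign, shuffleSign, ← mul_pow]

theorem Framing.offset_flip_compl (N : ℕ) (fr : Framing) (S : Finset (Fin 4)) :
    fr.flip.offset N Sᶜ = -fr.offset N S := by
  cases fr <;> simp [Framing.flip, Framing.offset]

theorem Framing.offset_insert (N : ℕ) (fr : Framing) (S : Finset (Fin 4)) (ν : Fin 4) (h : ν ∉ S) :
    fr.offset N (insert ν S) = fr.offset N S + dirs N {ν} := by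
  cases fr
  · ext i
    by_cases hi : i = ν
    · subst hi; simp [Framing.offset, dirs, h]
    · simp [Framing.offset, dirs, hi]
  · ext i
    by_cases hi : i = ν
    · subst hi; simp [Framing.offset, dirs, h]
    · simp [Framing.offset, dirs, hi]

/-- A finite check in the degree needed; the sign relation depends on the degree. -/
theorem Framing.cellSign_boundary (fr : Framing) (S : Finset (Fin 4)) (ν : Fin 4) (h : ν ∈ S)
    (hS : S.card = 2) :
    fr.cellSign S * shuffleSign Sᶜ {ν} =
      -fr.sign * (shuffleSign {ν} (S.erase ν) * fr.cellSign (S.erase ν)) := by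
  cases fr
  · revert S ν; simp only [Framing.cellSign, Framing.sign]; decide
  · revert S ν; simp only [Framing.cellSign, Framing.sign]; decide

theorem Framing.cellSign_extDeriv (fr : Framing) (S : Finset (Fin 4)) (ν : Fin 4) (h : ν ∈ Sᶜ)
    (hS : S.card = 1) :
    shuffleSign S {ν} * fr.cellSign (insert ν S) =
      fr.sign * (fr.cellSign S * shuffleSign {ν} (Sᶜ.erase ν)) := by
  cases fr
  · revert S ν; simp only [Framing.cellSign, Framing.sign]; decide
  · revert S ν; simp only [Framing.cellSign, Framing.sign]; decide

/-! ### The two lattice Hodge stars -/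

section Hodge

variable {N : ℕ} {half : Bool} {R : Type} [CommRing R] {p q : ℕ}

/-- The lattice Hodge star that represents the (reversed) cup product with values in the
`4`-forms by the Euclidean inner product. -/
def hodge (fr : Framing) (p : ℕ) (β : Form N half q R) : Form N half p R := fun c =>
  (fr.cellSign c.2.1 : R) * val β (c.1.shift (fr.offset N c.2.1)) c.2.1ᶜ

theorem val_hodge (fr : Framing) (β : Form N half q R) (x : Site N half) {S : Finset (Fin 4)}
    (h : S.card = p) : val (hodge fr p β) x S =
      (fr.cellSign S : R) * val β (x.shift (fr.offset N S)) Sᶜ := val_of_card _ _ h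

theorem card_compl_of_add_eq (h : p + q = 4) {S : Finset (Fin 4)} (hS : S.card = p) :
    Sᶜ.card = q := by
  rw [Finset.card_compl, hS, Fintype.card_fin]; omega

/-- Passing to the complement and the other framing negates the offset and keeps the sign. Hence the
two stars are inverse to each other, without the usual degree-dependent sign. -/
theorem hodge_flip_hodge (h : p + q = 4) (fr : Framing) (β : Form N half q R) :
    hodge fr.flip q (hodge fr p β) = β := by
  refine form_ext fun x S hS => ?_
  have h2 := fr.flip.offset_flip_compl N S
  have h3 := fr.flip.cellSign_flip_compl S
  rw [Framing.flip_flip] at h2 h3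
  rw [val_hodge _ _ _ hS, val_hodge _ _ _ (card_compl_of_add_eq (by omega : q + p = 4) hS),
    Site.shift_shift, h2, h3, compl_compl, add_neg_cancel, Site.shift_zero, ← mul_assoc,
    ← Int.cast_mul, Framing.cellSign_mul_self, Int.cast_one, one_mul]

theorem hodge_hodge_flip (h : p + q = 4) (fr : Framing) (β : Form N half q R) :
    hodge fr q (hodge fr.flip p β) = β := by
  have := hodge_flip_hodge h fr.flip β
  rwa [Framing.flip_flip] at this

theorem hodge_add (fr : Framing) (α β : Form N half q R) :
    hodge fr p (α + β) = hodge fr p α + hodge fr p β := by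
  ext c
  simp only [hodge, val_add, Pi.add_apply, mul_add]

theorem hodge_smul (fr : Framing) (a : R) (β : Form N half q R) :
    hodge fr p (a • β) = a • hodge fr p β := by
  ext c
  simp only [hodge, val_smul, Pi.smul_apply, smul_eq_mul]
  ring

/-- The Hodge star as a linear map. -/
def hodgeLin (N : ℕ) (half : Bool) (R : Type) [CommRing R] (fr : Framing) (p q : ℕ) :
    Form N half q R →ₗ[R] Form N half p R where
  toFun := hodge fr p
  map_add' := hodge_add fr
  map_smul' := hodge_smul fr

theorem toReal_hodge (fr : Framing) (n : Form N half q ℤ) :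
    toReal (hodge fr p n) = hodge fr p (toReal n) := by
  ext c
  simp [toReal, hodge, val_toReal]

/-- The Hodge star turns the boundary of a `3`-form into an exterior derivative. -/
theorem hodge_boundary (fr : Framing) (y : Form N half 3 R) :
    hodge fr 2 (boundary y) = (-fr.sign : R) • extDeriv (hodge fr 1 y) := by
  refine form_ext fun x S hS => ?_
  rw [val_hodge _ _ _ hS, val_smul, val_boundary _ _ (card_compl_of_add_eq (by rfl : 2 + 2 = 4) hS),
    val_extDeriv _ _ hS, Finset.mul_sum, Finset.mul_sum, compl_compl]
  refine Finset.sum_congr rfl fun ν hν => ?_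
  have hc : (S.erase ν).card = 1 := by rw [Finset.card_erase_of_mem hν, hS]
  have ho := fr.offset_insert N (S.erase ν) ν (Finset.notMem_erase ν S)
  rw [Finset.insert_erase hν] at ho
  have hs := congrArg (Int.cast (R := R)) (fr.cellSign_boundary S ν hν hS)
  push_cast at hs
  rw [val_hodge _ _ _ hc, val_hodge _ _ _ hc, Site.shift_shift, Site.shift_shift, ho,
    Finset.compl_erase, add_neg_cancel_right, add_comm (dirs N {ν})]
  linear_combination (val y (x.shift (fr.offset N (S.erase ν) + dirs N {ν})) (insert ν Sᶜ) -
    val y (x.shift (fr.offset N (S.erase ν))) (insert ν Sᶜ)) * hs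

/-- The boundary of the Hodge star of a `2`-form is the Hodge star of its exterior derivative. -/
theorem boundary_hodge (fr : Framing) (l : Form N half 2 R) :
    boundary (hodge fr 2 l) = (fr.sign : R) • hodge fr 1 (extDeriv l) := by
  refine form_ext fun x S hS => ?_
  rw [val_boundary _ _ hS, val_smul, val_hodge _ _ _ hS,
    val_extDeriv _ _ (card_compl_of_add_eq (by rfl : 1 + 3 = 4) hS), Finset.mul_sum, Finset.mul_sum]
  refine Finset.sum_congr rfl fun ν hν => ?_
  have hν' : ν ∉ S := Finset.mem_compl.1 hν
  have hc : (insert ν S).card = 2 := by rw [Finset.card_insert_of_notMem hν', hS]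
  have hs := congrArg (Int.cast (R := R)) (fr.cellSign_extDeriv S ν hν hS)
  push_cast at hs
  rw [val_hodge _ _ _ hc, val_hodge _ _ _ hc, Site.shift_shift, Site.shift_shift,
    fr.offset_insert N S ν hν', Finset.compl_insert]
  have h1 : -dirs N {ν} + (fr.offset N S + dirs N {ν}) = fr.offset N S := by abel
  rw [h1]
  linear_combination (val l (x.shift (fr.offset N S + dirs N {ν})) (Sᶜ.erase ν) -
    val l (x.shift (fr.offset N S)) (Sᶜ.erase ν)) * hs

variable [NeZero N]

/-- Transposing a star reverses the factors of the cup product, that is, flips the framing. With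
`hodge_flip_hodge` this makes each star an isometry. -/
theorem dot_hodge (h : p + q = 4) (fr : Framing) (α : Form N half p R) (β : Form N half q R) :
    dot α (hodge fr p β) = dot (hodge fr.flip q α) β := by
  rw [dot_eq_sum_val, dot_eq_sum_val, Finset.sum_comm, Finset.sum_comm (γ := Site N half)]
  refine Fintype.sum_equiv (Equiv.mk compl compl compl_compl compl_compl) _ _ fun S => ?_
  simp only [Equiv.coe_fn_mk]
  by_cases hS : S.card = p
  · have hc := card_compl_of_add_eq h hS
    simp only [val_hodge _ _ _ hS, val_hodge _ _ _ hc, fr.offset_flip_compl, compl_compl,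
      fr.cellSign_flip_compl]
    have := sum_shift_mul_shift (fun x => val α x S) (fun x => val β x Sᶜ) (-fr.offset N S)
    rw [neg_neg] at this
    simp only [mul_assoc, mul_left_comm _ (fr.cellSign S : R), ← Finset.mul_sum]
    rw [this]
  · have hc : Sᶜ.card ≠ q := fun hc => hS (by
      rw [Finset.card_compl, Fintype.card_fin] at hc
      have := S.card_le_univ
      rw [Fintype.card_fin] at this
      omega)
    simp only [val_of_card_ne _ _ hS, val_of_card_ne _ _ hc, mul_zero]

theorem dot_hodge_hodge (h : p + q = 4) (fr : Framing) (α β : Form N half q R) :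
    dot (hodge fr p α) (hodge fr p β) = dot α β := by
  rw [dot_hodge h, hodge_flip_hodge h]

theorem sum_val_cup (h : p + q = 4) (α : Form N half p R) (β : Form N half q R) :
    ∑ x, val (cup α β) x Finset.univ = dot α (hodge .plain p β) := by
  rw [dot_eq_sum_val]
  refine Finset.sum_congr rfl fun x _ => ?_
  rw [val_cup _ _ _ (by rw [Finset.card_univ, Fintype.card_fin, h]), Finset.powerset_univ]
  refine Finset.sum_congr rfl fun S _ => ?_
  by_cases hS : S.card = p
  · rw [val_hodge _ _ _ hS, ← Finset.compl_eq_univ_sdiff]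
    simp only [Framing.cellSign, Framing.offset]
    ring
  · simp only [val_of_card_ne _ _ hS, zero_mul, mul_zero]

end Hodge

/-! ### Orthogonality relations between `d`, `∂` and the stars -/

section Adjoint

variable {N : ℕ} [NeZero N] {half : Bool} {R : Type} [CommRing R] {r : ℕ}

theorem dot_add (α β γ : Form N half r R) : dot α (β + γ) = dot α β + dot α γ :=
  dotProduct_add α β γ

theorem add_dot (α β γ : Form N half r R) : dot (α + β) γ = dot α γ + dot β γ :=
  add_dotProduct α β γ

theorem dot_sub (α β γ : Form N half r R) : dot α (β - γ) = dot α β - dot α γ :=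
  dotProduct_sub α β γ

theorem sub_dot (α β γ : Form N half r R) : dot (α - β) γ = dot α γ - dot β γ :=
  sub_dotProduct α β γ

theorem dot_smul (a : R) (α β : Form N half r R) : dot α (a • β) = a * dot α β :=
  dotProduct_smul a α β

theorem smul_dot (a : R) (α β : Form N half r R) : dot (a • α) β = a * dot α β :=
  smul_dotProduct a α β

theorem dot_zero (α : Form N half r R) : dot α 0 = 0 := dotProduct_zero α

theorem dot_extDeriv_one (A : Form N half 1 R) (a : Form N half 2 R) :
    dot (extDeriv A) a = dot A (boundary a) := by
  rw [dot_extDeriv]; ring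

theorem dot_boundary_three (a : Form N half 2 R) (y : Form N half 3 R) :
    dot (boundary y) a = -dot y (extDeriv a) := by
  rw [dot_comm, dot_comm y, dot_extDeriv]; ring

theorem extDeriv_eq_zero_of_dot_boundary {a : Form N half 2 R}
    (h : ∀ y, dot (boundary y) a = 0) : extDeriv a = 0 := by
  refine eq_zero_of_dot_eq_zero fun y => ?_
  have := h y
  rwa [dot_boundary_three, neg_eq_zero, dot_comm] at this

/-- The transpose of `d² = 0`. -/
theorem boundary_boundary (y : Form N half 3 R) : boundary (boundary y) = 0 := by
  refine eq_zero_of_dot_eq_zero fun A => ?_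
  rw [dot_comm, ← dot_extDeriv_one, dot_comm, dot_boundary_three, extDeriv_extDeriv, dot_zero,
    neg_zero]

theorem dot_extDeriv_boundary (A : Form N half 1 R) (y : Form N half 3 R) :
    dot (extDeriv A) (boundary y) = 0 := by
  rw [dot_extDeriv_one, boundary_boundary, dot_zero]

theorem eq_zero_of_dot_self {α : Form N half r ℝ} (h : dot α α = 0) : α = 0 :=
  dotProduct_self_eq_zero.1 h

theorem boundary_hodge_of_closed {N : ℕ} (fr : Framing) {l : Form N half 2 R}
    (h : extDeriv l = 0) : boundary (hodge fr 2 l) = 0 := by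
  have h0 : hodge fr 1 (0 : Form N half 3 R) = 0 := (hodgeLin N half R fr 1 3).map_zero
  rw [boundary_hodge, h, h0, smul_zero]

theorem total_cup_eq_dot (a b : Form N half 2 R) :
    total (cup a b) = dot a (hodge .plain 2 b) := sum_val_cup rfl a b

theorem total_cup_eq_dot_dual (a b : Form N half 2 R) :
    total (cup a b) = dot b (hodge .dual 2 a) := by
  rw [total_cup_eq_dot, dot_hodge rfl, dot_comm]; rfl

end Adjoint

/-! ### The projection onto `Im ∂` and the Hodge decomposition -/

section Projection

variable {N : ℕ} [NeZero N] {half : Bool}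

theorem exists_projBoundary_eq (a : Form N half 2 ℝ) :
    ∃ y : Form N half 3 ℝ, projBoundary a = boundary y := by
  have h := (coexact N half).starProjection_apply_mem (WithLp.toLp 2 a)
  -- The image of a linear map is already a subspace, so the span adds nothing.
  have h2 : coexact N half = LinearMap.range
      ((WithLp.linearEquiv 2 ℝ (Form N half 2 ℝ)).symm.toLinearMap ∘ₗ boundaryLin N half 2 ℝ) := by
    rw [coexact, ← Submodule.span_eq (LinearMap.range _)]
    rfl
  obtain ⟨y, hy⟩ : (coexact N half).starProjection (WithLp.toLp 2 a) ∈ LinearMap.range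
      ((WithLp.linearEquiv 2 ℝ (Form N half 2 ℝ)).symm.toLinearMap ∘ₗ boundaryLin N half 2 ℝ) := by
    rw [← h2]
    exact h
  exact ⟨y, congrArg WithLp.ofLp hy.symm⟩

/-- The remainder is orthogonal to `Im ∂`, and `d` is minus the transpose of this `∂`. -/
theorem extDeriv_sub_projBoundary (a : Form N half 2 ℝ) : extDeriv (a - projBoundary a) = 0 := by
  refine extDeriv_eq_zero_of_dot_boundary fun y => ?_
  have h := (coexact N half).starProjection_inner_eq_zero (WithLp.toLp 2 a)
    (WithLp.toLp 2 (boundary y)) (Submodule.subset_span ⟨y, rfl⟩)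
  exact h

/-- Project the star of `m` onto `Im ∂` and return by the inverse star. This star carries `Im ∂` to
exact forms and closed forms to coclosed ones. -/
theorem exists_hodge_decomposition (m : Form N half 2 ℝ) (hm : extDeriv m = 0) :
    ∃ (A : Form N half 1 ℝ) (h : Form N half 2 ℝ),
      m = extDeriv A + h ∧ extDeriv h = 0 ∧ boundary h = 0 := by
  set b := hodge .plain 2 m
  obtain ⟨y, hy⟩ := exists_projBoundary_eq b
  have hmb : m = hodge .dual 2 b := (hodge_flip_hodge rfl .plain m).symm
  have hd : hodge .dual 2 (boundary y) = extDeriv (hodge .dual 1 y) := by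
    rw [hodge_boundary]
    simp [Framing.sign]
  have hm2 : m = extDeriv (hodge .dual 1 y) + hodge .dual 2 (b - projBoundary b) := by
    rw [← hd, ← hy, ← hodge_add, add_sub_cancel]
    exact hmb
  refine ⟨_, _, hm2, ?_, boundary_hodge_of_closed _ (extDeriv_sub_projBoundary b)⟩
  have h := congrArg extDeriv hm2
  rwa [hm, extDeriv_add, extDeriv_extDeriv, zero_add, eq_comm] at h

end Projection

/-! ### Harmonic 2-forms are constant; the intersection form is even -/

section Harmonic

variable {N : ℕ} {half : Bool} {R : Type} [CommRing R] {r : ℕ}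

/-- The translate of a form. -/
def translate (v : Fin 4 → ZMod N) (α : Form N half r R) : Form N half r R :=
  fun c => α (c.1.shift v, c.2)

theorem val_translate (v : Fin 4 → ZMod N) (α : Form N half r R) (x : Site N half)
    (S : Finset (Fin 4)) : val (translate v α) x S = val α (x.shift v) S := rfl

theorem boundary_translate (v : Fin 4 → ZMod N) (α : Form N half (r + 1) R) :
    boundary (translate v α) = translate v (boundary α) := by
  ext c
  simp only [boundary, translate, val_translate, Site.shift_shift, add_comm]

theorem exists_eq_pair_of_card_two : ∀ S : Finset (Fin 4), S.card = 2 →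
    S = {0, 1} ∨ S = {0, 2} ∨ S = {0, 3} ∨ S = {1, 2} ∨ S = {1, 3} ∨ S = {2, 3} := by
  decide

/-- Cartan's formula for a closed `2`-form. -/
theorem translate_sub_of_closed {h : Form N half 2 ℝ} (hd : extDeriv h = 0) (μ : Fin 4) :
    translate (dirs N {μ}) h - h = extDeriv (interiorProduct μ h) := by
  have key : ∀ (x : Site N half) (m : Fin 4), val (extDeriv h) x (Finset.univ.erase m) = 0 := by
    intro x m
    rw [hd]
    exact dite_eq_right_iff.2 fun _ => rfl
  simp only [val_extDeriv_erase] at key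
  refine form_ext fun x S hS => ?_
  have hsub : val (translate (dirs N {μ}) h - h) x S =
      val h (x.shift (dirs N {μ})) S - val h x S := by
    rw [val_of_card _ _ hS, val_of_card _ _ hS, val_of_card _ _ hS]
    rfl
  have h0 := key x 0
  have h1 := key x 1
  have h2 := key x 2
  have h3 := key x 3
  simp only [Fin.sum_univ_four, erase_erase_univ, dirs_eq, cast_shuffleSign_eq] at h0 h1 h2 h3
  -- The repeated direction gives a set of one element, on which a 2-form has value zero by
  -- convention.
  have hc : ∀ (y : Site N half) (i : Fin 4), val (interiorProduct i h) y {i} = 0 := fun y i => by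
    have h1 : ({i} : Finset (Fin 4)).card = 1 := Finset.card_singleton i
    have h2 : (insert i {i} : Finset (Fin 4)).card ≠ 2 := by simp
    rw [val_of_card _ _ h1, interiorProduct, val_of_card_ne _ _ h2, mul_zero]
  rw [hsub]
  rcases exists_eq_pair_of_card_two S hS with rfl | rfl | rfl | rfl | rfl | rfl <;>
    fin_cases μ <;>
    simp [val_extDeriv_pair, val_interiorProduct, dirs_eq, cast_shuffleSign_eq, pair_swap, hc] at h0 h1 h2 h3 ⊢ <;>
    linarith

/-- The difference is exact by Cartan's formula and coclosed because `∂` commutes with translations,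
hence orthogonal to itself. -/
theorem translate_eq_of_harmonic [NeZero N] {h : Form N half 2 ℝ} (hd : extDeriv h = 0)
    (hb : boundary h = 0) (μ : Fin 4) : translate (dirs N {μ}) h = h := by
  rw [← sub_eq_zero]
  refine eq_zero_of_dot_self ?_
  nth_rw 1 [translate_sub_of_closed hd μ]
  have h2 : boundary (translate (dirs N {μ}) h - h) = boundary (translate (dirs N {μ}) h) - boundary h :=
    (boundaryLin N half 1 ℝ).map_sub _ _
  rw [dot_extDeriv_one, h2, boundary_translate, hb]
  simp [translate, dot]

theorem site_ext {x y : Site N half} (h : ∀ i, x.coord i = y.coord i) : x = y := by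
  cases x; cases y
  simpa [funext_iff] using h

theorem Site.shift_dirs_induction {P : Site N half → Prop} {x : Site N half} (hx : P x)
    (hP : ∀ y (μ : Fin 4), P y → P (y.shift (dirs N {μ}))) [NeZero N] (v : Fin 4 → ZMod N) :
    P (x.shift v) := by
  have h1 : ∀ (μ : Fin 4) (k : ℕ) y, P y → P (y.shift (k • dirs N {μ})) := by
    intro μ k
    induction k with
    | zero => intro y hy; rwa [zero_smul, Site.shift_zero]
    | succ k ih =>
      intro y hy
      rw [succ_nsmul, ← Site.shift_shift]
      exact hP _ _ (ih y hy)
  -- Residues have natural representatives, so forward steps reach every site.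
  have h2 : v = (v 0).val • dirs N {0} + (v 1).val • dirs N {1} + (v 2).val • dirs N {2} +
      (v 3).val • dirs N {3} := by
    ext i
    fin_cases i <;> simp [dirs, -ZMod.natCast_val, ZMod.natCast_zmod_val]
  rw [h2]
  simp only [← Site.shift_shift]
  exact h1 _ _ _ (h1 _ _ _ (h1 _ _ _ (h1 _ _ _ hx)))

theorem val_shift_of_harmonic [NeZero N] {h : Form N half 2 ℝ} (hd : extDeriv h = 0)
    (hb : boundary h = 0) (x : Site N half) (v : Fin 4 → ZMod N) (S : Finset (Fin 4)) :
    val h (x.shift v) S = val h x S := by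
  refine Site.shift_dirs_induction (P := fun y => val h y S = val h x S) rfl (fun y μ hy => ?_) v
  rw [← hy, ← val_translate, translate_eq_of_harmonic hd hb]

theorem dirs_singleton (i : Fin 4) : dirs N {i} = Pi.single i 1 := by
  ext k
  simp [dirs, Pi.single_apply]

theorem sum_add_one [NeZero N] (f : ZMod N → R) : ∑ a, f (a + 1) = ∑ a, f a :=
    Equiv.sum_comp (Equiv.addRight (1 : ZMod N)) f

/-- The sum of an exact form over a coordinate plane vanishes. -/
theorem sum_plane_extDeriv [NeZero N] (A : Form N half 1 R) (x : Site N half) {i j : Fin 4}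
    (hij : i < j) :
    ∑ a : ZMod N, ∑ b : ZMod N,
      val (extDeriv A) (x.shift (Pi.single i a + Pi.single j b)) {i, j} = 0 := by
  have h1 : ∀ a b : ZMod N, (x.shift (Pi.single i a + Pi.single j b)).shift (dirs N {i}) =
      x.shift (Pi.single i (a + 1) + Pi.single j b) := fun a b => by
    rw [Site.shift_shift, dirs_singleton, Pi.single_add, add_right_comm]
  have h2 : ∀ a b : ZMod N, (x.shift (Pi.single i a + Pi.single j b)).shift (dirs N {j}) =
      x.shift (Pi.single i a + Pi.single j (b + 1)) := fun a b => by
    rw [Site.shift_shift, dirs_singleton, Pi.single_add, add_assoc]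
  have h5 : ∀ a : ZMod N, ∑ b : ZMod N, val A (x.shift (Pi.single i a + Pi.single j (b + 1))) {i} =
      ∑ b : ZMod N, val A (x.shift (Pi.single i a + Pi.single j b)) {i} := by
    intro a
    have h := sum_add_one fun b : ZMod N => val A (x.shift (Pi.single i a + Pi.single j b)) {i}
    exact h
  have h6 := sum_add_one fun a : ZMod N =>
    ∑ b : ZMod N, val A (x.shift (Pi.single i a + Pi.single j b)) {j}
  rw [Finset.sum_congr rfl fun a _ => Finset.sum_congr rfl fun b _ => val_extDeriv_pair A _ hij]
  simp only [h1, h2]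
  simp only [Finset.sum_sub_distrib]
  rw [h6, Finset.sum_congr rfl fun a _ => h5 a, sub_self, sub_self, sub_self]

/-- The intersection form of the torus is even. -/
theorem even_total_cup_self [NeZero N] {m : Form N half 2 ℤ} (hm : extDeriv m = 0) :
    Even (total (cup m m)) := by
  have hmR : extDeriv (toReal m) = 0 := by
    rw [← toReal_extDeriv, hm]
    ext c
    simp [toReal]
  obtain ⟨A, h, hA, hd, hb⟩ := exists_hodge_decomposition (toReal m) hmR
  set o : Site N half := ⟨0⟩
  have hconst : ∀ x S, val h x S = val h o S := fun x S => by
    have := val_shift_of_harmonic hd hb o x.coord S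
    rwa [show o.shift x.coord = x from site_ext fun i => by simp [o, Site.shift]] at this
  -- The flux of `m` through a coordinate torus is an integer; the exact part drops out and the
  -- constant part contributes once per each of the `N²` plaquettes.
  have hflux : ∀ i j : Fin 4, i < j → ∃ k : ℤ, (k : ℝ) = (N : ℝ) ^ 2 * val h o {i, j} := by
    intro i j hij
    refine ⟨∑ a : ZMod N, ∑ b : ZMod N, val m (o.shift (Pi.single i a + Pi.single j b)) {i, j}, ?_⟩
    push_cast
    simp only [← val_toReal, hA, val_add, Finset.sum_add_distrib, sum_plane_extDeriv A o hij]
    simp only [hconst]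
    simp [ZMod.card]
    ring
  have hcup : ((total (cup m m) : ℤ) : ℝ) = total (cup h h) := by
    have h1 : ((total (cup m m) : ℤ) : ℝ) = total (cup (toReal m) (toReal m)) := by
      simp only [total]
      push_cast
      refine Finset.sum_congr rfl fun x _ => ?_
      simp only [val_cup_univ, val_toReal]
      push_cast
      rfl
    -- The star of a closed form is coclosed, so exact forms do not contribute to the pairing.
    have h2 : ∀ (fr : Framing) (c : Form N half 2 ℝ), extDeriv c = 0 →
        dot (extDeriv A) (hodge fr 2 c) = 0 := fun fr c hc => by
      rw [dot_extDeriv_one, boundary_hodge_of_closed _ hc, dot_zero]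
    rw [h1, total_cup_eq_dot, total_cup_eq_dot]
    nth_rw 1 [hA]
    rw [add_dot, h2 _ _ hmR, zero_add, hA, hodge_add, dot_add, dot_hodge rfl, dot_comm, h2 _ _ hd,
      zero_add]
  obtain ⟨k01, h01⟩ := hflux 0 1 (by decide)
  obtain ⟨k02, h02⟩ := hflux 0 2 (by decide)
  obtain ⟨k03, h03⟩ := hflux 0 3 (by decide)
  obtain ⟨k12, h12⟩ := hflux 1 2 (by decide)
  obtain ⟨k13, h13⟩ := hflux 1 3 (by decide)
  obtain ⟨k23, h23⟩ := hflux 2 3 (by decide)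
  have hcard : Fintype.card (Site N half) = N ^ 4 := by
    rw [Fintype.card_congr (⟨Site.coord, Site.mk, fun _ => rfl, fun _ => rfl⟩ :
      Site N half ≃ (Fin 4 → ZMod N))]
    simp [ZMod.card]
  -- Each of the three complementary pairs of planes occurs twice, and the `N⁴` sites supply the two
  -- factors `N²` of the fluxes.
  have htot : total (cup h h) = ((2 * (k01 * k23 - k02 * k13 + k03 * k12) : ℤ) : ℝ) := by
    push_cast
    rw [h01, h02, h03, h12, h13, h23]
    simp only [total, val_cup_univ, hconst]
    rw [Finset.sum_const, Finset.card_univ, hcard]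
    simp only [nsmul_eq_mul]
    push_cast
    ring
  rw [htot] at hcup
  rw [Int.cast_injective hcup]
  exact even_two_mul _

end Harmonic

/-! ### Bilinearity of `∪₁` -/

section CupOne

variable {N : ℕ} {half : Bool} {R : Type} [CommRing R] {p q : ℕ}

theorem cupOne_add_left (a b : Form N half (p + 1) R) (c : Form N half (q + 1) R) :
    cupOne (a + b) c = cupOne a c + cupOne b c := by
  refine form_ext fun x S hS => ?_
  rw [val_add, val_cupOne _ _ _ hS, val_cupOne _ _ _ hS, val_cupOne _ _ _ hS]
  simp only [val_add, mul_add, add_mul, Finset.sum_add_distrib]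

theorem cupOne_smul_left (t : R) (a : Form N half (p + 1) R) (c : Form N half (q + 1) R) :
    cupOne (t • a) c = t • cupOne a c := by
  refine form_ext fun x S hS => ?_
  rw [val_smul, val_cupOne _ _ _ hS, val_cupOne _ _ _ hS]
  simp only [val_smul, Finset.mul_sum]
  exact Finset.sum_congr rfl fun _ _ => Finset.sum_congr rfl fun _ _ => by ring

theorem cupOne_smul_right (t : R) (a : Form N half (p + 1) R) (c : Form N half (q + 1) R) :
    cupOne a (t • c) = t • cupOne a c := by
  refine form_ext fun x S hS => ?_
  rw [val_smul, val_cupOne _ _ _ hS, val_cupOne _ _ _ hS]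
  simp only [val_smul, Finset.mul_sum]
  exact Finset.sum_congr rfl fun _ _ => Finset.sum_congr rfl fun _ _ => by ring

theorem cupOne_zero_left (c : Form N half (q + 1) R) :
    cupOne (0 : Form N half (p + 1) R) c = 0 := by
  have := cupOne_smul_left (0 : R) (0 : Form N half (p + 1) R) c
  rwa [zero_smul, zero_smul] at this

end CupOne

/-! ### The duality operator `K` and the lattice self-dual complex -/

section Operator

variable {N : ℕ} [NeZero N] {half : Bool}

/-- The defect of the symmetry of the pairing, for a closed form. -/
theorem dot_hodge_sub_dot_hodge_flip {R : Type} [CommRing R] (fr : Framing) {f : Form N half 2 R}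
    (hf : extDeriv f = 0) (l : Form N half 2 R) :
    dot f (hodge fr 2 l) - dot f (hodge fr.flip 2 l) =
      (fr.sign : R) * total (cupOne f (extDeriv l)) := by
  have h := total_cup_sub_total_cup f l
  have h0 : total (cupOne (extDeriv f) l) = 0 := by
    rw [hf, cupOne_zero_left]
    simp [total, val]
  rw [h0, add_zero, total_cup_eq_dot, total_cup_eq_dot_dual] at h
  cases fr
  · simpa [Framing.flip, Framing.sign] using h
  · simp only [Framing.flip, Framing.sign]
    push_cast
    linear_combination -h

theorem dot_hodge_flip_of_closed (fr : Framing) {f l : Form N half 2 ℝ}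
    (hf : extDeriv f = 0) (hl : extDeriv l = 0) :
    dot f (hodge fr 2 l) = dot f (hodge fr.flip 2 l) := by
  have h := dot_hodge_sub_dot_hodge_flip fr hf l
  have h0 := cupOne_smul_right (0 : ℝ) f (0 : Form N half 3 ℝ)
  rw [zero_smul, zero_smul] at h0
  rw [hl, h0] at h
  have h1 : total (0 : Form N half 4 ℝ) = 0 := by simp [total, val]
  rw [h1, mul_zero] at h
  linarith

theorem extDeriv_hodge_eq_zero_iff {N : ℕ} {R : Type} [CommRing R] (fr : Framing) (k : Form N half 2 R) :
    extDeriv (hodge fr 2 k) = 0 ↔ boundary k = 0 := by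
  constructor
  · intro h
    have := boundary_hodge_of_closed fr.flip h
    rwa [hodge_flip_hodge rfl] at this
  · intro h
    have h1 := boundary_hodge fr.flip (hodge fr 2 k)
    rw [hodge_flip_hodge rfl, h] at h1
    have h2 : ((fr.flip.sign : ℤ) : R) * fr.flip.sign = 1 := by
      rw [← Int.cast_mul, Framing.sign_mul_self, Int.cast_one]
    have h3 : hodge fr.flip 1 (extDeriv (hodge fr 2 k)) = 0 := by
      rw [← one_smul R (hodge _ _ _), ← h2, mul_smul, ← h1, smul_zero]
    rw [← hodge_hodge_flip (p := 1) (q := 3) rfl fr (extDeriv _), h3]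
    exact (hodgeLin N half R fr 3 1).map_zero

theorem projBoundary_add (x y : Form N half 2 ℝ) :
    projBoundary (x + y) = projBoundary x + projBoundary y := by
  simp [projBoundary]

theorem projBoundary_smul (t : ℝ) (x : Form N half 2 ℝ) :
    projBoundary (t • x) = t • projBoundary x := by
  simp [projBoundary]

theorem dot_projBoundary_of_closed (x : Form N half 2 ℝ) {s : Form N half 2 ℝ}
    (hs : extDeriv s = 0) : dot (projBoundary x) s = 0 := by
  obtain ⟨y, hy⟩ := exists_projBoundary_eq x
  rw [hy, dot_boundary_three, hs, dot_zero, neg_zero]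

/-- The difference of two candidates lies in `Im ∂` and is closed, hence is orthogonal to itself. -/
theorem projBoundary_eq_of_boundary {x v : Form N half 2 ℝ} {y : Form N half 3 ℝ}
    (hv : v = boundary y) (h : extDeriv (x - v) = 0) : projBoundary x = v := by
  obtain ⟨y', hy'⟩ := exists_projBoundary_eq x
  rw [← sub_eq_zero]
  refine eq_zero_of_dot_self ?_
  have h1 : projBoundary x - v = boundary (y' - y) := by
    rw [hy', hv]
    exact ((boundaryLin N half 2 ℝ).map_sub y' y).symm
  have h2 : projBoundary x - v = (x - v) - (x - projBoundary x) := by abel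
  nth_rw 1 [h1]
  rw [dot_boundary_three, h2, extDeriv_sub, h, extDeriv_sub_projBoundary, sub_zero, dot_zero,
    neg_zero]

theorem projBoundary_of_closed {x : Form N half 2 ℝ} (h : extDeriv x = 0) :
    projBoundary x = 0 := by
  have h0 : (0 : Form N half 2 ℝ) = boundary 0 := ((boundaryLin N half 2 ℝ).map_zero).symm
  exact projBoundary_eq_of_boundary h0 (by rwa [sub_zero])

theorem projBoundary_boundary (y : Form N half 3 ℝ) : projBoundary (boundary y) = boundary y :=
  projBoundary_eq_of_boundary rfl (by
    rw [sub_self]; exact (extDerivLin N half 2 ℝ).map_zero)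

theorem exists_hodge_projBoundary_eq (fr : Framing) (x : Form N half 2 ℝ) :
    ∃ A : Form N half 1 ℝ, hodge fr 2 (projBoundary x) = extDeriv A := by
  obtain ⟨y, hy⟩ := exists_projBoundary_eq x
  exact ⟨(-fr.sign : ℝ) • hodge fr 1 y, by rw [hy, hodge_boundary, extDeriv_smul]⟩

/-- The lattice duality operator: it is the Hodge star of the framing on the image of the boundary
operator, and the Hodge star of the other framing on the orthogonal complement. -/
noncomputable def dualOp (fr : Framing) : Form N half 2 ℝ →ₗ[ℝ] Form N half 2 ℝ where
  toFun x := hodge fr 2 (projBoundary x) + hodge fr.flip 2 (x - projBoundary x)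
  map_add' x y := by
    rw [projBoundary_add, hodge_add, add_sub_add_comm, hodge_add]
    abel
  map_smul' t x := by
    rw [projBoundary_smul, hodge_smul, ← smul_sub, hodge_smul, RingHom.id_apply, smul_add]

theorem dualOp_apply (fr : Framing) (x : Form N half 2 ℝ) :
    dualOp fr x = hodge fr 2 (projBoundary x) + hodge fr.flip 2 (x - projBoundary x) := rfl

/-- The block between `Im ∂` and itself vanishes: the star makes `∂y` exact, hence closed, hence
orthogonal to `Im ∂`. -/
theorem dot_dualOp (fr : Framing) (x y : Form N half 2 ℝ) :
    dot x (dualOp fr y) = dot (x - projBoundary x) (hodge fr 2 (projBoundary y)) +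
      dot (projBoundary x) (hodge fr.flip 2 (y - projBoundary y)) +
      dot (x - projBoundary x) (hodge fr.flip 2 (y - projBoundary y)) := by
  obtain ⟨A, hA⟩ := exists_hodge_projBoundary_eq fr y
  have h0 : dot (projBoundary x) (hodge fr 2 (projBoundary y)) = 0 :=
    dot_projBoundary_of_closed x (by rw [hA, extDeriv_extDeriv])
  have h1 : ∀ z, dot x z = dot (projBoundary x) z + dot (x - projBoundary x) z := fun z => by
    rw [← add_dot, add_sub_cancel]
  rw [dualOp_apply, dot_add, h1, h1 (hodge fr.flip 2 _), h0]
  ring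

/-- The two mixed blocks are transposes of each other because the framings are opposite; on the
closed block both stars define the same pairing, which is therefore symmetric. -/
theorem dot_dualOp_comm (fr : Framing) (x y : Form N half 2 ℝ) :
    dot x (dualOp fr y) = dot (dualOp fr x) y := by
  rw [dot_comm (dualOp fr x), dot_dualOp, dot_dualOp,
    dot_hodge_flip_of_closed fr.flip (extDeriv_sub_projBoundary x) (extDeriv_sub_projBoundary y),
    Framing.flip_flip, dot_hodge rfl fr (x - projBoundary x), dot_hodge rfl fr (x - projBoundary x),
    dot_hodge rfl fr.flip (projBoundary x), Framing.flip_flip,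
    dot_comm (projBoundary y), dot_comm (y - projBoundary y), dot_comm (y - projBoundary y)]
  ring

/-- Both stars are isometries, and they send the two summands to exact and to coclosed forms, which
are orthogonal. -/
theorem dot_dualOp_dualOp (fr : Framing) (x y : Form N half 2 ℝ) :
    dot (dualOp fr x) (dualOp fr y) = dot x y := by
  have h : ∀ a b : Form N half 2 ℝ,
      dot (hodge fr 2 (projBoundary a)) (hodge fr.flip 2 (b - projBoundary b)) = 0 := by
    intro a b
    obtain ⟨A, hA⟩ := exists_hodge_projBoundary_eq fr a
    rw [hA, dot_extDeriv_one, boundary_hodge_of_closed _ (extDeriv_sub_projBoundary b), dot_zero]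
  have h1 : ∀ a b : Form N half 2 ℝ, dot a b = dot (projBoundary a) (projBoundary b) +
      dot (a - projBoundary a) (b - projBoundary b) := fun a b => by
    have e1 := dot_projBoundary_of_closed a (extDeriv_sub_projBoundary b)
    have e2 := dot_projBoundary_of_closed b (extDeriv_sub_projBoundary a)
    simp only [dot_sub, sub_dot] at e1 e2 ⊢
    rw [dot_comm (projBoundary b), dot_comm (projBoundary b)] at e2
    linarith
  rw [dualOp_apply, dualOp_apply, add_dot, dot_add, dot_add, h, dot_comm (hodge fr.flip 2 _), h,
    dot_hodge_hodge rfl, dot_hodge_hodge rfl, h1 x y]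
  ring

theorem dualOp_dualOp (fr : Framing) (x : Form N half 2 ℝ) : dualOp fr (dualOp fr x) = x := by
  rw [← sub_eq_zero]
  refine eq_zero_of_dot_eq_zero fun y => ?_
  rw [sub_dot, ← dot_dualOp_comm, dot_dualOp_dualOp, sub_self]

theorem dualOp_of_closed (fr : Framing) {x : Form N half 2 ℝ} (h : extDeriv x = 0) :
    dualOp fr x = hodge fr.flip 2 x := by
  have h0 : hodge fr 2 (0 : Form N half 2 ℝ) = 0 := (hodgeLin N half ℝ fr 2 2).map_zero
  rw [dualOp_apply, projBoundary_of_closed h, sub_zero, h0, zero_add]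

theorem dualOp_boundary (fr : Framing) (y : Form N half 3 ℝ) :
    dualOp fr (boundary y) = hodge fr 2 (boundary y) := by
  rw [dualOp_apply, projBoundary_boundary, sub_self]
  have : hodge fr.flip 2 (0 : Form N half 2 ℝ) = 0 := (hodgeLin N half ℝ fr.flip 2 2).map_zero
  rw [this, add_zero]

/-- The difference of the two stars is closed, and closed forms cannot distinguish the two stars of
a closed form; so it is orthogonal to itself. -/
theorem hodge_eq_hodge_flip_of_harmonic (fr : Framing) {h : Form N half 2 ℝ}
    (hd : extDeriv h = 0) (hb : boundary h = 0) : hodge fr 2 h = hodge fr.flip 2 h := by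
  rw [← sub_eq_zero]
  refine eq_zero_of_dot_self ?_
  have hz : extDeriv (hodge fr 2 h - hodge fr.flip 2 h) = 0 := by
    rw [extDeriv_sub, (extDeriv_hodge_eq_zero_iff fr h).2 hb,
      (extDeriv_hodge_eq_zero_iff fr.flip h).2 hb, sub_zero]
  rw [dot_sub, dot_hodge_flip_of_closed fr hz hd, sub_self]

/-- The component orthogonal to `Im ∂` is harmonic, where the stars agree. Thus `K` is integral on
coclosed integer forms although the projection is not. -/
theorem dualOp_of_coclosed (fr : Framing) {k : Form N half 2 ℝ} (hk : boundary k = 0) :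
    dualOp fr k = hodge fr 2 k := by
  obtain ⟨y, hy⟩ := exists_projBoundary_eq k
  have hb : boundary (k - projBoundary k) = 0 := by
    rw [hy]
    have := (boundaryLin N half 1 ℝ).map_sub k (boundary y)
    refine this.trans ?_
    change boundary k - boundary (boundary y) = 0
    rw [hk, boundary_boundary, sub_zero]
  rw [dualOp_apply, ← hodge_eq_hodge_flip_of_harmonic fr (extDeriv_sub_projBoundary k) hb,
    ← hodge_add, add_sub_cancel]

/-- The bijection of links and dual plaquettes. -/
def linkEquiv (N : ℕ) (half : Bool) (fr : Framing) : Cell N half 1 ≃ Cell N half 3 where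
  toFun c := (c.1.shift (fr.offset N c.2.1),
    ⟨c.2.1ᶜ, card_compl_of_add_eq (by rfl : 1 + 3 = 4) c.2.2⟩)
  invFun c := (c.1.shift (fr.flip.offset N c.2.1),
    ⟨c.2.1ᶜ, card_compl_of_add_eq (by rfl : 3 + 1 = 4) c.2.2⟩)
  left_inv c := by
    obtain ⟨x, S, hS⟩ := c
    simp only [Site.shift_shift, fr.offset_flip_compl, add_neg_cancel, Site.shift_zero, compl_compl]
  right_inv c := by
    obtain ⟨x, S, hS⟩ := c
    have h := fr.flip.offset_flip_compl N S
    rw [Framing.flip_flip] at h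
    simp only [Site.shift_shift, h, add_neg_cancel, Site.shift_zero, compl_compl]

theorem boundary_toReal {N : ℕ} {r : ℕ} (k : Form N half (r + 1) ℤ) :
    boundary (toReal k) = toReal (boundary k) := by
  ext c
  simp [toReal, boundary, val_toReal]

theorem toReal_zero {N : ℕ} {r : ℕ} : toReal (0 : Form N half r ℤ) = 0 := by
  ext c
  simp [toReal]

/-- The complex of lattice forms around degree two with the duality operator. -/
noncomputable def latticeComplex (N : ℕ) [NeZero N] (half : Bool) (fr : Framing) :
    SelfDualComplex (Cell N half 1) (Cell N half 2) (Cell N half 3) where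
  d := extDerivLin N half 1 ℝ
  b := boundaryLin N half 2 ℝ
  dT := boundary
  -- The sign is that of the transpose of `∂` on 3-forms.
  bT n := -extDeriv n
  d_dot A k := by
    refine (dot_extDeriv_one A (toReal k)).trans ?_
    rw [boundary_toReal]
    rfl
  b_dot y n := by
    refine (dot_boundary_three (toReal n) y).trans ?_
    rw [← toReal_extDeriv]
    simp [dot, toReal, Finset.sum_neg_distrib]
  d_dot_b := dot_extDeriv_boundary
  K := LinearMap.toMatrix' (dualOp fr)
  isHermitian := by
    ext i j
    have h := dot_dualOp_comm fr (Pi.single i 1) (Pi.single j (1 : ℝ))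
    simp only [dot, Pi.single_apply, ite_mul, one_mul, zero_mul, mul_ite, mul_one, mul_zero,
      Finset.sum_ite_eq', Finset.mem_univ, if_true] at h
    simpa [LinearMap.toMatrix'_apply, Pi.single_apply] using h.symm
  involution x := by
    rw [LinearMap.toMatrix'_mulVec, LinearMap.toMatrix'_mulVec, dualOp_dualOp]
  Kint := ⟨hodge fr 2, hodge fr.flip 2, hodge_flip_hodge rfl fr, hodge_hodge_flip rfl fr⟩
  mulVec_intCast k hk := by
    rw [LinearMap.toMatrix'_mulVec]
    refine (dualOp_of_coclosed fr (k := toReal k) ?_).trans (toReal_hodge fr k).symm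
    rw [boundary_toReal, hk, toReal_zero]
  dT_eq_zero_iff k := by
    rw [neg_eq_zero]
    exact (extDeriv_hodge_eq_zero_iff fr k).symm
  e := linkEquiv N half fr
  -- The star of a 3-form is a signed permutation of its components; the extra sign comes from
  -- moving the star past `∂`.
  s c := -fr.sign * fr.cellSign c.2.1
  s_eq c := by
    have h1 : fr.sign = 1 ∨ fr.sign = -1 := by cases fr <;> simp [Framing.sign]
    have h2 := mul_self_eq_one_iff.1 (fr.cellSign_mul_self c.2.1)
    rcases h1 with h1 | h1 <;> rcases h2 with h2 | h2 <;> simp [h1, h2]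
  mulVec_b y := by
    rw [LinearMap.toMatrix'_mulVec]
    refine (dualOp_boundary fr y).trans ?_
    rw [hodge_boundary, ← extDeriv_smul]
    refine congrArg extDeriv ?_
    ext c
    have hc : c.2.1ᶜ.card = 3 := card_compl_of_add_eq (by rfl : 1 + 3 = 4) c.2.2
    simp only [Pi.smul_apply, hodge, smul_eq_mul, val_of_card _ _ hc, ← mul_assoc]
    rfl

end Operator

/-! ### The framing correction as a bilinear form -/

section FramingForm

variable {N : ℕ} [NeZero N] {half : Bool} {R : Type} [CommRing R]

theorem total_add (a b : Form N half 4 R) : total (a + b) = total a + total b := by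
  simp only [total, val_add, Finset.sum_add_distrib]

theorem total_smul (t : R) (a : Form N half 4 R) : total (t • a) = t * total a := by
  simp only [total, val_smul, Finset.mul_sum]

/-- The sum over the lattice of the higher cup product of a `2`-form and a `3`-form, with the sign
of the framing. -/
def framingForm (fr : Framing) (a : Form N half 2 R) (b : Form N half 3 R) : R :=
  fr.sign * total (cupOne a b)

theorem framingForm_add_left (fr : Framing) (a b : Form N half 2 R) (c : Form N half 3 R) :
    framingForm fr (a + b) c = framingForm fr a c + framingForm fr b c := by
  have h := total_add (cupOne a c) (cupOne b c)
  simp only [framingForm, cupOne_add_left]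
  rw [← mul_add]
  exact congrArg _ h

theorem framingForm_smul_left (fr : Framing) (t : R) (a : Form N half 2 R) (c : Form N half 3 R) :
    framingForm fr (t • a) c = t * framingForm fr a c := by
  have h := total_smul t (cupOne a c)
  simp only [framingForm, cupOne_smul_left]
  rw [mul_left_comm]
  exact congrArg _ h

theorem framingForm_smul_right (fr : Framing) (t : R) (a : Form N half 2 R) (c : Form N half 3 R) :
    framingForm fr a (t • c) = t * framingForm fr a c := by
  have h := total_smul t (cupOne a c)
  simp only [framingForm, cupOne_smul_right]
  rw [mul_left_comm]
  exact congrArg _ h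

theorem framingForm_sub_left (fr : Framing) (a b : Form N half 2 R) (c : Form N half 3 R) :
    framingForm fr (a - b) c = framingForm fr a c - framingForm fr b c := by
  have h := framingForm_add_left fr (a - b) b c
  rw [sub_add_cancel] at h
  rw [h, add_sub_cancel_right]

theorem dot_hodge_comm_of_closed (fr : Framing) {f : Form N half 2 R} (hf : extDeriv f = 0)
    (l : Form N half 2 R) :
    dot f (hodge fr 2 l) - dot l (hodge fr 2 f) = framingForm fr f (extDeriv l) := by
  rw [framingForm, ← dot_hodge_sub_dot_hodge_flip fr hf l, dot_hodge rfl fr l, dot_comm (hodge _ _ _)]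

end FramingForm

/-! ### Replacing the star by `K` -/

section Algebra

variable {N : ℕ} [NeZero N] {half : Bool}

theorem dot_hodge_projBoundary (fr : Framing) (x y : Form N half 2 ℝ) :
    dot (projBoundary x) (hodge fr 2 (projBoundary y)) = 0 := by
  obtain ⟨A, hA⟩ := exists_hodge_projBoundary_eq fr y
  exact dot_projBoundary_of_closed x (by rw [hA, extDeriv_extDeriv])

theorem extDeriv_projBoundary (l : Form N half 2 ℝ) :
    extDeriv (projBoundary l) = extDeriv l := by
  have h := extDeriv_sub_projBoundary l
  rw [extDeriv_sub, sub_eq_zero] at h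
  exact h.symm

/-- The topological charge with the framing correction of a form `F` whose exterior derivative is
that of `c l`. -/
theorem dot_hodge_self_add_framingForm (fr : Framing) (c : ℝ) {F l : Form N half 2 ℝ}
    (h : extDeriv (F - c • l) = 0) :
    dot F (hodge fr 2 F) + c * framingForm fr F (extDeriv l) =
      dot F (dualOp fr F) + c ^ 2 * framingForm fr (projBoundary l) (extDeriv l) := by
  set v := projBoundary l with hv
  -- Only `d l` matters, so `l` is replaced by its projection `v`. Then `F` is closed up to `c v`,
  -- and `K` is a single star on each of `f` and `v`.
  set f := F - c • v with hfdef
  have hdv : extDeriv v = extDeriv l := extDeriv_projBoundary l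
  have hf : extDeriv f = 0 := by
    rw [hfdef, extDeriv_sub, extDeriv_smul, hdv, ← extDeriv_smul, ← extDeriv_sub, h]
  have hF : F = f + c • v := by rw [hfdef, sub_add_cancel]
  obtain ⟨y, hy⟩ := exists_projBoundary_eq l
  have hKv : dualOp fr v = hodge fr 2 v := by rw [hv, hy, dualOp_boundary]
  have hvv : dot v (hodge fr 2 v) = 0 := dot_hodge_projBoundary fr l l
  have hKf : dualOp fr f = hodge fr.flip 2 f := dualOp_of_closed fr hf
  have hff := dot_hodge_flip_of_closed fr hf hf
  have h1 : dot v (hodge fr.flip 2 f) = dot f (hodge fr 2 v) := by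
    rw [dot_hodge rfl, Framing.flip_flip, dot_comm]
  have h2 := dot_hodge_comm_of_closed fr hf v
  rw [hF, map_add, map_smul, hKv, hKf, hodge_add, hodge_smul, framingForm_add_left,
    framingForm_smul_left, ← hdv]
  simp only [dot_add, add_dot, dot_smul, smul_dot, hvv, h1]
  linear_combination hff - c * h2

theorem dot_projBoundary_hodge_sub (fr : Framing) (l : Form N half 2 ℝ) :
    dot (projBoundary l) (hodge fr 2 (l - projBoundary l)) -
      dot (projBoundary l) (hodge fr.flip 2 (l - projBoundary l)) =
      framingForm fr (projBoundary l) (extDeriv l) - framingForm fr l (extDeriv l) := by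
  have h := dot_hodge_comm_of_closed fr (extDeriv_sub_projBoundary l) (projBoundary l)
  rw [extDeriv_projBoundary, framingForm_sub_left] at h
  rw [dot_hodge rfl fr.flip, Framing.flip_flip, dot_comm (hodge _ _ _)]
  linarith

/-- Star and `K` differ only on the closed part of `l`. The closed part of `F` does not see this
difference, so only the multiple `c` of the projected `l` contributes. -/
theorem dot_hodge_sub_dot_dualOp (fr : Framing) (c : ℝ) {F l : Form N half 2 ℝ}
    (h : extDeriv (F - c • l) = 0) :
    dot F (hodge fr 2 l) - dot F (dualOp fr l) =
      c * (framingForm fr (projBoundary l) (extDeriv l) - framingForm fr l (extDeriv l)) := by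
  have hs := extDeriv_sub_projBoundary l
  have hf : extDeriv (F - c • projBoundary l) = 0 := by
    rw [extDeriv_sub, extDeriv_smul, extDeriv_projBoundary, ← extDeriv_smul, ← extDeriv_sub, h]
  have h1 := dot_hodge_flip_of_closed fr hf hs
  have h2 := dot_projBoundary_hodge_sub fr l
  have h3 : hodge fr 2 l = hodge fr 2 (projBoundary l) + hodge fr 2 (l - projBoundary l) := by
    rw [← hodge_add, add_sub_cancel]
  rw [h3, dualOp_apply, dot_add, dot_add]
  simp only [sub_dot, smul_dot] at h1
  linear_combination h1 + c * h2

theorem dot_dualOp_self (fr : Framing) (l : Form N half 2 ℝ) :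
    dot l (dualOp fr l) = dot l (hodge fr 2 l) + framingForm fr l (extDeriv l) -
      framingForm fr (projBoundary l) (extDeriv l) := by
  have h := dot_hodge_sub_dot_dualOp fr 1 (F := l) (l := l) (by
    rw [one_smul, sub_self]; exact (extDerivLin N half 2 ℝ).map_zero)
  linarith

end Algebra

/-! ### Integrality and the Pontryagin square modulo two -/

section Integrality

variable {N : ℕ} [NeZero N] {half : Bool}

theorem dot_toReal {r : ℕ} (a b : Form N half r ℤ) :
    dot (toReal a) (toReal b) = ((dot a b : ℤ) : ℝ) := by
  simp [dot, toReal]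

theorem total_cupOne_toReal (a : Form N half 2 ℤ) (b : Form N half 3 ℤ) :
    total (cupOne (toReal a) (toReal b)) = ((total (cupOne a b) : ℤ) : ℝ) := by
  have h : ∀ x : Site N half, val (cupOne (toReal a) (toReal b)) x Finset.univ =
      ((val (cupOne a b) x Finset.univ : ℤ) : ℝ) := fun x => by
    rw [val_cupOne _ _ _ (by rfl), val_cupOne _ _ _ (by rfl)]
    simp only [val_toReal]
    push_cast
    congr 1
    norm_num
  simp only [total]
  push_cast
  exact Finset.sum_congr rfl fun x _ => h x

theorem framingForm_toReal (fr : Framing) (a : Form N half 2 ℤ) (b : Form N half 3 ℤ) :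
    framingForm fr (toReal a) (toReal b) = ((framingForm fr a b : ℤ) : ℝ) := by
  simp only [framingForm]
  rw [total_cupOne_toReal]
  push_cast
  rfl

theorem pontryagin_eq (n : Form N half 2 ℤ) :
    pontryagin n = dot n (hodge .plain 2 n) + framingForm .plain n (extDeriv n) := by
  rw [pontryagin, total_cup_eq_dot, framingForm]
  simp [Framing.sign]

/-- The Pontryagin square modulo two depends only on the exterior derivative. -/
theorem even_pontryagin_sub {n l : Form N half 2 ℤ} {k : ℤ} (h : extDeriv (n - k • l) = 0) :
    Even (pontryagin n - k ^ 2 * pontryagin l) := by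
  set m := n - k • l with hm
  have hn : n = m + k • l := by rw [hm, sub_add_cancel]
  have hdn : extDeriv n = k • extDeriv l := by rw [hn, extDeriv_add, h, zero_add, extDeriv_smul]
  obtain ⟨j, hj⟩ := even_total_cup_self h
  rw [total_cup_eq_dot] at hj
  have h1 := dot_hodge_comm_of_closed .plain h l
  -- With `n = m + k l`, the `∪₁` term turns `l ∪ m` into a second copy of `m ∪ l`; what remains is
  -- `m ∪ m`, even on the torus.
  refine ⟨j + k * dot m (hodge .plain 2 l), ?_⟩
  rw [pontryagin_eq, pontryagin_eq, hdn, framingForm_smul_right, hn, hodge_add, hodge_smul,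
    framingForm_add_left, framingForm_smul_left]
  simp only [dot_add, add_dot, dot_smul, smul_dot]
  linear_combination hj - k * h1

end Integrality

/-! ### The loop integral as a constrained Gaussian sum -/

noncomputable section

variable {N : ℕ} [NeZero N] {half : Bool}

/-- The topological charge with the correction for the framing: `Q` or `Q̃`. -/
def framedCharge (fr : Framing) (A : Form N half 1 ℝ) (n : Form N half 2 ℤ) : ℝ :=
  charge₀ (fieldStrength A n) +
    1 / (4 * π) * framingForm fr (fieldStrength A n) (extDeriv (toReal n))

theorem fieldStrength_eq {N : ℕ} (A : Form N half 1 ℝ) (n : Form N half 2 ℤ) :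
    fieldStrength A n = extDeriv A + (2 * π) • toReal n := rfl

theorem dot_hodge_framing (fr : Framing) (F : Form N half 2 ℝ) :
    total (cup F F) = dot F (hodge fr 2 F) := by
  cases fr
  · exact total_cup_eq_dot F F
  · exact total_cup_eq_dot_dual F F

theorem extDeriv_toReal_sub {N : ℕ} {n l : Form N half 2 ℤ} {k : ℤ} (h : extDeriv (n - k • l) = 0) :
    extDeriv (toReal n) = (k : ℝ) • extDeriv (toReal l) := by
  rw [extDeriv_sub, extDeriv_smul, sub_eq_zero] at h
  rw [← toReal_extDeriv, h, ← toReal_extDeriv]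
  ext c
  simp [toReal]

theorem extDeriv_fieldStrength_sub {N : ℕ} (A : Form N half 1 ℝ) {n l : Form N half 2 ℤ} {k : ℤ}
    (h : extDeriv (n - k • l) = 0) :
    extDeriv (fieldStrength A n - (2 * π * k) • toReal l) = 0 := by
  rw [fieldStrength_eq, extDeriv_sub, extDeriv_add, extDeriv_smul, extDeriv_smul,
    extDeriv_extDeriv, extDeriv_toReal_sub h, zero_add, smul_smul, sub_self]

/-- The number `u` with the sign of the framing. -/
def framedNumber (fr : Framing) (l : Form N half 2 ℤ) : ℝ := fr.sign * uNumber l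

theorem framingForm_projBoundary (fr : Framing) (l : Form N half 2 ℤ) :
    framingForm fr (projBoundary (toReal l)) (extDeriv (toReal l)) = framedNumber fr l := by
  rw [framedNumber, uNumber, framingForm, extDeriv_projBoundary]

/-- Here the form whose derivative matches that of `F` is `2πk l`; the constant is `(2πk)²/8π² =
k²/2`. -/
theorem framedCharge_eq (fr : Framing) (A : Form N half 1 ℝ) {n l : Form N half 2 ℤ} {k : ℤ}
    (h : extDeriv (n - k • l) = 0) :
    framedCharge fr A n =
      1 / (8 * π ^ 2) * dot (fieldStrength A n) (dualOp fr (fieldStrength A n)) +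
        k ^ 2 / 2 * framedNumber fr l := by
  have h1 := dot_hodge_self_add_framingForm fr _ (extDeriv_fieldStrength_sub A h)
  rw [framedCharge, charge₀, dot_hodge_framing fr, extDeriv_toReal_sub h, framingForm_smul_right,
    ← framingForm_projBoundary]
  have hpi := Real.pi_ne_zero
  field_simp
  linear_combination 8 * h1

/-- Summation by parts: the tangent is, up to sign, the boundary of the star of `l`. -/
theorem dot_toReal_tangent (fr : Framing) {g : Form N half 1 ℤ} {l : Form N half 2 ℤ}
    (hg : g = (-fr.sign) • hodge fr 1 (extDeriv l)) (A : Form N half 1 ℝ) :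
    dot (toReal g) A = -dot (extDeriv A) (hodge fr 2 (toReal l)) := by
  have h : toReal g = (-fr.sign : ℝ) • hodge fr 1 (extDeriv (toReal l)) := by
    rw [← toReal_extDeriv, ← toReal_hodge, hg]
    ext c
    simp [toReal]
  rw [h, dot_extDeriv_one, boundary_hodge, smul_dot, dot_smul, dot_comm A]
  ring

theorem neg_one_zpow_eq_exp (z : ℤ) : (-1 : ℂ) ^ z = Complex.exp (-Complex.I * (π * z : ℝ)) := by
  rw [← Complex.exp_neg_pi_mul_I, ← Complex.exp_int_mul]
  congr 1
  push_cast
  ring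

/-- The factor that relates the loop integral to the sum over the forms with prescribed exterior
derivative. -/
def loopFactor (fr : Framing) (l : Form N half 2 ℤ) (p qe qm : ℤ) (θ : ℝ) : ℂ :=
  Complex.exp (-Complex.I *
    (θ * qm ^ 2 / 2 * framedNumber fr l + 2 * π * (qe * qm) * framedNumber fr l : ℝ)) *
  (-1 : ℂ) ^ (p * (qm ^ 2 * pontryagin l))

/-- The part of the integrand of the dyonic loop that does not involve the magnetic field. -/
def electricWeight (fr : Framing) (g : Form N half 1 ℤ) (p qe : ℤ) (β θ : ℝ) (A : Form N half 1 ℝ)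
    (n : Form N half 2 ℤ) : ℂ :=
  Complex.exp (-(β / 2 * dot (fieldStrength A n) (fieldStrength A n) : ℝ) +
    Complex.I * (qe * dot (toReal g) A - θ * framedCharge fr A n - p * π * pontryagin n : ℝ))

theorem exists_framing_integer (fr : Framing) (n l : Form N half 2 ℤ) (qm : ℤ) :
    ∃ j : ℤ, (j : ℝ) = qm * framingForm fr (toReal l) (extDeriv (toReal l)) +
      dot (toReal n) (hodge fr 2 (toReal l)) := by
  refine ⟨qm * framingForm fr l (extDeriv l) + dot n (hodge fr 2 l), ?_⟩
  rw [← toReal_extDeriv, ← toReal_hodge, framingForm_toReal, dot_toReal]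
  push_cast
  rfl

/-- Changing the source from the star of `l` to `K l` costs the phase `2π qe qm u`, and the charge
costs `θ qm² u/2`. The rest is `2π` times integers: pairings of `n` and `l`, and half of an even
difference of Pontryagin squares. -/
theorem electricWeight_eq (fr : Framing) {g : Form N half 1 ℤ} {n l : Form N half 2 ℤ} {qm : ℤ}
    (hg : g = (-fr.sign) • hodge fr 1 (extDeriv l)) (h : extDeriv (n - qm • l) = 0)
    (p qe : ℤ) (β θ : ℝ) (A : Form N half 1 ℝ) :
    electricWeight fr g p qe β θ A n = loopFactor fr l p qe qm θ *
      (latticeComplex N half fr).weight β (θ / (4 * π ^ 2))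
        ((qe : ℝ) • (latticeComplex N half fr).K.mulVec fun i => (l i : ℝ))
        ((latticeComplex N half fr).d A + (2 * π) • fun i => (n i : ℝ)) := by
  set F := fieldStrength A n with hF
  have hK : ∀ x, (latticeComplex N half fr).K.mulVec x = dualOp fr x := fun x =>
    LinearMap.toMatrix'_mulVec _ _
  have hFd : (latticeComplex N half fr).d A + (2 * π) • (fun i => (n i : ℝ)) = F := rfl
  have hL : (fun i => (l i : ℝ)) = toReal l := rfl
  rw [hFd, hL, hK, SelfDualComplex.weight, hK, loopFactor, electricWeight, neg_one_zpow_eq_exp,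
    ← Complex.exp_add, ← Complex.exp_add, Complex.exp_eq_exp_iff_exists_int]
  obtain ⟨i, hi⟩ := exists_framing_integer fr n l qm
  obtain ⟨j, hj⟩ := even_pontryagin_sub h
  have hj' : ((pontryagin n : ℤ) : ℝ) = qm ^ 2 * (pontryagin l : ℤ) + (j + j) := by
    have := congrArg (Int.cast (R := ℝ)) hj
    push_cast at this
    linarith
  have h1 := dot_hodge_sub_dot_dualOp fr _ (extDeriv_fieldStrength_sub A h)
  rw [framingForm_projBoundary] at h1
  have h2 : dot F (hodge fr 2 (toReal l)) = dot (extDeriv A) (hodge fr 2 (toReal l)) +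
      2 * π * dot (toReal n) (hodge fr 2 (toReal l)) := by
    rw [hF, fieldStrength_eq, add_dot, smul_dot]
  have h3 : F ⬝ᵥ F = dot F F := rfl
  have h4 : F ⬝ᵥ dualOp fr F = dot F (dualOp fr F) := rfl
  have h5 : ((qe : ℝ) • dualOp fr (toReal l)) ⬝ᵥ F = qe * dot F (dualOp fr (toReal l)) := by
    rw [smul_dotProduct, dotProduct_comm]; rfl
  refine ⟨qe * i - p * j, ?_⟩
  rw [h3, h4, h5, framedCharge_eq fr A h, dot_toReal_tangent fr hg, hj']
  have key : qe * -dot (extDeriv A) (hodge fr 2 (toReal l)) -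
      θ * (1 / (8 * π ^ 2) * dot F (dualOp fr F) + qm ^ 2 / 2 * framedNumber fr l) -
      p * π * (qm ^ 2 * (pontryagin l : ℤ) + (j + j)) =
      -(θ * qm ^ 2 / 2 * framedNumber fr l + 2 * π * (qe * qm) * framedNumber fr l) -
      π * ((p * (qm ^ 2 * pontryagin l) : ℤ) : ℝ) -
      θ / (4 * π ^ 2) / 2 * dot F (dualOp fr F) - qe * dot F (dualOp fr (toReal l)) +
      ((qe * i - p * j : ℤ) : ℝ) * (2 * π) := by
    have hpi : θ / (4 * π ^ 2) / 2 = θ * (1 / (8 * π ^ 2)) := by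
      have := Real.pi_ne_zero
      field_simp
      ring
    rw [hpi]
    push_cast
    linear_combination -qe * h1 + qe * h2 - 2 * π * qe * hi
  rw [key]
  push_cast
  ring

theorem summable_electricWeight (fr : Framing) (g : Form N half 1 ℤ) (p qe : ℤ) {β : ℝ}
    (hβ : 0 < β) (θ : ℝ) (A : Form N half 1 ℝ) :
    Summable (electricWeight fr g p qe β θ A) := by
  refine Summable.of_norm_bounded ((latticeComplex N half fr).summable_weight hβ 0 0
    ((latticeComplex N half fr).d A) (t := 2 * π) (by positivity)).norm fun n => ?_
  rw [SelfDualComplex.norm_weight, electricWeight, Complex.norm_exp]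
  refine le_of_eq (congrArg _ ?_)
  have : dot (fieldStrength A n) (fieldStrength A n) =
      ∑ i, ((latticeComplex N half fr).d A + (2 * π) • fun i => (n i : ℝ)) i ^ 2 :=
    Finset.sum_congr rfl fun i _ => (sq _).symm
  rw [← this]
  simp

/-- The unnormalized expectation value of the dyonic loop. -/
def loopIntegral (fr : Framing) (g : Form N half 1 ℤ) (l : Form N half 2 ℤ) (p qe qm : ℤ)
    (β θ : ℝ) : ℂ :=
  compactIntegral fun Ae : Form N half 1 ℝ => compactIntegral fun Am : Form N half 3 ℝ =>
    ∑' n : Form N half 2 ℤ,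
      Complex.exp (-(β / 2 * dot (fieldStrength Ae n) (fieldStrength Ae n) : ℝ)
        - Complex.I * (θ * framedCharge fr Ae n : ℝ)
        + Complex.I * (1 / (2 * π) * dot (boundary Am) (fieldStrength Ae n) : ℝ)
        - Complex.I * (p * π * pontryagin n : ℝ)) *
      Complex.exp (Complex.I *
        (qe * dot (toReal g) Ae - qm * dot (boundary Am) (toReal l) : ℝ))

theorem dot_boundary_fieldStrength (A : Form N half 1 ℝ) (y : Form N half 3 ℝ)
    (n : Form N half 2 ℤ) :
    dot (boundary y) (fieldStrength A n) = 2 * π * dot (boundary y) (toReal n) := by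
  rw [fieldStrength_eq, dot_add, dot_smul, dot_comm, dot_extDeriv_boundary, zero_add]

open Classical in
theorem loopIntegral_eq (fr : Framing) {g : Form N half 1 ℤ} {l : Form N half 2 ℤ}
    (hg : g = (-fr.sign) • hodge fr 1 (extDeriv l)) (p qe qm : ℤ) {β : ℝ} (hβ : 0 < β) (θ : ℝ) :
    loopIntegral fr g l p qe qm β θ = loopFactor fr l p qe qm θ *
      (latticeComplex N half fr).theta β (θ / (4 * π ^ 2)) l qe qm := by
  rw [SelfDualComplex.theta, ← compactIntegral_const_mul, loopIntegral]
  refine congrArg _ (funext fun A => ?_)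
  rw [← tsum_mul_left]
  have h := (latticeComplex N half fr).compactIntegral_tsum_constraint
    (summable_electricWeight fr g p qe hβ θ A) (qm • l)
  refine Eq.trans (congrArg _ (funext fun y => tsum_congr fun n => ?_)) (h.trans (tsum_congr fun n => ?_))
  · have hb : (latticeComplex N half fr).b y ⬝ᵥ (fun i => ((n - qm • l) i : ℝ)) =
        dot (boundary y) (toReal n) - qm * dot (boundary y) (toReal l) := by
      rw [← dot_smul, ← dot_sub]
      simp [dot, dotProduct, toReal, latticeComplex, boundaryLin]
    rw [hb, electricWeight, ← Complex.exp_add, ← Complex.exp_add, dot_boundary_fieldStrength,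
      ← mul_assoc, one_div_mul_cancel (by positivity : (2 * π : ℝ) ≠ 0), one_mul]
    congr 1
    push_cast
    ring
  · by_cases hn : (latticeComplex N half fr).bT (n - qm • l) = 0
    · rw [if_pos hn, if_pos hn]
      exact electricWeight_eq fr hg (neg_eq_zero.1 hn) p qe β θ A
    · rw [if_neg hn, if_neg hn, mul_zero]

-- At zero charges neither the source nor the constraint involves `l`, so this sum can share the
-- proportionality constant of the loop sum.
open Classical in
theorem partition_eq (fr : Framing) (l : Form N half 2 ℤ) (β θ : ℝ) :
    partition N half β θ = (latticeComplex N half fr).theta β (θ / (4 * π ^ 2)) l 0 0 := by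
  rw [SelfDualComplex.theta, partition]
  refine congrArg _ (funext fun A => tsum_congr fun n => ?_)
  have hiff : (latticeComplex N half fr).bT (n - (0 : ℤ) • l) = 0 ↔ extDeriv n = 0 := by
    rw [zero_smul, sub_zero]
    exact neg_eq_zero
  by_cases hn : extDeriv n = 0
  · rw [if_pos hn, if_pos (hiff.2 hn)]
    have h := framedCharge_eq fr A (n := n) (l := l) (k := 0) (by rwa [zero_smul, sub_zero])
    have h0 : framingForm fr (fieldStrength A n) (extDeriv (toReal n)) = 0 := by
      have h1 : extDeriv (toReal n) = (0 : ℝ) • extDeriv (toReal n) := by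
        rw [zero_smul, ← toReal_extDeriv, hn, toReal_zero]
      rw [h1, framingForm_smul_right, zero_mul]
    rw [framedCharge, h0, mul_zero, add_zero] at h
    rw [SelfDualComplex.weight, h]
    have hK : ∀ x, (latticeComplex N half fr).K.mulVec x = dualOp fr x := fun x =>
      LinearMap.toMatrix'_mulVec _ _
    have hF : (latticeComplex N half fr).d A + (2 * π) • (fun i => (n i : ℝ)) =
      fieldStrength A n := rfl
    rw [hK, hF, hK]
    have h3 : fieldStrength A n ⬝ᵥ fieldStrength A n = dot (fieldStrength A n) (fieldStrength A n) :=
      rfl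
    have h4 : fieldStrength A n ⬝ᵥ dualOp fr (fieldStrength A n) =
      dot (fieldStrength A n) (dualOp fr (fieldStrength A n)) := rfl
    have hpi : θ / (4 * π ^ 2) / 2 = θ * (1 / (8 * π ^ 2)) := by
      have := Real.pi_ne_zero
      field_simp
      ring
    rw [h3, h4, hpi]
    congr 1
    push_cast
    simp
    ring
  · rw [if_neg hn, if_neg (mt hiff.1 hn)]

end

/-! ### The complex coupling -/

noncomputable section

section Coupling

theorem dual_denominator_pos {β : ℝ} (hβ : 0 < β) (θ : ℝ) :
    0 < (2 * π * β) ^ 2 + (θ / (2 * π)) ^ 2 := by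
  positivity

theorem dualBeta_pos {β : ℝ} (hβ : 0 < β) (θ : ℝ) : 0 < dualBeta β θ :=
  div_pos hβ (dual_denominator_pos hβ θ)

/-- Equivalently, the dual complex coupling is `-1/τ`. -/
theorem coupling_inv {β : ℝ} (hβ : 0 < β) (θ : ℝ) :
    (coupling β θ)⁻¹ =
      -((dualTheta β θ / (2 * π) : ℝ) : ℂ) - Complex.I * (2 * π * dualBeta β θ : ℝ) := by
  have hD := (dual_denominator_pos hβ θ).ne'
  refine inv_eq_of_mul_eq_one_right ?_
  have h1 : dualTheta β θ / (2 * π) =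
      -(θ / (2 * π)) * ((2 * π * β) ^ 2 + (θ / (2 * π)) ^ 2)⁻¹ := by
    rw [dualTheta]; ring
  have h2 : 2 * π * dualBeta β θ =
      2 * π * β * ((2 * π * β) ^ 2 + (θ / (2 * π)) ^ 2)⁻¹ := by
    rw [dualBeta]; ring
  rw [h1, h2, coupling]
  generalize θ / (2 * π) = s at *
  generalize 2 * π * β = t at *
  have h3 : ((t ^ 2 + s ^ 2 : ℝ) : ℂ) * ((t ^ 2 + s ^ 2)⁻¹ : ℝ) = 1 := by
    rw [← Complex.ofReal_mul, mul_inv_cancel₀ hD, Complex.ofReal_one]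
  generalize (t ^ 2 + s ^ 2)⁻¹ = w at *
  push_cast at h3 ⊢
  linear_combination h3 - (t : ℂ) ^ 2 * w * Complex.I_sq

/-- The exponent of the duality relation in terms of real couplings. -/
theorem duality_exponent {β : ℝ} (hβ : 0 < β) (θ u : ℝ) (qe qm : ℤ) :
    -Complex.I * u * π * complexCharge qe qm β θ ^ 2 / coupling β θ
      - 2 * π ^ 2 * u * (β * qm ^ 2 - dualBeta β θ * qe ^ 2) =
    -Complex.I * (θ * qm ^ 2 / 2 * u - dualTheta β θ * qe ^ 2 / 2 * u +
      2 * π * (qe * qm) * u : ℝ) := by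
  have hinv := coupling_inv hβ θ
  have h0 : coupling β θ ≠ 0 := by
    intro h
    have := congrArg Complex.im h
    rw [coupling, Complex.add_im, Complex.ofReal_im, Complex.I_mul_im, Complex.ofReal_re,
      zero_add, Complex.zero_im] at this
    exact (by positivity : 2 * π * β ≠ 0) this
  -- Expanding the square separates `1/τ` and `τ`; the contributions of their imaginary parts to the
  -- exponent are cancelled by the explicit `β` and `β̃` terms, leaving a pure phase.
  have hq : complexCharge qe qm β θ ^ 2 / coupling β θ =
      qe ^ 2 * (coupling β θ)⁻¹ + 2 * qe * qm + coupling β θ * qm ^ 2 := by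
    rw [complexCharge]
    field_simp
    ring
  have hpi : (π : ℂ) ≠ 0 := by exact_mod_cast Real.pi_ne_zero
  rw [mul_div_assoc, hq, hinv, coupling]
  push_cast
  field_simp
  ring_nf
  simp only [Complex.I_sq]
  ring

end Coupling

/-! ### Normalized duality and the two loop operators -/

section Duality

variable {N : ℕ} [NeZero N] {half : Bool}

theorem loopIntegral_duality (fr : Framing) {g : Form N half 1 ℤ} {l : Form N half 2 ℤ}
    (hg : g = (-fr.sign) • hodge fr 1 (extDeriv l)) (p qe qm : ℤ) {β : ℝ} (hβ : 0 < β) (θ : ℝ) :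
    1 / partition N half β θ * loopIntegral fr g l p qe qm β θ =
      Complex.exp (-Complex.I * (framedNumber fr l : ℝ) * π *
          complexCharge qe qm β θ ^ 2 / coupling β θ
        - 2 * π ^ 2 * (framedNumber fr l : ℝ) * (β * qm ^ 2 - dualBeta β θ * qe ^ 2)) *
      (-1 : ℂ) ^ (p * pontryagin l * (qm ^ 2 + qe ^ 2)) *
      (1 / partition N half (dualBeta β θ) (dualTheta β θ) *
        loopIntegral fr g l p qm (-qe) (dualBeta β θ) (dualTheta β θ)) := by
  classical
  obtain ⟨C, hC, h⟩ := (latticeComplex N half fr).exists_theta_duality hβ (θ / (4 * π ^ 2))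
  have hpi := Real.pi_ne_zero
  have hD := (dual_denominator_pos hβ θ).ne'
  have hden : (2 * π * β) ^ 2 + (θ / (2 * π)) ^ 2 =
      4 * π ^ 2 * (β ^ 2 + (θ / (4 * π ^ 2)) ^ 2) := by
    field_simp
    ring
  have h1 : β / (β ^ 2 + (θ / (4 * π ^ 2)) ^ 2) / (4 * π ^ 2) = dualBeta β θ := by
    rw [dualBeta, hden, div_div, mul_comm (4 * π ^ 2)]
  have h2 : -(θ / (4 * π ^ 2)) / (β ^ 2 + (θ / (4 * π ^ 2)) ^ 2) / (4 * π ^ 2) =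
      dualTheta β θ / (4 * π ^ 2) := by
    rw [dualTheta, hden, div_div, div_div, ← neg_div, div_div]
    congr 1
    ring
  rw [h1, h2] at h
  -- The same constant `C` relates the partition functions, and so disappears from the ratio.
  have hZ : (latticeComplex N half fr).theta β (θ / (4 * π ^ 2)) l 0 0 =
      C * (latticeComplex N half fr).theta (dualBeta β θ) (dualTheta β θ / (4 * π ^ 2)) l 0 0 := by
    simpa using h l 0 0
  have hL : (fun i => (l i : ℝ)) ⬝ᵥ (latticeComplex N half fr).K.mulVec (fun i => (l i : ℝ)) =
      dot (toReal l) (dualOp fr (toReal l)) := by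
    rw [show (latticeComplex N half fr).K.mulVec (fun i => (l i : ℝ)) = dualOp fr (toReal l) from
      LinearMap.toMatrix'_mulVec _ _]
    rfl
  -- This integer makes `l ⬝ K l = j - u`, with `u` taken in the sign of the framing.
  obtain ⟨j, hj⟩ := exists_framing_integer fr l l 1
  have hself := dot_dualOp_self fr (toReal l)
  rw [framingForm_projBoundary] at hself
  have hfac : loopFactor fr l p qe qm θ * Complex.exp (-Complex.I * (2 * π * (qe * qm) *
      dot (toReal l) (dualOp fr (toReal l)) : ℝ)) =
      Complex.exp (-Complex.I * (framedNumber fr l : ℝ) * π *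
          complexCharge qe qm β θ ^ 2 / coupling β θ
        - 2 * π ^ 2 * (framedNumber fr l : ℝ) * (β * qm ^ 2 - dualBeta β θ * qe ^ 2)) *
      (-1 : ℂ) ^ (p * pontryagin l * (qm ^ 2 + qe ^ 2)) *
        loopFactor fr l p qm (-qe) (dualTheta β θ) := by
    rw [duality_exponent hβ, loopFactor, loopFactor]
    simp only [neg_one_zpow_eq_exp, ← Complex.exp_add]
    rw [Complex.exp_eq_exp_iff_exists_int]
    -- The sign for `qe²` occurs twice on the right, and `j` enters through `l ⬝ K l`; both give
    -- whole turns.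
    refine ⟨p * pontryagin l * qe ^ 2 - qe * qm * j, ?_⟩
    have hs : dot (toReal l) (dualOp fr (toReal l)) = j - framedNumber fr l := by
      rw [hself, hj]
      push_cast
      ring
    rw [hs]
    push_cast
    ring
  rw [partition_eq fr l, partition_eq fr l, loopIntegral_eq fr hg p qe qm hβ,
    loopIntegral_eq fr hg p qm (-qe) (dualBeta_pos hβ θ), h l qe qm, hZ, hL]
  rw [one_div, one_div, mul_inv]
  linear_combination
    (C⁻¹ * C * ((latticeComplex N half fr).theta (dualBeta β θ) (dualTheta β θ / (4 * π ^ 2)) l 0 0)⁻¹ *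
      (latticeComplex N half fr).theta (dualBeta β θ) (dualTheta β θ / (4 * π ^ 2)) l qm (-qe)) * hfac +
    (Complex.exp (-Complex.I * (framedNumber fr l : ℝ) * π *
          complexCharge qe qm β θ ^ 2 / coupling β θ
        - 2 * π ^ 2 * (framedNumber fr l : ℝ) * (β * qm ^ 2 - dualBeta β θ * qe ^ 2)) *
      (-1 : ℂ) ^ (p * pontryagin l * (qm ^ 2 + qe ^ 2)) *
        loopFactor fr l p qm (-qe) (dualTheta β θ) *
      ((latticeComplex N half fr).theta (dualBeta β θ) (dualTheta β θ / (4 * π ^ 2)) l 0 0)⁻¹ *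
      (latticeComplex N half fr).theta (dualBeta β θ) (dualTheta β θ / (4 * π ^ 2)) l qm (-qe)) *
      inv_mul_cancel₀ hC

theorem evLoop_eq {γ : Contour N half} {l : Form N half 2 ℤ}
    (hg : γ.tangent = (-Framing.plain.sign) • hodge .plain 1 (extDeriv l)) (p qe qm : ℤ) (β θ : ℝ) :
    evLoop γ p qe qm β θ =
      1 / partition N half β θ * loopIntegral .plain γ.tangent l p qe qm β θ := by
  have h1 : ∀ (A : Form N half 1 ℝ) (n : Form N half 2 ℤ), charge A n = framedCharge .plain A n := by
    intro A n
    simp [charge, framedCharge, framingForm, Framing.sign]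
  -- The magnetic loop is a coupling of `A^m` to `l`: the star is an isometry, and `d` moves onto
  -- `A^m` as `∂`.
  have h2 : ∀ y : Form N half 3 ℝ, total (cup (toReal γ.tangent) y) =
      dot (boundary y) (toReal l) := by
    intro y
    refine (sum_val_cup (p := 1) (q := 3) rfl _ _).trans ?_
    have h3 : toReal γ.tangent = (-1 : ℝ) • hodge .plain 1 (extDeriv (toReal l)) := by
      rw [← toReal_extDeriv, ← toReal_hodge, hg]
      ext c
      simp [toReal, Framing.sign]
    rw [h3, smul_dot, dot_hodge_hodge rfl, dot_boundary_three, dot_comm y]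
    ring
  simp only [evLoop, loopIntegral, h1, h2]

theorem evDualLoop_eq {γ : Contour N half} {l : Form N half 2 ℤ}
    (hg : γ.tangent = (-Framing.dual.sign) • hodge .dual 1 (extDeriv l)) (p qe qm : ℤ) (β θ : ℝ) :
    evDualLoop γ p qe qm β θ =
      1 / partition N half β θ * loopIntegral .dual γ.tangent l p qe qm β θ := by
  have h1 : ∀ (A : Form N half 1 ℝ) (n : Form N half 2 ℤ),
      dualCharge A n = framedCharge .dual A n := by
    intro A n
    simp [dualCharge, framedCharge, framingForm, Framing.sign]
    ring
  have h2 : ∀ y : Form N half 3 ℝ, total (cup y (toReal γ.tangent)) =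
      -dot (boundary y) (toReal l) := by
    intro y
    refine (sum_val_cup (p := 3) (q := 1) rfl _ _).trans ?_
    have h3 : toReal γ.tangent = hodge .dual 1 (extDeriv (toReal l)) := by
      rw [← toReal_extDeriv, ← toReal_hodge, hg]
      ext c
      simp [toReal, Framing.sign]
    have h4 : hodge .plain 3 (hodge .dual 1 (extDeriv (toReal l))) = extDeriv (toReal l) :=
      hodge_flip_hodge (p := 1) (q := 3) rfl .dual _
    rw [h3, h4, dot_boundary_three, neg_neg]
  simp only [evDualLoop, loopIntegral, h1, h2, mul_neg, ← sub_eq_add_neg]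

end Duality

/-! ### Transport to the dual lattice -/

section Dualize

variable {N : ℕ} {R : Type} [CommRing R] {r : ℕ}

/-- The site of the lattice at `x + ŝ/2`, for `x` in the dual lattice. -/
def ofDual (x : Site N true) : Site N false := ⟨x.coord + 1⟩

theorem ofDual_shift (x : Site N true) (v : Fin 4 → ZMod N) :
    ofDual (x.shift v) = (ofDual x).shift v := by
  simp only [ofDual, Site.shift, add_right_comm]

/-- The pullback of a form to the dual lattice along the translation by half a unit. -/
def dualize (α : Form N false r R) : Form N true r R := fun c => α (ofDual c.1, c.2)

theorem val_dualize (α : Form N false r R) (x : Site N true) (S : Finset (Fin 4)) :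
    val (dualize α) x S = val α (ofDual x) S := rfl

theorem extDeriv_dualize (α : Form N false r R) : extDeriv (dualize α) = dualize (extDeriv α) := by
  ext c
  simp only [extDeriv, dualize, val_dualize, ofDual_shift]

theorem boundary_dualize (α : Form N false (r + 1) R) :
    boundary (dualize α) = dualize (boundary α) := by
  ext c
  simp only [boundary, dualize, val_dualize, ofDual_shift]

theorem cup_dualize {p q : ℕ} (a : Form N false p R) (b : Form N false q R) :
    cup (dualize a) (dualize b) = dualize (cup a b) := by
  ext c
  simp only [cup, dualize, val_dualize, ofDual_shift]

/-- The reflections differ on the two lattices, but the explicit component formula contains only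
translations. -/
theorem cupOne_dualize {p q : ℕ} (a : Form N false (p + 1) R) (b : Form N false (q + 1) R) :
    cupOne (dualize a) (dualize b) = dualize (cupOne a b) := by
  refine form_ext fun x S hS => ?_
  rw [val_dualize, val_cupOne _ _ _ hS, val_cupOne _ _ _ hS]
  simp only [val_dualize, ofDual_shift]

theorem total_dualize [NeZero N] (α : Form N false 4 R) : total (dualize α) = total α := by
  simp only [total, val_dualize]
  exact Fintype.sum_equiv (⟨ofDual, fun x => ⟨x.coord - 1⟩, fun x => by simp [ofDual],
    fun x => by simp [ofDual]⟩ : Site N true ≃ Site N false) _ _ fun x => rfl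

theorem pontryagin_dualize [NeZero N] (l : Form N false 2 ℤ) :
    pontryagin (dualize l) = pontryagin l := by
  rw [pontryagin, pontryagin, extDeriv_dualize, cup_dualize, cupOne_dualize]
  exact congrArg₂ _ (total_dualize _) (total_dualize _)

theorem projBoundary_dualize [NeZero N] (a : Form N false 2 ℝ) :
    projBoundary (dualize a) = dualize (projBoundary a) := by
  obtain ⟨y, hy⟩ := exists_projBoundary_eq a
  refine projBoundary_eq_of_boundary (y := dualize y) (by rw [hy, boundary_dualize]) ?_
  have h : dualize a - dualize (projBoundary a) = dualize (a - projBoundary a) := rfl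
  rw [h, extDeriv_dualize, extDeriv_sub_projBoundary]
  rfl

theorem uNumber_dualize [NeZero N] (l : Form N false 2 ℤ) : uNumber (dualize l) = uNumber l := by
  have h : toReal (dualize l) = dualize (toReal l) := rfl
  rw [uNumber, uNumber, h, projBoundary_dualize, extDeriv_dualize, cupOne_dualize]
  exact total_dualize _

theorem tangent_eq_of_isMonopoleSolution {half : Bool} [NeZero N] {γ : Contour N half}
    {l : Form N half 2 ℤ} (hl : IsMonopoleSolution γ l) :
    γ.tangent = (-Framing.plain.sign) • hodge .plain 1 (extDeriv l) := by
  refine form_ext fun x S hS => ?_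
  obtain ⟨μ, rfl⟩ := Finset.card_eq_one.1 hS
  have h := hl x μ
  rw [val_smul, val_hodge _ _ _ hS]
  simp only [Framing.sign, Framing.cellSign, Framing.offset, Int.cast_id]
  linarith

theorem val_tangent_toDual (γ : Contour N false) (x : Site N true) (S : Finset (Fin 4)) :
    val γ.toDual.tangent x S = val γ.tangent ⟨x.coord⟩ S := by
  have key : ∀ y : Site N false, Villain.toDual y = x ↔ y = ⟨x.coord⟩ := by
    rintro ⟨y⟩
    obtain ⟨x⟩ := x
    simp [Villain.toDual]
  by_cases hS : S.card = 1
  · rw [val_of_card _ _ hS, val_of_card _ _ hS]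
    simp only [Contour.tangent, Contour.toDual, List.countP_map, Function.comp_def,
      OrientedLink.target_toDual]
    simp only [OrientedLink.toDual, key]
  · rw [val_of_card_ne _ _ hS, val_of_card_ne _ _ hS]

theorem shuffleSign_compl_singleton (μ : Fin 4) :
    shuffleSign {μ}ᶜ {μ} = -shuffleSign {μ} {μ}ᶜ := by
  revert μ
  decide

theorem tangent_toDual_eq_of_isMonopoleSolution [NeZero N] {γ : Contour N false}
    {l : Form N false 2 ℤ} (hl : IsMonopoleSolution γ l) :
    γ.toDual.tangent = (-Framing.dual.sign) • hodge .dual 1 (extDeriv (dualize l)) := by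
  refine form_ext fun x S hS => ?_
  obtain ⟨μ, rfl⟩ := Finset.card_eq_one.1 hS
  have h := hl ⟨x.coord⟩ μ
  -- The identity `ŝ - ∑_{ν ≠ μ} ν̂ = μ̂`: `F` followed by the half-unit pullback is a translation
  -- by `ŝ`, which corrects the offset of the reversed pairing.
  have hx : (ofDual x).shift (-dirs N {μ}ᶜ) = (⟨x.coord⟩ : Site N false).shift (dirs N {μ}) := by
    refine site_ext fun i => ?_
    by_cases hi : i = μ <;> simp [ofDual, Site.shift, dirs, hi]
  rw [val_smul, val_hodge _ _ _ hS, extDeriv_dualize, val_dualize, ofDual_shift, val_tangent_toDual]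
  simp only [Framing.sign, Framing.cellSign, Framing.offset, Int.cast_id,
    shuffleSign_compl_singleton, hx]
  linarith

end Dualize

end

end Villain

/-! ### The duality relations in both framings -/

open Villain
theorem mainTheorem3 (N : ℕ) [NeZero N] (β θ : ℝ) (hβ : 0 < β) (p qe qm : ℤ)
    (γ : Contour N false) (l : Form N false 2 ℤ) (hl : IsMonopoleSolution γ l) :
    (LoopData.mk .plain ![qe, qm] β θ).ev γ p =
        Complex.exp (-Complex.I * uNumber l * π * complexCharge qe qm β θ ^ 2 / coupling β θ
          - 2 * π ^ 2 * uNumber l * (β * qm ^ 2 - dualBeta β θ * qe ^ 2)) *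
        (-1 : ℂ) ^ (p * pontryagin l * (qm ^ 2 + qe ^ 2)) *
        (LoopData.mk .plain ![qe, qm] β θ).sTransform.ev γ p ∧
    (LoopData.mk .dual ![qe, qm] β θ).ev γ p =
        Complex.exp (Complex.I * uNumber l * π * complexCharge qe qm β θ ^ 2 / coupling β θ
          + 2 * π ^ 2 * uNumber l * (β * qm ^ 2 - dualBeta β θ * qe ^ 2)) *
        (-1 : ℂ) ^ (p * pontryagin l * (qm ^ 2 + qe ^ 2)) *
        (LoopData.mk .dual ![qe, qm] β θ).sTransform.ev γ p ∧
    ∀ fr : Framing,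
      (LoopData.mk fr ![qe, qm] β θ).sTransform =
        LoopData.mk fr ![qm, -qe] (dualBeta β θ) (dualTheta β θ) ∧
      (![qm, -qe] : Fin 2 → ℤ) = Matrix.mulVec !![0, 1; -1, 0] ![qe, qm] := by
  have htr : ∀ fr : Framing, (LoopData.mk fr ![qe, qm] β θ).sTransform =
      LoopData.mk fr ![qm, -qe] (dualBeta β θ) (dualTheta β θ) := fun fr => by
    cases fr <;> rfl
  refine ⟨?_, ?_, fun fr => ⟨htr fr, ?_⟩⟩
  · have hg := tangent_eq_of_isMonopoleSolution hl
    have h := loopIntegral_duality .plain hg p qe qm hβ θ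
    rw [← evLoop_eq hg, ← evLoop_eq hg] at h
    rw [htr]
    simpa [LoopData.ev, framedNumber, Framing.sign] using h
  · have hg := tangent_toDual_eq_of_isMonopoleSolution hl
    have h := loopIntegral_duality .dual hg p qe qm hβ θ
    -- The dual framing carries `-u`, which reverses the sign of the exponent; `u` and `𝔓(l)` are
    -- unchanged by the transport of `l`.
    rw [← evDualLoop_eq hg, ← evDualLoop_eq hg, pontryagin_dualize, framedNumber,
      uNumber_dualize] at h
    rw [htr]
    refine h.trans ?_
    congr 3
    simp only [Framing.sign]
    push_cast
    ring
  · ext i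
    fin_cases i <;> simp [Matrix.mulVec, dotProduct, Fin.sum_univ_two]
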